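/- Let $k$ be a finite field with algebraic closure $\bar k$, let $\hat G=\mathrm{Gal}(\bar k/k)$ with its Krull topology, let $\varphi\in\hat G$ be the Frobenius automorphism and $G=\langle\varphi\rangle\subset\hat G$ the Weil group. Let $X$ be a $k$-scheme, and let $\mathcal E$ be a full subcategory of the category of $X$-schemes whose objects are separated and of finite type over $k$, such that $U\in\mathcal E$ whenever $U$ is separated over $k$ and admits an étale $X$-morphism of finite type to some $Y\in\mathcal E$. (For $X=\operatorname{Spec}k$, $\mathcal E$ can be, for example, all separated schemes of finite type over $k$, or all smooth ones; for $X$ separated and of finite type over $k$ it can be the small étale site of $X$.) Let $\bar{\mathcal E}$ be the full subcategory of schemes over $X\times_k\bar k$ whose objects are the connected components of the base changes $Y\times_k\bar k$, $Y\in\mathcal E$, with the étale topology. For $g\in\hat G$ and $U\in\bar{\mathcal E}$ put $gU=U\times_{\bar k,g^{-1}}\bar k\in\bar{\mathcal E}$, and for a sheaf $\mathcal F$ of abelian groups on $\bar{\mathcal E}$ put $(g^*\mathcal F)(U)=\mathcal F(gU)$. An action of a subgroup $\Gamma\subseteq\hat G$ on $\mathcal F$ is a family of isomorphisms $\sigma_g:\mathcal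 F\to g^*\mathcal F$ $(g\in\Gamma)$ with $\sigma_{gh}=h^*\sigma_g\circ\sigma_h$; morphisms are those that commute with the $\sigma_g$. If $U$ has a model $U'$ over a finite extension $K\subset\bar k$ of $k$, i.e. $U=U'\times_K\bar k$, then an action of $\hat G$ on $\mathcal F$ gives an action of $\mathrm{Gal}(\bar k/K)$ on $\mathcal F(U)$; the action of $\hat G$ is continuous if for every $U\in\bar{\mathcal E}$ and every such model the map $\mathrm{Gal}(\bar k/K)\times\mathcal F(U)\to\mathcal F(U)$ is continuous for the discrete topology on $\mathcal F(U)$. Let $\mathcal T_{\hat G}$ (étale sheaves) be the category of sheaves of abelian groups on $\bar{\mathcal E}$ with continuous $\hat G$-action, and $\mathcal T_G$ (Weil-étale sheaves) the category of sheaves of abelian groups on $\bar{\mathcal E}$ with $G$-action. Let $\gamma^*:\mathcal T_{\hat G}\to\mathcal T_G$ be the functor restricting the action to $G$. Let $D(\mathcal T_{\hat G})$ and $D(\mathcal T_G)$ be the unbounded derived categories. On $\mathcal T_{\hat G}$ let $\otimes$ be the sheafified tensor product over $\mathbb Z$ with diagonal action, and $\otimes^L$ its derived functor, computed by representing one of the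 factors by a K-flat complex. Then $\gamma^*$ has a right adjoint $\gamma_*$; the total right derived functor $R\gamma_*:D(\mathcal T_G)\to D(\mathcal T_{\hat G})$ of $\gamma_*$ on unbounded complexes exists; and for every (possibly unbounded) complex $\mathcal G^\cdot$ in $\mathcal T_{\hat G}$ there is an isomorphism in $D(\mathcal T_{\hat G})$ (a quasi-isomorphism) $$R\gamma_*\mathbb Z\otimes^L\mathcal G^\cdot\;\cong\;R\gamma_*(\gamma^*\mathcal G^\cdot),$$ where $\mathbb Z$ is the constant sheaf with trivial $G$-action, placed in degree $0$. -/

import Mathlib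

open CategoryTheory CategoryTheory.Limits AlgebraicGeometry Opposite
universe u
noncomputable section
namespace WeilEtale

lemma action_mul_aux {C A : Type*} [Category* C] [Category* A] {Tg Th Tgh : C ⥤ C}
    (m : Tgh ⟶ Th ⋙ Tg) {P Q : Cᵒᵖ ⥤ A} {s : P ⟶ Q} {τg : P ⟶ Tg.op ⋙ P} {τh : P ⟶ Th.op ⋙ P}
    {σg : Q ⟶ Tg.op ⋙ Q} {σh : Q ⟶ Th.op ⋙ Q}
    (hg : s ≫ σg = τg ≫ Functor.whiskerLeft Tg.op s)
    (hh : s ≫ σh = τh ≫ Functor.whiskerLeft Th.op s) :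
    (τh ≫ Functor.whiskerLeft Th.op τg ≫ Functor.whiskerRight (NatTrans.op m) P) ≫
        Functor.whiskerLeft Tgh.op s =
      s ≫ σh ≫ Functor.whiskerLeft Th.op σg ≫ Functor.whiskerRight (NatTrans.op m) Q := by
  ext U
  have h1 := congrArg (fun t => t.app U) hh
  have h2 := congrArg (fun t => t.app (op (Th.obj U.unop))) hg
  have h3 := s.naturality (m.app U.unop).op
  simp only [NatTrans.comp_app, Functor.whiskerLeft_app, Functor.op_obj] at h1 h2
  simp only [NatTrans.comp_app, Functor.whiskerLeft_app, Functor.whiskerRight_app, Functor.op_obj,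
    NatTrans.op_app, Category.assoc]
  rw [reassoc_of% h1, reassoc_of% h2]
  exact congrArg (fun t => τh.app U ≫ τg.app (op (Th.obj U.unop)) ≫ t) h3

lemma action_comm_aux {C A : Type*} [Category* C] [Category* A] {T : C ⥤ C}
    {P P' Q Q' : Cᵒᵖ ⥤ A} {φ : P ⟶ P'} {ψ : Q ⟶ Q'} {s : P ⟶ Q} {s' : P' ⟶ Q'}
    {τ : P ⟶ T.op ⋙ P} {τ' : P' ⟶ T.op ⋙ P'} {σ : Q ⟶ T.op ⋙ Q} {σ' : Q' ⟶ T.op ⋙ Q'}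
    (hφ : τ ≫ Functor.whiskerLeft T.op φ = φ ≫ τ') (h : s ≫ σ = τ ≫ Functor.whiskerLeft T.op s)
    (h' : s' ≫ σ' = τ' ≫ Functor.whiskerLeft T.op s') (hs : s ≫ ψ = φ ≫ s') :
    s ≫ σ ≫ Functor.whiskerLeft T.op ψ = s ≫ ψ ≫ σ' := by
  rw [reassoc_of% h, reassoc_of% hs, h', ← reassoc_of% hφ, ← Functor.whiskerLeft_comp, hs,
    Functor.whiskerLeft_comp]

variable (k : Type u) [Field k]

/-- The absolute Galois group of `k`, with its Krull topology. -/
abbrev GHat : Type u := Gal(AlgebraicClosure k/k)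

/-- The Frobenius automorphism `x ↦ x ^ #k` of the algebraic closure. -/
def frobenius [Fintype k] : GHat k :=
  FiniteField.frobeniusAlgEquivOfAlgebraic k (AlgebraicClosure k)

/-- The Weil group: the infinite cyclic subgroup of the Galois group generated by Frobenius. -/
def weilGroup [Fintype k] : Subgroup (GHat k) := Subgroup.zpowers (frobenius k)

variable {k}

/-- The structure morphism of the spectrum of the algebraic closure. -/
abbrev geomPoint (k : Type u) [Field k] :
    Spec (.of (AlgebraicClosure k)) ⟶ Spec (.of k) :=
  Spec.map (CommRingCat.ofHom (algebraMap k (AlgebraicClosure k)))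

/-- The left action of the Galois group on the spectrum of the algebraic closure `k̄`: on
functions `g` is `g⁻¹`. -/
def specAct (g : GHat k) : Spec (.of (AlgebraicClosure k)) ⟶ Spec (.of (AlgebraicClosure k)) :=
  Spec.map (CommRingCat.ofHom (g⁻¹ : GHat k).toRingEquiv.toRingHom)

lemma specAct_geomPoint (g : GHat k) : specAct g ≫ geomPoint k = geomPoint k := by
  rw [specAct, geomPoint, ← Spec.map_comp, ← CommRingCat.ofHom_comp]
  congr 2
  ext x
  simp

lemma specAct_one : specAct (1 : GHat k) = 𝟙 _ := by
  rw [specAct, ← Spec.map_id]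
  congr 1

lemma specAct_mul (g h : GHat k) : specAct (g * h) = specAct h ≫ specAct g := by
  rw [specAct, specAct, specAct, ← Spec.map_comp, ← CommRingCat.ofHom_comp]
  congr 2

variable {X : Scheme.{u}} (p : X ⟶ Spec (.of k))

/-- The base change of `X` to the algebraic closure. -/
abbrev geomFibre : Scheme.{u} := pullback p (geomPoint k)

/-- The action of `g` on `X ×_k k̄` through the second factor. -/
def act (g : GHat k) : geomFibre p ⟶ geomFibre p :=
  pullback.lift (pullback.fst _ _) (pullback.snd _ _ ≫ specAct g)
    (by rw [Category.assoc, specAct_geomPoint, pullback.condition])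

@[simp]
lemma act_fst (g : GHat k) : act p g ≫ pullback.fst _ _ = pullback.fst _ _ :=
  pullback.lift_fst _ _ _

@[simp]
lemma act_snd (g : GHat k) : act p g ≫ pullback.snd _ _ = pullback.snd _ _ ≫ specAct g :=
  pullback.lift_snd _ _ _

@[simp]
lemma act_fst_assoc (g : GHat k) {Z : Scheme.{u}} (f : X ⟶ Z) :
    act p g ≫ pullback.fst _ _ ≫ f = pullback.fst _ _ ≫ f := by
  rw [← Category.assoc, act_fst]

@[simp]
lemma act_snd_assoc (g : GHat k) {Z : Scheme.{u}} (f : Spec (.of (AlgebraicClosure k)) ⟶ Z) :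
    act p g ≫ pullback.snd _ _ ≫ f = pullback.snd _ _ ≫ specAct g ≫ f := by
  rw [← Category.assoc, act_snd, Category.assoc]

lemma act_one : act p (1 : GHat k) = 𝟙 _ := by
  apply pullback.hom_ext <;> simp [specAct_one]

lemma act_mul (g h : GHat k) : act p (g * h) = act p h ≫ act p g := by
  apply pullback.hom_ext <;> simp [specAct_mul]

variable (E : ObjectProperty (Over X))

/-- A scheme over `X ×_k k̄` which is a connected component of the base change `Y ×_k k̄` (written as
`Y ×_X (X ×_k k̄)`) of some `Y` in `E`. A connected component is non-empty; it is given as an open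
subscheme, which is the standard scheme structure since the components are open here. -/
def isGeomComponent : ObjectProperty (Over (geomFibre p)) := fun U =>
  ∃ Y : Over X, E Y ∧ ∃ i : U ⟶ (Over.pullback (pullback.fst p (geomPoint k))).obj Y,
    IsOpenImmersion i.left ∧ ∃ y, Set.range i.left = connectedComponent y

lemma isGeomComponent_act (g : GHat k) (U : Over (geomFibre p))
    (hU : isGeomComponent p E U) : isGeomComponent p E ((Over.map (act p g)).obj U) := by
  obtain ⟨Y, hY, i, hi, y, hy⟩ := hU
  let P := (Over.pullback (pullback.fst p (geomPoint k))).obj Y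
  let t : ∀ g : GHat k, P.left ⟶ P.left := fun g =>
    pullback.lift (pullback.fst Y.hom (pullback.fst p (geomPoint k)))
      (pullback.snd Y.hom (pullback.fst p (geomPoint k)) ≫ act p g) (by
      rw [Category.assoc, act_fst, pullback.condition])
  have tfst : ∀ g, t g ≫ pullback.fst Y.hom (pullback.fst p (geomPoint k)) =
      pullback.fst Y.hom (pullback.fst p (geomPoint k)) := fun g => pullback.lift_fst _ _ _
  have tsnd : ∀ g, t g ≫ pullback.snd Y.hom (pullback.fst p (geomPoint k)) =
      pullback.snd Y.hom (pullback.fst p (geomPoint k)) ≫ act p g := fun g =>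
    pullback.lift_snd _ _ _
  have htt : ∀ g h, t g ≫ t h = t (h * g) := by
    intro g h
    apply pullback.hom_ext
    · rw [Category.assoc, tfst, tfst, tfst]
    · rw [Category.assoc, tsnd, reassoc_of% (tsnd g), tsnd, act_mul]
  have ht1 : t 1 = 𝟙 _ := by
    apply pullback.hom_ext
    · rw [tfst, Category.id_comp]
    · rw [tsnd, act_one, Category.id_comp, Category.comp_id]
  let e : P.left ≅ P.left := ⟨t g, t g⁻¹, by rw [htt, inv_mul_cancel, ht1], by
    rw [htt, mul_inv_cancel, ht1]⟩
  refine ⟨Y, hY, Over.homMk (i.left ≫ e.hom) ?_, ?_, e.hom y, ?_⟩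
  · have := Over.w i
    change (i.left ≫ t g) ≫ pullback.snd Y.hom (pullback.fst p (geomPoint k)) = U.hom ≫ act p g
    rw [Category.assoc, tsnd, ← this]
    rfl
  · have h1 : IsIso e.hom := e.isIso_hom
    have h2 : IsOpenImmersion e.hom := IsOpenImmersion.of_isIso e.hom
    exact IsOpenImmersion.comp (f := i.left) (g := e.hom)
  · change Set.range (i.left ≫ e.hom : U.left ⟶ P.left) = _
    have h := (Scheme.homeoOfIso e).image_connectedComponentIn (Set.mem_univ y)
    rw [Set.image_univ, (Scheme.homeoOfIso e).surjective.range_eq, connectedComponentIn_univ,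
      connectedComponentIn_univ, ← hy, ← Set.range_comp] at h
    exact h

/-- The category `Ē`: connected components of base changes to `k̄` of objects of `E`. -/
abbrev Ebar : Type (u + 1) := (isGeomComponent p E).FullSubcategory

/-- The functor `U ↦ gU = U ×_{k̄, g⁻¹} k̄`. As base change along an isomorphism does not change the
scheme, `gU` is `U` with its structure morphism composed with the action of `g`. -/
def twist (g : GHat k) : Ebar p E ⥤ Ebar p E :=
  (isGeomComponent p E).lift ((isGeomComponent p E).ι ⋙ Over.map (act p g))
    fun U => isGeomComponent_act p E g U.obj U.property

variable {p E} in
/-- A morphism of `Ē` from a morphism of schemes over `X ×_k k̄`. -/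
def homMk {U V : Ebar p E} (f : U.obj.left ⟶ V.obj.left) (w : f ≫ V.obj.hom = U.obj.hom) : U ⟶ V :=
  ⟨Over.homMk f w⟩

lemma comp_id_eq {S T : Scheme.{u}} (a : S ⟶ T) : a ≫ 𝟙 T = 𝟙 S ≫ a := by simp

lemma ebar_hom_ext {U V : Ebar p E} {f g : U ⟶ V} (h : f.hom.left = g.hom.left) : f = g := by
  apply (isGeomComponent p E).hom_ext
  exact Over.OverMorphism.ext h

/-- The canonical isomorphism `1U → U`. -/
def twistOne : twist p E 1 ⟶ 𝟭 (Ebar p E) where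
  app U := homMk (𝟙 U.obj.left) (show 𝟙 U.obj.left ≫ U.obj.hom = U.obj.hom ≫ act p 1 by
    rw [act_one, Category.comp_id, Category.id_comp])
  naturality U V f := ebar_hom_ext p E (comp_id_eq f.hom.left)

/-- The canonical isomorphism `(gh)U → g(hU)`. -/
def twistMul (g h : GHat k) : twist p E (g * h) ⟶ twist p E h ⋙ twist p E g where
  app U := homMk (𝟙 U.obj.left) (show 𝟙 U.obj.left ≫ (U.obj.hom ≫ act p h) ≫ act p g =
      U.obj.hom ≫ act p (g * h) by
    rw [act_mul, Category.id_comp, Category.assoc])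
  naturality U V f := ebar_hom_ext p E (comp_id_eq f.hom.left)

/-- The étale topology on `Ē`: a sieve on `U` is covering if jointly surjective étale morphisms
belong to it, and likewise after every `V ⟶ U` (for a category closed under étale morphisms the
clause about `V` follows from the case `V = U`). -/
def etaleTopology : GrothendieckTopology (Ebar p E) where
  sieves U := {S | ∀ ⦃V : Ebar p E⦄ (f : V ⟶ U) (x : V.obj.left),
    ∃ (W : Ebar p E) (j : W ⟶ V), Etale j.hom.left ∧ x ∈ Set.range j.hom.left ∧ S (j ≫ f)}
  top_mem' U V f x := ⟨V, 𝟙 V, by change Etale (𝟙 _); infer_instance, ⟨x, rfl⟩, trivial⟩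
  pullback_stable' U U' S q hS V f x := by
    obtain ⟨W, j, h1, h2, h3⟩ := hS (f ≫ q) x
    exact ⟨W, j, h1, h2, by simpa using h3⟩
  transitive' U S hS R hR V f x := by
    obtain ⟨W, j, h1, ⟨y, rfl⟩, h3⟩ := hS f x
    obtain ⟨W', j', h1', ⟨z, rfl⟩, h3'⟩ := hR h3 (𝟙 W) y
    refine ⟨W', j' ≫ j, ?_, ⟨z, rfl⟩, by simpa using h3'⟩
    exact inferInstanceAs (Etale (j'.hom.left ≫ j.hom.left))

variable {p E} in
def untwistHom {g : GHat k} {V U : Ebar p E} (f : V ⟶ (twist p E g).obj U) :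
    (twist p E g⁻¹).obj V ⟶ U :=
  homMk f.hom.left (by
    have key : ∀ a : V.obj.left ⟶ U.obj.left, a ≫ U.obj.hom ≫ act p g = V.obj.hom →
        a ≫ U.obj.hom = V.obj.hom ≫ act p g⁻¹ := fun a ha => by
      rw [← ha, Category.assoc, Category.assoc, ← act_mul, inv_mul_cancel, act_one,
        Category.comp_id]
    exact key _ (Over.w f.hom))

variable {p E} in
def fromTwistTwistInv (g : GHat k) (V : Ebar p E) :
    (twist p E g).obj ((twist p E g⁻¹).obj V) ⟶ V :=
  homMk (𝟙 V.obj.left) (show 𝟙 V.obj.left ≫ V.obj.hom = (V.obj.hom ≫ act p g⁻¹) ≫ act p g by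
    rw [Category.assoc, ← act_mul, mul_inv_cancel, act_one, Category.comp_id, Category.id_comp])
variable {p E} in
def toTwistTwistInv (g : GHat k) (V : Ebar p E) :
    V ⟶ (twist p E g).obj ((twist p E g⁻¹).obj V) :=
  homMk (𝟙 V.obj.left) (show 𝟙 V.obj.left ≫ (V.obj.hom ≫ act p g⁻¹) ≫ act p g = V.obj.hom by
    rw [Category.assoc, ← act_mul, mul_inv_cancel, act_one, Category.comp_id, Category.id_comp])

instance (g : GHat k) : (twist p E g).Faithful where
  map_injective h := ebar_hom_ext _ _ (congrArg (fun t => t.hom.left) h)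

instance (g : GHat k) : (twist p E g).Full where
  map_surjective {U V} f := by
    have key : ∀ a : U.obj.left ⟶ V.obj.left, a ≫ V.obj.hom ≫ act p g = U.obj.hom ≫ act p g →
        a ≫ V.obj.hom = U.obj.hom := fun a ha => by
      have h2 := congrArg (fun t => t ≫ act p g⁻¹) ha
      simpa only [Category.assoc, ← act_mul, inv_mul_cancel, act_one, Category.comp_id] using h2
    refine ⟨homMk f.hom.left (key _ (Over.w f.hom)), ?_⟩
    · apply ebar_hom_ext; rfl

instance (g : GHat k) : (twist p E g).IsContinuous (etaleTopology p E) (etaleTopology p E) := by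
  apply Functor.isContinuous_of_coverPreserving
  · apply compatiblePreservingOfDownwardsClosed
    intro U V f
    refine ⟨(twist p E g⁻¹).obj V, ⟨fromTwistTwistInv g V, toTwistTwistInv g V, ?_, ?_⟩⟩
    · apply ebar_hom_ext; exact Category.id_comp _
    · apply ebar_hom_ext; exact Category.id_comp _
  · constructor
    intro U S hS V f x
    obtain ⟨W, j, h1, h2, h3⟩ := hS (untwistHom f) x
    refine ⟨(twist p E g).obj W, (twist p E g).map j ≫ fromTwistTwistInv g V, ?_, ?_, ?_⟩
    · have h : ∀ a : W.obj.left ⟶ V.obj.left, Etale a → Etale (a ≫ 𝟙 V.obj.left) := fun a ha => by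
        rwa [Category.comp_id]
      exact h _ h1
    · exact h2
    · refine ⟨W, j ≫ untwistHom f, 𝟙 _, h3, ?_⟩
      apply ebar_hom_ext
      change (j.hom.left ≫ 𝟙 _) ≫ f.hom.left = 𝟙 _ ≫ j.hom.left ≫ f.hom.left
      simp


/-- Étale sheaves of abelian groups on `Ē`. The coefficients are one universe above the schemes,
the universe of the essentially small category `Ē`. -/
abbrev AbSheaf : Type (u + 2) := Sheaf (etaleTopology p E) AddCommGrpCat.{u + 1}

/-- The functor `g^*`, with `(g^* F)(U) = F(gU)`. -/
abbrev pull (g : GHat k) : AbSheaf p E ⥤ AbSheaf p E :=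
  (twist p E g).sheafPushforwardContinuous AddCommGrpCat.{u + 1}
    (etaleTopology p E) (etaleTopology p E)

/-- The identification of `F` with `1^* F`. -/
def pullOne : 𝟭 (AbSheaf p E) ⟶ pull p E 1 where
  app F := ⟨Functor.whiskerRight (NatTrans.op (twistOne p E)) F.obj⟩
  naturality F F' f := by
    apply Sheaf.hom_ext
    ext U : 2
    exact (f.hom.naturality _).symm

/-- The identification of `h^* g^* F` with `(gh)^* F`. -/
def pullMul (g h : GHat k) : pull p E g ⋙ pull p E h ⟶ pull p E (g * h) where
  app F := ⟨Functor.whiskerRight (NatTrans.op (twistMul p E g h)) F.obj⟩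
  naturality F F' f := by
    apply Sheaf.hom_ext
    ext U : 2
    exact (f.hom.naturality _).symm

instance (g : GHat k) : (pull p E g).Additive where
  map_add := rfl

/-- A sheaf of abelian groups on `Ē` with an action of `Γ`: morphisms `σ_g : F → g^* F` with
`σ_1 = id` and `σ_{gh} = h^* σ_g ∘ σ_h`. They are automatically isomorphisms. -/
structure EqSheaf (Γ : Subgroup (GHat k)) where
  sheaf : AbSheaf p E
  σ (g : Γ) : sheaf ⟶ (pull p E g).obj sheaf
  σ_one : σ 1 = (pullOne p E).app sheaf
  σ_mul (g h : Γ) : σ (g * h) = σ h ≫ (pull p E h).map (σ g) ≫ (pullMul p E g h).app sheaf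

variable {p E}

namespace EqSheaf

variable {Γ : Subgroup (GHat k)}

/-- Morphisms of sheaves commuting with the actions. -/
@[ext]
structure Hom (F F' : EqSheaf p E Γ) where
  hom : F.sheaf ⟶ F'.sheaf
  comm (g : Γ) : F.σ g ≫ (pull p E g).map hom = hom ≫ F'.σ g

instance : Category (EqSheaf p E Γ) where
  Hom := Hom
  id F := ⟨𝟙 _, fun g => by rw [CategoryTheory.Functor.map_id, Category.comp_id, Category.id_comp]⟩
  comp f f' := ⟨f.hom ≫ f'.hom, fun g => by
    rw [Functor.map_comp, reassoc_of% f.comm, f'.comm, Category.assoc]⟩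
  id_comp f := Hom.ext (Category.id_comp _)
  comp_id f := Hom.ext (Category.comp_id _)
  assoc f f' f'' := Hom.ext (Category.assoc _ _ _)

@[ext]
lemma hom_ext {F F' : EqSheaf p E Γ} {f f' : F ⟶ F'} (h : f.hom = f'.hom) : f = f' := Hom.ext h

@[simp] lemma id_hom (F : EqSheaf p E Γ) : (𝟙 F : F ⟶ F).hom = 𝟙 F.sheaf := rfl
@[simp] lemma comp_hom {F F' F'' : EqSheaf p E Γ} (f : F ⟶ F') (f' : F' ⟶ F'') :
    (f ≫ f').hom = f.hom ≫ f'.hom := rfl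

variable {F F' : EqSheaf p E Γ}

instance : Zero (F ⟶ F') := ⟨⟨0, fun g => by simp⟩⟩
instance : Add (F ⟶ F') := ⟨fun f f' => ⟨f.hom + f'.hom, fun g => by
  rw [Functor.map_add, Preadditive.comp_add, Preadditive.add_comp, f.comm, f'.comm]⟩⟩
instance : Neg (F ⟶ F') := ⟨fun f => ⟨-f.hom, fun g => by
  rw [Functor.map_neg, Preadditive.comp_neg, Preadditive.neg_comp, f.comm]⟩⟩
instance : Sub (F ⟶ F') := ⟨fun f f' => ⟨f.hom - f'.hom, fun g => by
  rw [Functor.map_sub, Preadditive.comp_sub, Preadditive.sub_comp, f.comm, f'.comm]⟩⟩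
instance : SMul ℕ (F ⟶ F') := ⟨fun n f => ⟨n • f.hom, fun g => by
  rw [Functor.map_nsmul, Preadditive.comp_nsmul, Preadditive.nsmul_comp, f.comm]⟩⟩
instance : SMul ℤ (F ⟶ F') := ⟨fun n f => ⟨n • f.hom, fun g => by
  rw [Functor.map_zsmul, Preadditive.comp_zsmul, Preadditive.zsmul_comp, f.comm]⟩⟩

instance : AddCommGroup (F ⟶ F') :=
  Function.Injective.addCommGroup (Hom.hom : (F ⟶ F') → (F.sheaf ⟶ F'.sheaf))
    (fun _ _ h => Hom.ext h) rfl (fun _ _ => rfl) (fun _ => rfl) (fun _ _ => rfl)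
    (fun _ _ => rfl) (fun _ _ => rfl)

instance : Preadditive (EqSheaf p E Γ) where
  add_comp _ _ _ _ _ _ := Hom.ext (Preadditive.add_comp _ _ _ _ _ _)
  comp_add _ _ _ _ _ _ := Hom.ext (Preadditive.comp_add _ _ _ _ _ _)

variable (p E Γ) in
/-- The functor forgetting the action. -/
def forget : EqSheaf p E Γ ⥤ AbSheaf p E where
  obj F := F.sheaf
  map f := f.hom

instance : (forget p E Γ).Additive where
  map_add := rfl

instance : HasColimitsOfSize.{0, 0} AddCommGrpCat.{u + 1} := hasColimitsOfSizeShrink.{0, 0, u+1, u+1} _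
instance : HasColimitsOfSize.{0, 0} (AbSheaf p E) := inferInstance
instance : HasZeroObject (AbSheaf p E) := inferInstance
instance : CategoryWithHomology (AbSheaf p E) := inferInstance

instance (ι : Type) : HasColimitsOfShape (Discrete.{0} ι) (AbSheaf p E) := HasColimitsOfSize.has_colimits_of_shape _
instance (ι : Type) (A : ι → AbSheaf p E) : HasCoproduct A := HasColimitsOfShape.has_colimit _

section coproduct
variable {ι : Type} (A : ι → EqSheaf p E Γ)

/-- The direct sum of a family of sheaves with action. -/
def coprod : EqSheaf p E Γ where
  sheaf := ∐ fun i => (A i).sheaf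
  σ g := Sigma.desc fun i => (A i).σ g ≫ (pull p E g).map (Sigma.ι (fun i => (A i).sheaf) i)
  σ_one := by
    apply Sigma.hom_ext
    intro i
    rw [Sigma.ι_desc, (A i).σ_one]
    exact ((pullOne p E).naturality (Sigma.ι (fun i => (A i).sheaf) i)).symm
  σ_mul g h := by
    apply Sigma.hom_ext
    intro i
    have h2 : (pull p E h).map ((pull p E g).map (Sigma.ι (fun i => (A i).sheaf) i)) ≫
        (pullMul p E g h).app _ = (pullMul p E g h).app _ ≫
          (pull p E (g * h : Γ)).map (Sigma.ι (fun i => (A i).sheaf) i) :=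
      (pullMul p E g h).naturality (Sigma.ι (fun i => (A i).sheaf) i)
    rw [Sigma.ι_desc, Sigma.ι_desc_assoc, (A i).σ_mul, Category.assoc, Category.assoc,
      Category.assoc, ← h2, ← Functor.map_comp_assoc, ← Functor.map_comp_assoc, Sigma.ι_desc]

def coprodι (i : ι) : A i ⟶ coprod A where
  hom := Sigma.ι (fun i => (A i).sheaf) i
  comm g := (Sigma.ι_desc (fun i => (A i).σ g ≫
    (pull p E g).map (Sigma.ι (fun i => (A i).sheaf) i)) i).symm

variable {A} in
def coprodDesc {B : EqSheaf p E Γ} (f : ∀ i, A i ⟶ B) : coprod A ⟶ B where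
  hom := Sigma.desc fun i => (f i).hom
  comm g := by
    have key : (Sigma.desc fun i => (A i).σ g ≫
        (pull p E g).map (Sigma.ι (fun i => (A i).sheaf) i)) ≫
          (pull p E g).map (Sigma.desc fun i => (f i).hom) =
        (Sigma.desc fun i => (f i).hom) ≫ B.σ g := by
      apply Sigma.hom_ext
      intro i
      rw [Sigma.ι_desc_assoc, Sigma.ι_desc_assoc, Category.assoc, ← CategoryTheory.Functor.map_comp,
        Sigma.ι_desc, (f i).comm]
    exact key

lemma coprodι_desc {B : EqSheaf p E Γ} (f : ∀ i, A i ⟶ B) (i : ι) :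
    coprodι A i ≫ coprodDesc f = f i :=
  hom_ext (Sigma.ι_desc (fun i => (f i).hom) i)

lemma coprod_hom_ext {B : EqSheaf p E Γ} {f f' : coprod A ⟶ B}
    (h : ∀ i, coprodι A i ≫ f = coprodι A i ≫ f') : f = f' :=
  hom_ext (Sigma.hom_ext f.hom f'.hom fun i => congrArg Hom.hom (h i))

def coprodIsColimit : IsColimit (Cofan.mk (coprod A) (coprodι A)) :=
  Cofan.IsColimit.mk _ (fun s => coprodDesc s.inj) (fun s i => coprodι_desc A s.inj i)
    (fun s _ hm => coprod_hom_ext A fun i => (hm i).trans (coprodι_desc A s.inj i).symm)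

instance : HasCoproduct A := ⟨⟨⟨_, coprodIsColimit A⟩⟩⟩

end coproduct

instance : HasCoproducts.{0} (EqSheaf p E Γ) := fun _ =>
  { has_colimit := fun K => hasColimit_of_iso (F := Discrete.functor (fun i => K.obj ⟨i⟩))
      Discrete.natIsoFunctor }

instance : HasZeroObject (EqSheaf p E Γ) := by
  refine ⟨coprod (Empty.elim : Empty → EqSheaf p E Γ), ?_⟩
  rw [IsZero.iff_id_eq_zero]
  exact coprod_hom_ext _ (fun i => i.elim)

end EqSheaf

section sheafification
variable (p E)

/-- A presheaf of abelian groups on `Ē` with an action of `Γ`. -/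
structure EqPresheaf (Γ : Subgroup (GHat k)) where
  psh : (Ebar p E)ᵒᵖ ⥤ AddCommGrpCat.{u + 1}
  τ (g : Γ) : psh ⟶ (twist p E g).op ⋙ psh
  τ_one : τ 1 = Functor.whiskerRight (NatTrans.op (twistOne p E)) psh
  τ_mul (g h : Γ) : τ (g * h) = τ h ≫ Functor.whiskerLeft (twist p E h).op (τ g) ≫
    Functor.whiskerRight (NatTrans.op (twistMul p E g h)) psh

variable {p E} {Γ : Subgroup (GHat k)}

namespace EqPresheaf

lemma sheaf_hom_ext {P : (Ebar p E)ᵒᵖ ⥤ AddCommGrpCat.{u + 1}} {F : AbSheaf p E}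
    {f f' : (presheafToSheaf (etaleTopology p E) _).obj P ⟶ F}
    (h : toSheafify (etaleTopology p E) P ≫ f.hom = toSheafify (etaleTopology p E) P ≫ f'.hom) :
    f = f' :=
  Sheaf.hom_ext (sheafify_hom_ext _ _ _ F.property h)

/-- The sheafification of a presheaf with action, with the induced action. -/
def sheafify (P : EqPresheaf p E Γ) : EqSheaf p E Γ where
  sheaf := (presheafToSheaf (etaleTopology p E) _).obj P.psh
  σ g := ⟨sheafifyLift (etaleTopology p E)
    (P.τ g ≫ Functor.whiskerLeft (twist p E g).op (toSheafify (etaleTopology p E) P.psh))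
    ((pull p E g).obj ((presheafToSheaf (etaleTopology p E) _).obj P.psh)).property⟩
  σ_one := by
    apply sheaf_hom_ext
    refine (toSheafify_sheafifyLift _ _ _).trans ?_
    rw [P.τ_one]
    ext U : 2
    exact ((toSheafify (etaleTopology p E) P.psh).naturality _)
  σ_mul g h := by
    apply sheaf_hom_ext
    refine (toSheafify_sheafifyLift _ _ _).trans ?_
    rw [P.τ_mul]
    exact action_mul_aux (twistMul p E g h) (toSheafify_sheafifyLift _ _ _)
      (toSheafify_sheafifyLift _ _ _)

def sheafifyMap {P P' : EqPresheaf p E Γ} (φ : P.psh ⟶ P'.psh)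
    (hφ : ∀ g : Γ, P.τ g ≫ Functor.whiskerLeft (twist p E g).op φ = φ ≫ P'.τ g) :
    P.sheafify ⟶ P'.sheafify where
  hom := (presheafToSheaf (etaleTopology p E) _).map φ
  comm g := by
    apply sheaf_hom_ext
    exact action_comm_aux (hφ g) (toSheafify_sheafifyLift _ _ _) (toSheafify_sheafifyLift _ _ _)
      (toSheafify_naturality _ φ).symm

end EqPresheaf

end sheafification

/-- The tensor product of two homomorphisms of abelian groups. -/
def abTensorMap {A A' B B' : AddCommGrpCat.{u}} (f : A ⟶ A') (g : B ⟶ B') :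
    AddCommGrpCat.of (TensorProduct ℤ A B) ⟶ AddCommGrpCat.of (TensorProduct ℤ A' B') :=
  AddCommGrpCat.ofHom
    (TensorProduct.map f.hom.toIntLinearMap g.hom.toIntLinearMap).toAddMonoidHom

lemma ab_tensor_hom_ext {A B : AddCommGrpCat.{u}} {C : AddCommGrpCat.{u}}
    {f g : AddCommGrpCat.of (TensorProduct ℤ A B) ⟶ C}
    (h : ∀ (a : A) (b : B), f.hom (TensorProduct.tmul ℤ a b) = g.hom (TensorProduct.tmul ℤ a b)) :
    f = g := by
  apply AddCommGrpCat.hom_ext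
  ext x
  induction x using TensorProduct.induction_on with
  | zero => rw [map_zero, map_zero]
  | tmul a b => exact h a b
  | add x y hx hy => rw [map_add, map_add, hx, hy]

lemma abTensorMap_id (A B : AddCommGrpCat.{u}) : abTensorMap (𝟙 A) (𝟙 B) = 𝟙 _ :=
  ab_tensor_hom_ext fun _ _ => rfl

lemma abTensorMap_comp {A A' A'' B B' B'' : AddCommGrpCat.{u}} (f : A ⟶ A') (f' : A' ⟶ A'')
    (g : B ⟶ B') (g' : B' ⟶ B'') :
    abTensorMap f g ≫ abTensorMap f' g' = abTensorMap (f ≫ f') (g ≫ g') :=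
  ab_tensor_hom_ext fun _ _ => rfl

lemma abTensorMap_zero_left {A A' B B' : AddCommGrpCat.{u}} (g : B ⟶ B') :
    abTensorMap (0 : A ⟶ A') g = 0 :=
  ab_tensor_hom_ext fun _ b => TensorProduct.zero_tmul _ (g.hom b)

lemma abTensorMap_zero_right {A A' B B' : AddCommGrpCat.{u}} (f : A ⟶ A') :
    abTensorMap f (0 : B ⟶ B') = 0 :=
  ab_tensor_hom_ext fun a _ => TensorProduct.tmul_zero _ (f.hom a)

section
variable {C : Type*} [Category* C]

/-- The objectwise tensor product of presheaves of abelian groups. -/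
def pshTensor (P Q : Cᵒᵖ ⥤ AddCommGrpCat.{u}) : Cᵒᵖ ⥤ AddCommGrpCat.{u} where
  obj U := AddCommGrpCat.of (TensorProduct ℤ (P.obj U) (Q.obj U))
  map f := abTensorMap (P.map f) (Q.map f)
  map_id U := by rw [P.map_id, Q.map_id, abTensorMap_id]
  map_comp f g := by rw [P.map_comp, Q.map_comp, abTensorMap_comp]

def pshTensorMap {P P' Q Q' : Cᵒᵖ ⥤ AddCommGrpCat.{u}} (φ : P ⟶ P') (ψ : Q ⟶ Q') :
    pshTensor P Q ⟶ pshTensor P' Q' where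
  app U := abTensorMap (φ.app U) (ψ.app U)
  naturality U V f := by
    refine (abTensorMap_comp _ _ _ _).trans (Eq.trans ?_ (abTensorMap_comp _ _ _ _).symm)
    rw [φ.naturality, ψ.naturality]

lemma pshTensorMap_comp {P P' P'' Q Q' Q'' : Cᵒᵖ ⥤ AddCommGrpCat.{u}} (φ : P ⟶ P')
    (φ' : P' ⟶ P'') (ψ : Q ⟶ Q') (ψ' : Q' ⟶ Q'') :
    pshTensorMap φ ψ ≫ pshTensorMap φ' ψ' = pshTensorMap (φ ≫ φ') (ψ ≫ ψ') := by
  ext U : 2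
  exact abTensorMap_comp _ _ _ _

lemma pshTensorMap_id (P Q : Cᵒᵖ ⥤ AddCommGrpCat.{u}) : pshTensorMap (𝟙 P) (𝟙 Q) = 𝟙 _ := by
  ext U : 2
  exact abTensorMap_id _ _

lemma pshTensorMap_zero_left {P P' Q Q' : Cᵒᵖ ⥤ AddCommGrpCat.{u}} (ψ : Q ⟶ Q') :
    pshTensorMap (0 : P ⟶ P') ψ = 0 := by
  ext U : 2
  exact abTensorMap_zero_left _

lemma pshTensorMap_zero_right {P P' Q Q' : Cᵒᵖ ⥤ AddCommGrpCat.{u}} (φ : P ⟶ P') :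
    pshTensorMap φ (0 : Q ⟶ Q') = 0 := by
  ext U : 2
  exact abTensorMap_zero_right _

def pshTensorAct {T : C ⥤ C} {P Q : Cᵒᵖ ⥤ AddCommGrpCat.{u}} (τ : P ⟶ T.op ⋙ P)
    (τ' : Q ⟶ T.op ⋙ Q) : pshTensor P Q ⟶ T.op ⋙ pshTensor P Q where
  app U := abTensorMap (τ.app U) (τ'.app U)
  naturality _ _ f := (pshTensorMap τ τ').naturality f

lemma pshTensorAct_one {T : C ⥤ C} (m : T ⟶ 𝟭 C) {P Q : Cᵒᵖ ⥤ AddCommGrpCat.{u}}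
    {τ : P ⟶ T.op ⋙ P} {τ' : Q ⟶ T.op ⋙ Q}
    (h : τ = Functor.whiskerRight (NatTrans.op m) P)
    (h' : τ' = Functor.whiskerRight (NatTrans.op m) Q) :
    pshTensorAct τ τ' = Functor.whiskerRight (NatTrans.op m) (pshTensor P Q) := by
  subst h h'
  rfl

lemma pshTensorAct_mul {Tg Th Tgh : C ⥤ C} (m : Tgh ⟶ Th ⋙ Tg) {P Q : Cᵒᵖ ⥤ AddCommGrpCat.{u}}
    {τg : P ⟶ Tg.op ⋙ P} {τh : P ⟶ Th.op ⋙ P} {τgh : P ⟶ Tgh.op ⋙ P}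
    {σg : Q ⟶ Tg.op ⋙ Q} {σh : Q ⟶ Th.op ⋙ Q} {σgh : Q ⟶ Tgh.op ⋙ Q}
    (hP : τgh = τh ≫ Functor.whiskerLeft Th.op τg ≫ Functor.whiskerRight (NatTrans.op m) P)
    (hQ : σgh = σh ≫ Functor.whiskerLeft Th.op σg ≫ Functor.whiskerRight (NatTrans.op m) Q) :
    pshTensorAct τgh σgh = pshTensorAct τh σh ≫ Functor.whiskerLeft Th.op (pshTensorAct τg σg) ≫
      Functor.whiskerRight (NatTrans.op m) (pshTensor P Q) := by
  subst hP hQ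
  ext U : 2
  exact ((congrArg (fun t => abTensorMap (τh.app U) (σh.app U) ≫ t) (abTensorMap_comp
    (τg.app (op (Th.obj U.unop))) (P.map (m.app U.unop).op) (σg.app (op (Th.obj U.unop)))
    (Q.map (m.app U.unop).op))).trans (abTensorMap_comp _ _ _ _)).symm

lemma pshTensorAct_comm {T : C ⥤ C} {P P' Q Q' : Cᵒᵖ ⥤ AddCommGrpCat.{u}} {φ : P ⟶ P'}
    {ψ : Q ⟶ Q'} {τ : P ⟶ T.op ⋙ P} {τ' : P' ⟶ T.op ⋙ P'} {σ : Q ⟶ T.op ⋙ Q}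
    {σ' : Q' ⟶ T.op ⋙ Q'} (h : τ ≫ Functor.whiskerLeft T.op φ = φ ≫ τ')
    (h' : σ ≫ Functor.whiskerLeft T.op ψ = ψ ≫ σ') :
    pshTensorAct τ σ ≫ Functor.whiskerLeft T.op (pshTensorMap φ ψ) =
      pshTensorMap φ ψ ≫ pshTensorAct τ' σ' := by
  ext U : 2
  refine (abTensorMap_comp _ _ _ _).trans (Eq.trans ?_ (abTensorMap_comp _ _ _ _).symm)
  exact congrArg₂ abTensorMap (congrArg (fun t => t.app U) h) (congrArg (fun t => t.app U) h')
end

section tensor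

namespace EqSheaf

variable {Γ : Subgroup (GHat k)}

/-- The objectwise tensor product of sheaves with action, with the diagonal action. -/
def pshTensor (F F' : EqSheaf p E Γ) : EqPresheaf p E Γ where
  psh := WeilEtale.pshTensor F.sheaf.obj F'.sheaf.obj
  τ g := pshTensorAct (F.σ g).hom (F'.σ g).hom
  τ_one := pshTensorAct_one (twistOne p E)
    (congrArg (fun t => t.hom) F.σ_one) (congrArg (fun t => t.hom) F'.σ_one)
  τ_mul g h := pshTensorAct_mul (twistMul p E g h)
    (congrArg (fun t => t.hom) (F.σ_mul g h)) (congrArg (fun t => t.hom) (F'.σ_mul g h))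

def tensorMap {F₁ F₁' F₂ F₂' : EqSheaf p E Γ} (f₁ : F₁ ⟶ F₁') (f₂ : F₂ ⟶ F₂') :
    (F₁.pshTensor F₂).sheafify ⟶ (F₁'.pshTensor F₂').sheafify :=
  EqPresheaf.sheafifyMap (P := F₁.pshTensor F₂) (P' := F₁'.pshTensor F₂')
    (pshTensorMap f₁.hom.hom f₂.hom.hom) fun g => pshTensorAct_comm
      (congrArg (fun t => t.hom) (f₁.comm g)) (congrArg (fun t => t.hom) (f₂.comm g))

lemma tensorMap_id (F₁ F₂ : EqSheaf p E Γ) : tensorMap (𝟙 F₁) (𝟙 F₂) = 𝟙 _ :=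
  hom_ext ((congrArg (presheafToSheaf (etaleTopology p E) _).map (pshTensorMap_id _ _)).trans
    ((presheafToSheaf (etaleTopology p E) _).map_id _))

lemma tensorMap_comp {F₁ F₁' F₁'' F₂ F₂' F₂'' : EqSheaf p E Γ} (f₁ : F₁ ⟶ F₁') (f₁' : F₁' ⟶ F₁'')
    (f₂ : F₂ ⟶ F₂') (f₂' : F₂' ⟶ F₂'') :
    tensorMap (f₁ ≫ f₁') (f₂ ≫ f₂') = tensorMap f₁ f₂ ≫ tensorMap f₁' f₂' :=
  hom_ext ((congrArg (presheafToSheaf (etaleTopology p E) _).map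
    (pshTensorMap_comp _ _ _ _).symm).trans
    ((presheafToSheaf (etaleTopology p E) _).map_comp _ _))

variable (p E Γ) in
/-- The tensor product of sheaves with action: the sheaf associated to `U ↦ F(U) ⊗ F'(U)`, with the
diagonal action. -/
def tensor : EqSheaf p E Γ ⥤ EqSheaf p E Γ ⥤ EqSheaf p E Γ where
  obj F :=
    { obj F' := (F.pshTensor F').sheafify
      map f := tensorMap (𝟙 F) f
      map_id F' := tensorMap_id F F'
      map_comp f f' := by
        rw [← tensorMap_comp, Category.comp_id] }
  map f :=
    { app F' := tensorMap f (𝟙 F')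
      naturality F' F'' f' := by
        refine (tensorMap_comp _ _ _ _).symm.trans (Eq.trans ?_ (tensorMap_comp _ _ _ _))
        exact congrArg₂ tensorMap ((Category.id_comp f).trans (Category.comp_id f).symm)
          ((Category.comp_id f').trans (Category.id_comp f').symm) }
  map_id F := by
    ext F' : 2
    exact tensorMap_id F F'
  map_comp f f' := by
    ext F' : 2
    refine Eq.trans ?_ (tensorMap_comp _ _ _ _)
    exact congrArg (tensorMap (f ≫ f')) (Category.comp_id (𝟙 F')).symm

lemma tensorMap_zero_left {F₁ F₁' F₂ F₂' : EqSheaf p E Γ} (f₂ : F₂ ⟶ F₂') :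
    tensorMap (0 : F₁ ⟶ F₁') f₂ = 0 :=
  hom_ext ((congrArg (presheafToSheaf (etaleTopology p E) _).map
    (pshTensorMap_zero_left f₂.hom.hom)).trans
      ((presheafToSheaf (etaleTopology p E) _).map_zero _ _))

lemma tensorMap_zero_right {F₁ F₁' F₂ F₂' : EqSheaf p E Γ} (f₁ : F₁ ⟶ F₁') :
    tensorMap f₁ (0 : F₂ ⟶ F₂') = 0 :=
  hom_ext ((congrArg (presheafToSheaf (etaleTopology p E) _).map
    (pshTensorMap_zero_right f₁.hom.hom)).trans
      ((presheafToSheaf (etaleTopology p E) _).map_zero _ _))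

instance : (tensor p E Γ).PreservesZeroMorphisms where
  map_zero F F' := by
    ext F'' : 2
    exact tensorMap_zero_left (𝟙 F'')

instance (F : EqSheaf p E Γ) : ((tensor p E Γ).obj F).PreservesZeroMorphisms where
  map_zero _ _ := tensorMap_zero_right (𝟙 F)

variable (p E Γ) in
/-- The constant sheaf `ℤ` with the trivial action. -/
def constInt : EqSheaf p E Γ := EqPresheaf.sheafify
  { psh := (Functor.const _).obj (AddCommGrpCat.of (ULift.{u + 1} ℤ))
    τ _ := 𝟙 _
    τ_one := rfl
    τ_mul _ _ := rfl }

/-- Restriction of the action to a subgroup. -/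
def restrict {Γ Γ' : Subgroup (GHat k)} (h : Γ' ≤ Γ) : EqSheaf p E Γ ⥤ EqSheaf p E Γ' where
  obj F :=
    { sheaf := F.sheaf
      σ g := F.σ ⟨g, h g.2⟩
      σ_one := F.σ_one
      σ_mul g g' := F.σ_mul ⟨g, h g.2⟩ ⟨g', h g'.2⟩ }
  map f := ⟨f.hom, fun g => f.comm ⟨g, h g.2⟩⟩

instance {Γ Γ' : Subgroup (GHat k)} (h : Γ' ≤ Γ) : (restrict (p := p) (E := E) h).Additive where
  map_add := rfl

/-- The total complex (with direct sums) of the tensor product of two complexes, with the usual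
signs. -/
def totalTensor (K L : CochainComplex (EqSheaf p E Γ) ℤ) : CochainComplex (EqSheaf p E Γ) ℤ :=
  HomologicalComplex.mapBifunctor K L (tensor p E Γ) (ComplexShape.up ℤ)

end EqSheaf
end tensor


section continuity
variable (p E)

/-- A model of `U` over a finite subextension `K` of `k̄`: a scheme `U'` over `K`, over `X`, with an
isomorphism of `U` with `U' ×_K k̄` over `X ×_k k̄`. -/
structure Model (U : Ebar p E) where
  K : IntermediateField k (AlgebraicClosure k)
  finite : FiniteDimensional k K
  scheme : Scheme.{u}
  toX : scheme ⟶ X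
  toField : scheme ⟶ Spec (.of K)
  comm : toX ≫ p = toField ≫ Spec.map (CommRingCat.ofHom (algebraMap k K))
  proj : U.obj.left ⟶ scheme
  proj_toX : proj ≫ toX = U.obj.hom ≫ pullback.fst p (geomPoint k)
  isPullback : IsPullback proj (U.obj.hom ≫ pullback.snd p (geomPoint k)) toField
    (Spec.map (CommRingCat.ofHom (algebraMap K (AlgebraicClosure k))))

variable {p E}

lemma specAct_fixing (K : IntermediateField k (AlgebraicClosure k)) (g : K.fixingSubgroup) :
    specAct (g : GHat k) ≫ Spec.map (CommRingCat.ofHom (algebraMap K (AlgebraicClosure k))) =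
      Spec.map (CommRingCat.ofHom (algebraMap K (AlgebraicClosure k))) := by
  rw [specAct, ← Spec.map_comp, ← CommRingCat.ofHom_comp]
  congr 2
  ext x
  exact (IntermediateField.mem_fixingSubgroup_iff K _).1 (g⁻¹).2 x x.2

/-- For `g` fixing `K` and `U = U' ×_K k̄`, the automorphism of `U` over `U'` induced by `g⁻¹`. -/
def Model.conjMap {U : Ebar p E} (M : Model p E U) (g : M.K.fixingSubgroup) :
    U.obj.left ⟶ U.obj.left :=
  M.isPullback.lift M.proj
    ((U.obj.hom ≫ pullback.snd p (geomPoint k)) ≫ specAct ((g⁻¹ : M.K.fixingSubgroup) : GHat k))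
    (by rw [Category.assoc, specAct_fixing, M.isPullback.w])

lemma Model.conjMap_comp {U : Ebar p E} (M : Model p E U) (g : M.K.fixingSubgroup) :
    M.conjMap g ≫ U.obj.hom ≫ act p g = U.obj.hom := by
  have h1 : M.conjMap g ≫ M.proj = M.proj := M.isPullback.lift_fst _ _ _
  have h2 : M.conjMap g ≫ U.obj.hom ≫ pullback.snd p (geomPoint k) =
      (U.obj.hom ≫ pullback.snd p (geomPoint k)) ≫
        specAct ((g⁻¹ : M.K.fixingSubgroup) : GHat k) := M.isPullback.lift_snd _ _ _
  apply pullback.hom_ext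
  · rw [Category.assoc, Category.assoc, act_fst, ← M.proj_toX, ← Category.assoc, h1]
  · have h3 : (g : GHat k) * ((g⁻¹ : M.K.fixingSubgroup) : GHat k) = 1 := by simp
    rw [Category.assoc, Category.assoc, act_snd, ← Category.assoc U.obj.hom, ← Category.assoc,
      h2, Category.assoc, ← specAct_mul, h3, specAct_one, Category.comp_id]

/-- For `g` fixing `K` and `U = U' ×_K k̄`, the canonical isomorphism `U → gU` over `X ×_k k̄`. -/
def Model.conj {U : Ebar p E} (M : Model p E U) (g : M.K.fixingSubgroup) :
    U ⟶ (twist p E g).obj U :=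
  homMk (M.conjMap g) (M.conjMap_comp g)

/-- The action of `Gal(k̄/K)` on `F(U)`, where `U` has a model over `K`:
`F(U) → F(gU) ≅ F(U)`. -/
def Model.galAct {U : Ebar p E} (M : Model p E U) (F : EqSheaf p E (⊤ : Subgroup (GHat k)))
    (g : M.K.fixingSubgroup) : F.sheaf.obj.obj (op U) ⟶ F.sheaf.obj.obj (op U) :=
  (F.σ ⟨g, Subgroup.mem_top _⟩).hom.app (op U) ≫ F.sheaf.obj.map (M.conj g).op

variable (p E) in
/-- The action of the Galois group is continuous: for every `U` with a model over a finite extension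
`K`, the map `Gal(k̄/K) × F(U) → F(U)` is continuous for the discrete topology on `F(U)`. -/
def isContinuous : ObjectProperty (EqSheaf p E (⊤ : Subgroup (GHat k))) := fun F =>
  ∀ (U : Ebar p E) (M : Model p E U),
    letI : TopologicalSpace (F.sheaf.obj.obj (op U)) := ⊥
    Continuous fun x : M.K.fixingSubgroup × F.sheaf.obj.obj (op U) => (M.galAct F x.1).hom x.2

variable (p E)
/-- Abelian sheaves on `Ē` with continuous action of the Galois group (étale sheaves). -/
abbrev TGHat : Type (u + 2) := (isContinuous p E).FullSubcategory
/-- Abelian sheaves on `Ē` with action of the Weil group (Weil-étale sheaves). -/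
abbrev TG [Fintype k] : Type (u + 2) := EqSheaf p E (weilGroup k)

/-- The functor `γ^*`: restriction of the action to the Weil group. -/
def gammaUpper [Fintype k] : TGHat p E ⥤ TG p E :=
  (isContinuous p E).ι ⋙ EqSheaf.restrict le_top

instance [Fintype k] : (gammaUpper p E).Additive := by unfold gammaUpper; infer_instance

/-- The underlying sheaf of an étale sheaf. -/
def underlyingHat : TGHat p E ⥤ AbSheaf p E := (isContinuous p E).ι ⋙ EqSheaf.forget p E ⊤
instance : (underlyingHat p E).Additive := by unfold underlyingHat; infer_instance

/-- The underlying sheaf of a Weil-étale sheaf. -/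
def underlying [Fintype k] : TG p E ⥤ AbSheaf p E := EqSheaf.forget p E (weilGroup k)
instance [Fintype k] : (underlying p E).Additive := by unfold underlying; infer_instance

/-- The morphisms of complexes in `𝒜` that `Φ` sends to quasi-isomorphisms of complexes of sheaves. -/
def qis {𝒜 : Type*} [Category* 𝒜] [Preadditive 𝒜] (Φ : 𝒜 ⥤ AbSheaf p E) [Φ.Additive] :
    MorphismProperty (CochainComplex 𝒜 ℤ) :=
  (HomologicalComplex.quasiIso (AbSheaf p E) (ComplexShape.up ℤ)).inverseImage
    (Φ.mapHomologicalComplex (ComplexShape.up ℤ))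

/-- Quasi-isomorphisms of complexes of étale sheaves. -/
abbrev qisHat := qis p E (underlyingHat p E)
/-- Quasi-isomorphisms of complexes of Weil-étale sheaves. -/
abbrev qisG [Fintype k] := qis p E (underlying p E)

/-- The unbounded derived category of étale sheaves. -/
abbrev DHat := (qisHat p E).Localization
/-- The unbounded derived category of Weil-étale sheaves. -/
abbrev DG [Fintype k] := (qisG p E).Localization

/-- The localization functor from complexes to the derived category of étale sheaves. -/
abbrev QHat : CochainComplex (TGHat p E) ℤ ⥤ DHat p E := (qisHat p E).Q

/-- The localization functor from complexes to the derived category of Weil-étale sheaves. -/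
abbrev QG [Fintype k] : CochainComplex (TG p E) ℤ ⥤ DG p E := (qisG p E).Q

/-- The functor `γ_*`, the right adjoint of `γ^*`. -/
def gammaLower [Fintype k] [(gammaUpper p E).IsLeftAdjoint] : TG p E ⥤ TGHat p E :=
  (gammaUpper p E).rightAdjoint

instance [Fintype k] [(gammaUpper p E).IsLeftAdjoint] : (gammaLower p E).Additive :=
  (Adjunction.ofIsLeftAdjoint (gammaUpper p E)).right_adjoint_additive

/-- The functor `γ_*` applied degreewise, with values in the derived category. -/
abbrev gammaLowerComplex [Fintype k] [(gammaUpper p E).IsLeftAdjoint] :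
    CochainComplex (TG p E) ℤ ⥤ DHat p E :=
  (gammaLower p E).mapHomologicalComplex (ComplexShape.up ℤ) ⋙ QHat p E

/-- The functor `Rγ_*`: the total right derived functor of `γ_*` on unbounded complexes. -/
def RGamma [Fintype k] [(gammaUpper p E).IsLeftAdjoint]
    [(gammaLowerComplex p E).HasRightDerivedFunctor (qisG p E)] : DG p E ⥤ DHat p E :=
  (gammaLowerComplex p E).totalRightDerived (QG p E) (qisG p E)

variable {p E}
/-- `T` is (isomorphic to) the total tensor product of the complexes `K` and `L`. -/
def IsTotalTensor (K L T : CochainComplex (TGHat p E) ℤ) : Prop :=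
  Nonempty (((isContinuous p E).ι.mapHomologicalComplex _).obj T ≅
    EqSheaf.totalTensor (((isContinuous p E).ι.mapHomologicalComplex _).obj K)
      (((isContinuous p E).ι.mapHomologicalComplex _).obj L))

/-- The complex has zero cohomology sheaves. -/
def Acyclic (K : CochainComplex (EqSheaf p E (⊤ : Subgroup (GHat k))) ℤ) : Prop :=
  (((EqSheaf.forget p E ⊤).mapHomologicalComplex _).obj K).Acyclic
/-- The complex `P` of étale sheaves is K-flat: its tensor product with every acyclic complex of
étale sheaves is acyclic. -/
def KFlat (P : CochainComplex (TGHat p E) ℤ) : Prop :=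
  ∀ C : CochainComplex (TGHat p E) ℤ,
    Acyclic (((isContinuous p E).ι.mapHomologicalComplex _).obj C) →
    Acyclic (EqSheaf.totalTensor (((isContinuous p E).ι.mapHomologicalComplex _).obj P)
      (((isContinuous p E).ι.mapHomologicalComplex _).obj C))

/-- `T` is isomorphic to the derived tensor product of `A` and `B`: to the total tensor product of
complexes `P` and `L` that represent `A` and `B`, where `P` is K-flat. -/
def IsDerivedTensor (A B T : DHat p E) : Prop :=
  ∃ P L M : CochainComplex (TGHat p E) ℤ, KFlat P ∧ Nonempty ((QHat p E).obj P ≅ A) ∧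
    Nonempty ((QHat p E).obj L ≅ B) ∧ IsTotalTensor P L M ∧ Nonempty ((QHat p E).obj M ≅ T)

variable (p E) in
/-- `E` consists of schemes over `X` that are separated and of finite type over `k`, and it contains
with `Y` every `U` that is étale and of finite type over `Y` (and separated over `k`). -/
structure IsAdmissible : Prop where
  separated (Y : Over X) (hY : E Y) : IsSeparated (Y.hom ≫ p)
  locallyOfFiniteType (Y : Over X) (hY : E Y) : LocallyOfFiniteType (Y.hom ≫ p)
  quasiCompact (Y : Over X) (hY : E Y) : QuasiCompact (Y.hom ≫ p)
  etale_mem {Y U : Over X} (f : U ⟶ Y) (hY : E Y) (hf : Etale f.left) (hqc : QuasiCompact f.left)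
    (hU : IsSeparated (U.hom ≫ p)) : E U

end continuity

end WeilEtale

end

open WeilEtale

/-! Write `coind` for the right adjoint of forgetting the action (sections over U are families f(g)
in A(gU)) and `coindHat` for its smooth version, the right adjoint of the forgetful functor on étale
sheaves. The Weil group is infinite cyclic. In the coordinates g ↦ σ_g⁻¹ f(g), a section of the
coinduced sheaf of a Weil-étale sheaf F is therefore a sequence of sections of F indexed by the
integers, and shifting by Frobenius translates the sequence. Every sequence is the difference of
another one, unique up to its value at 0. Hence 0 → F → coind F → coind F → 0, with second map shift
− 1, is split exact on underlying sheaves (`splitSeq_unit`), and split equivariantly when F is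
itself coinduced (`splitSeq_coindMonad`).

Existence of γ_*: a morphism γ^*K → F is a sheaf morphism that commutes with Frobenius. By
adjunction it is a morphism from K to the sheaf coinduced from F to the whole Galois group that is
killed by shift − 1. As K is continuous, this lands in the smooth part. So γ_*F is the smooth part
of ker(shift − 1) (`gammaUpper_isLeftAdjoint`).

Existence of Rγ_*: uniqueness of adjoints gives γ_* ∘ coind ≅ `coindHat` (`coindHatIso`), and
`coindHat` is exact because the Galois group is compact (`epi_coindHat_map`,
`preservesHomology_coindHat`). For any complex K, the homotopy fibre of shift − 1 on coind K is then
a functorial resolution by complexes on which γ_* may be computed directly. It has only two columns,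
so no boundedness of K is needed. This gives a right derivability structure, and Rγ_*K is the
homotopy fibre of shift − 1 on coindHat K (`hasRightDerivedFunctor_gammaLower`,
`nonempty_RGamma_iso`).

Projection formula: if F is étale, the smooth sections of its coinduced sheaf are, in coordinates,
the locally constant functions from the Galois group to F(U)
(`isSmooth_coind_iff_isLocallyConstant`). By compactness these are the locally constant integral
functions tensored with F(U), so coindHat ℤ ⊗ F ≅ coindHat F, compatibly with the shift
(`tensorCoind`, `tensorCoind_intShift`). The total tensor product with a complex in degrees 0 and 1
is again a homotopy fibre (`twoTermFibData`). Hence the complex representing Rγ_*ℤ, tensored with 𝒢,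
is the complex representing Rγ_*γ^*𝒢 (`totalTensorIso`). The same isomorphism and the exactness of
`coindHat` show that the first factor is K-flat (`kFlat_gammaInt`), so this tensor product is the
derived one.

The geometry enters through descent to finite extensions of k: objects have models in `E`
(`exists_good_model`), Galois elements near 1 commute with a given morphism (`conjMap_comm`), étale
covers can be pulled back (`exists_refinement`) and made finite (`exists_finite_cover`). -/

noncomputable section
namespace WeilEtale

/-! ### Descent from the algebraic closure to finite extensions of k. -/

section finiteLevel

variable {k : Type u} [Field k]

/-- The finite subextensions of the algebraic closure that contain `K`. -/
abbrev FiniteLevel (K : IntermediateField k (AlgebraicClosure k)) : Type u :=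
  {L : IntermediateField k (AlgebraicClosure k) // K ≤ L ∧ FiniteDimensional k L}

variable {K : IntermediateField k (AlgebraicClosure k)}

instance [hK : FiniteDimensional k K] : Nonempty (FiniteLevel K) := ⟨⟨K, le_rfl, hK⟩⟩

instance : IsDirectedOrder (FiniteLevel K) where
  directed L L' := by
    have := L.2.2
    have := L'.2.2
    exact ⟨⟨L.1 ⊔ L'.1, L.2.1.trans le_sup_left, inferInstance⟩,
      (le_sup_left : L.1 ≤ L.1 ⊔ L'.1), (le_sup_right : L'.1 ≤ L.1 ⊔ L'.1)⟩

lemma FiniteLevel.exists_mem [hK : FiniteDimensional k K] (x : AlgebraicClosure k) :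
    ∃ L : FiniteLevel K, x ∈ L.1 := by
  have : FiniteDimensional k (IntermediateField.adjoin k {x}) :=
    IntermediateField.adjoin.finiteDimensional (Algebra.IsIntegral.isIntegral x)
  exact ⟨⟨K ⊔ IntermediateField.adjoin k {x}, le_sup_left, inferInstance⟩,
    (le_sup_right : _ ≤ K ⊔ IntermediateField.adjoin k {x})
      (IntermediateField.mem_adjoin_simple_self k x)⟩

variable (K) in
/-- The diagram of the finite subextensions. -/
abbrev levelDiagram : FiniteLevel K ⥤ CommRingCat.{u} where
  obj L := .of L.1
  map f := CommRingCat.ofHom (IntermediateField.inclusion (leOfHom f)).toRingHom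

variable (K) in
/-- The algebraic closure as a cocone over its finite subextensions. -/
abbrev levelCocone : Cocone (levelDiagram K) where
  pt := .of (AlgebraicClosure k)
  ι := { app L := CommRingCat.ofHom (algebraMap L.1 (AlgebraicClosure k))
         naturality _ _ _ := rfl }

/-- Two levels lie in a common third, through which both values factor. This makes a map out of the
algebraic closure, defined level by level, independent of the chosen level. -/
lemma levelCocone_app_eq (s : Cocone (levelDiagram K)) {L L' : FiniteLevel K}
    {x : AlgebraicClosure k} (h : x ∈ L.1) (h' : x ∈ L'.1) :
    (s.ι.app L).hom ⟨x, h⟩ = (s.ι.app L').hom ⟨x, h'⟩ := by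
  obtain ⟨M, hL, hL'⟩ := exists_ge_ge L L'
  have h1 := congrArg (fun t => t.hom ⟨x, h⟩) (s.w (homOfLE hL))
  have h2 := congrArg (fun t => t.hom ⟨x, h'⟩) (s.w (homOfLE hL'))
  exact h1.symm.trans h2

variable (K) in
/-- The algebraic closure is the colimit of its finite subextensions. -/
def levelIsColimit [FiniteDimensional k K] : IsColimit (levelCocone K) where
  desc s := CommRingCat.ofHom
    { toFun x := (s.ι.app (FiniteLevel.exists_mem x).choose).hom
        ⟨x, (FiniteLevel.exists_mem x).choose_spec⟩
      map_one' := (levelCocone_app_eq s _ (one_mem _)).trans (map_one _)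
      map_zero' := (levelCocone_app_eq s _ (zero_mem _)).trans (map_zero _)
      map_add' x y := by
        obtain ⟨L, hx⟩ := FiniteLevel.exists_mem (K := K) x
        obtain ⟨L', hy⟩ := FiniteLevel.exists_mem (K := K) y
        obtain ⟨M, hL, hL'⟩ := exists_ge_ge L L'
        rw [levelCocone_app_eq s _ (hL hx), levelCocone_app_eq s _ (hL' hy),
          levelCocone_app_eq s _ (add_mem (hL hx) (hL' hy))]
        exact map_add (s.ι.app M).hom (⟨x, hL hx⟩ : M.1) ⟨y, hL' hy⟩
      map_mul' x y := by
        obtain ⟨L, hx⟩ := FiniteLevel.exists_mem (K := K) x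
        obtain ⟨L', hy⟩ := FiniteLevel.exists_mem (K := K) y
        obtain ⟨M, hL, hL'⟩ := exists_ge_ge L L'
        rw [levelCocone_app_eq s _ (hL hx), levelCocone_app_eq s _ (hL' hy),
          levelCocone_app_eq s _ (mul_mem (hL hx) (hL' hy))]
        exact map_mul (s.ι.app M).hom (⟨x, hL hx⟩ : M.1) ⟨y, hL' hy⟩ }
  fac s L := by
    ext x
    exact levelCocone_app_eq s _ x.2
  uniq s m hm := by
    ext x
    exact congrArg (fun t => t.hom ⟨x, (FiniteLevel.exists_mem x).choose_spec⟩)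
      (hm (FiniteLevel.exists_mem x).choose)

/-- The morphism of spectra given by an inclusion of intermediate fields. -/
abbrev specIncl {K L : IntermediateField k (AlgebraicClosure k)} (h : K ≤ L) :
    Spec (.of L) ⟶ Spec (.of K) :=
  Spec.map (CommRingCat.ofHom (IntermediateField.inclusion h).toRingHom)

/-- The geometric point of the spectrum of an intermediate field. -/
abbrev specGeom (K : IntermediateField k (AlgebraicClosure k)) :
    Spec (.of (AlgebraicClosure k)) ⟶ Spec (.of K) :=
  Spec.map (CommRingCat.ofHom (algebraMap K (AlgebraicClosure k)))

lemma specGeom_incl {K L : IntermediateField k (AlgebraicClosure k)} (h : K ≤ L) :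
    specGeom L ≫ specIncl h = specGeom K := by
  rw [← Spec.map_comp]
  rfl

lemma specIncl_incl {K L M : IntermediateField k (AlgebraicClosure k)} (h : K ≤ L) (h' : L ≤ M) :
    specIncl h' ≫ specIncl h = specIncl (h.trans h') := by
  rw [← Spec.map_comp]
  rfl

variable {B T W : Scheme.{u}} (t : T ⟶ B) (b : Spec (.of K) ⟶ B)

/-- The base change of `T` to a finite level. -/
abbrev levelChange (L : FiniteLevel K) : Scheme.{u} := pullback t (specIncl L.2.1 ≫ b)

/-- The diagram of the base changes of `T` to the finite levels. -/
abbrev changeDiagram : (FiniteLevel K)ᵒᵖ ⥤ Scheme.{u} where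
  obj L := levelChange t b L.unop
  map f := pullback.lift (pullback.fst _ _) (pullback.snd _ _ ≫ specIncl (leOfHom f.unop)) (by
    rw [pullback.condition, Category.assoc, ← Category.assoc (specIncl _), specIncl_incl])
  map_id L := by
    apply pullback.hom_ext
    · rw [pullback.lift_fst, Category.id_comp]
    · rw [pullback.lift_snd, Category.id_comp]
      refine (congrArg (_ ≫ ·) (Spec.map_id _)).trans (Category.comp_id _)
  map_comp f g := by
    apply pullback.hom_ext
    · rw [pullback.lift_fst, Category.assoc, pullback.lift_fst, pullback.lift_fst]
    · rw [pullback.lift_snd, Category.assoc, pullback.lift_snd, pullback.lift_snd_assoc,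
        Category.assoc, specIncl_incl]

variable {t b} {π : W ⟶ T} {q : W ⟶ Spec (.of (AlgebraicClosure k))}

/-- The projection of the geometric base change to a finite level. -/
def toLevel (h : IsPullback π q t (specGeom K ≫ b)) (L : FiniteLevel K) : W ⟶ levelChange t b L :=
  pullback.lift π (q ≫ specGeom L.1) (by
    rw [h.w, Category.assoc, ← specGeom_incl L.2.1, Category.assoc])

variable (h : IsPullback π q t (specGeom K ≫ b))

@[simp]
lemma toLevel_fst (L : FiniteLevel K) : toLevel h L ≫ pullback.fst _ _ = π :=
  pullback.lift_fst _ _ _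

@[simp]
lemma toLevel_fst_assoc (L : FiniteLevel K) {Z : Scheme.{u}} (f : T ⟶ Z) :
    toLevel h L ≫ pullback.fst _ _ ≫ f = π ≫ f :=
  pullback.lift_fst_assoc _ _ _ _

@[simp]
lemma toLevel_snd (L : FiniteLevel K) : toLevel h L ≫ pullback.snd _ _ = q ≫ specGeom L.1 :=
  pullback.lift_snd _ _ _

@[simp]
lemma toLevel_snd_assoc (L : FiniteLevel K) {Z : Scheme.{u}} (f : Spec (.of L.1) ⟶ Z) :
    toLevel h L ≫ pullback.snd _ _ ≫ f = q ≫ specGeom L.1 ≫ f :=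
  (pullback.lift_snd_assoc _ _ _ _).trans (Category.assoc _ _ _)

lemma toLevel_isPullback (L : FiniteLevel K) :
    IsPullback (toLevel h L) q (pullback.snd _ _) (specGeom L.1) := by
  refine IsPullback.of_right (h₁₂ := pullback.fst _ _) (v₁₃ := t) (h₂₂ := specIncl L.2.1 ≫ b) ?_
    (toLevel_snd h L) (IsPullback.of_hasPullback _ _)
  rw [toLevel_fst, ← Category.assoc, specGeom_incl]
  exact h

/-- The geometric base change as a cone over the base changes to finite levels. -/
abbrev changeCone : Cone (changeDiagram t b) where
  pt := W
  π := { app L := toLevel h L.unop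
         naturality L L' f := by
          refine (Category.id_comp _).trans ?_
          apply pullback.hom_ext
          · rw [toLevel_fst, Category.assoc, pullback.lift_fst, toLevel_fst]
          · rw [toLevel_snd, Category.assoc, pullback.lift_snd, toLevel_snd_assoc,
              specGeom_incl] }

/-- The geometric base change is the limit of the base changes to finite levels. -/
def changeIsLimit [FiniteDimensional k K] : IsLimit (changeCone h) := by
  -- `Scheme.Spec` preserves limits, so the colimit of fields becomes a limit of spectra.
  have hS : IsLimit (Scheme.Spec.mapCone (levelCocone K).op) :=
    isLimitOfPreserves Scheme.Spec (levelIsColimit K).op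
  let L₀ : FiniteLevel K := Classical.arbitrary _
  -- By directedness the component in `T` is the same at all levels. A cone is thus one map to `T`
  -- together with a compatible family of maps to the spectra.
  have hT : ∀ (s : Cone (changeDiagram t b)) (L L' : FiniteLevel K),
      s.π.app (op L) ≫ pullback.fst _ _ = s.π.app (op L') ≫ pullback.fst _ _ := by
    intro s
    have h0 : ∀ (L L' : FiniteLevel K) (hL : L ≤ L'),
        s.π.app (op L) ≫ pullback.fst _ _ = s.π.app (op L') ≫ pullback.fst _ _ := by
      intro L L' hL
      rw [← s.w (homOfLE hL).op, Category.assoc]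
      congr 1
      exact pullback.lift_fst _ _ _
    intro L L'
    obtain ⟨M, hL, hL'⟩ := exists_ge_ge L L'
    rw [h0 _ _ hL, h0 _ _ hL']
  let c : Cone (changeDiagram t b) → Cone ((levelDiagram K).op ⋙ Scheme.Spec) := fun s =>
    { pt := s.pt
      π := { app L := s.π.app L ≫ pullback.snd _ _
             naturality L L' f := by
              refine (Category.id_comp _).trans ?_
              rw [← s.w f, Category.assoc, Category.assoc]
              congr 1
              exact pullback.lift_snd _ _ _ } }
  have hc : ∀ s (L : FiniteLevel K), hS.lift (c s) ≫ specGeom L.1 = s.π.app (op L) ≫ pullback.snd _ _ := fun s L =>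
    hS.fac (c s) (op L)
  have hw : ∀ s : Cone (changeDiagram t b), (s.π.app (op L₀) ≫ pullback.fst _ _) ≫ t =
      hS.lift (c s) ≫ specGeom K ≫ b := by
    intro s
    rw [Category.assoc, pullback.condition, ← specGeom_incl L₀.2.1, ← Category.assoc, ← hc]
    simp only [Category.assoc]
  refine { lift s := h.lift (s.π.app (op L₀) ≫ pullback.fst _ _) (hS.lift (c s)) (hw s),
           fac := ?_, uniq := ?_ }
  · intro s L
    apply pullback.hom_ext
    · refine (Category.assoc _ _ _).trans ?_
      rw [toLevel_fst, IsPullback.lift_fst]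
      exact hT s _ _
    · refine (Category.assoc _ _ _).trans ?_
      rw [toLevel_snd, IsPullback.lift_snd_assoc]
      exact hc s _
  · intro s m hm
    apply h.hom_ext
    · rw [IsPullback.lift_fst, ← hm, Category.assoc]
      exact congrArg (m ≫ ·) (toLevel_fst h L₀).symm
    · rw [IsPullback.lift_snd]
      apply hS.hom_ext
      intro L
      rw [hS.fac]
      change _ = s.π.app L ≫ pullback.snd _ _
      rw [← hm, Category.assoc, Category.assoc]
      exact congrArg (m ≫ ·) (toLevel_snd h L.unop).symm

instance isAffineHom_specIncl {K L : IntermediateField k (AlgebraicClosure k)} (h : K ≤ L) :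
    IsAffineHom (specIncl h) := inferInstance

/-- The transition maps are base changes of `specIncl`. Affine transition maps are what the limit
theorems for schemes require. -/
instance {L L' : (FiniteLevel K)ᵒᵖ} (f : L ⟶ L') : IsAffineHom ((changeDiagram t b).map f) := by
  have h1 : IsPullback ((changeDiagram t b).map f) (pullback.snd _ _) (pullback.snd _ _)
      (specIncl (leOfHom f.unop)) := by
    refine IsPullback.of_right (h₁₂ := pullback.fst _ _) (v₁₃ := t)
      (h₂₂ := specIncl L'.unop.2.1 ≫ b) ?_ (pullback.lift_snd _ _ _) (IsPullback.of_hasPullback _ _)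
    rw [← Category.assoc, specIncl_incl, pullback.lift_fst]
    exact IsPullback.of_hasPullback _ _
  exact MorphismProperty.of_isPullback h1.flip inferInstance

/-- A morphism from the geometric base change to a scheme locally of finite presentation factors
through a finite level. -/
lemma exists_level_factor [FiniteDimensional k K] [IsAffine B] [CompactSpace T]
    [QuasiSeparatedSpace T] {Y S : Scheme.{u}} (f : Y ⟶ S) [LocallyOfFinitePresentation f]
    (s : T ⟶ S) (a : W ⟶ Y) (ha : π ≫ s = a ≫ f) :
    ∃ (L : FiniteLevel K) (g : levelChange t b L ⟶ Y), toLevel h L ≫ g = a ∧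
      g ≫ f = pullback.fst _ _ ≫ s := by
  have h1 : ∀ L, CompactSpace ((changeDiagram t b).obj L) := fun L =>
    QuasiCompact.compactSpace_of_compactSpace (pullback.fst t (specIncl L.unop.2.1 ≫ b))
  have h2 : ∀ L, QuasiSeparatedSpace ((changeDiagram t b).obj L) := fun L =>
    quasiSeparatedSpace_of_quasiSeparated (pullback.fst t (specIncl L.unop.2.1 ≫ b))
  let τ : changeDiagram t b ⟶ (Functor.const _).obj S :=
    { app L := pullback.fst _ _ ≫ s
      naturality L L' φ := by
        exact (pullback.lift_fst_assoc _ _ _ _).trans (Category.comp_id _).symm }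
  obtain ⟨L, g, hg, hg'⟩ := Scheme.exists_π_app_comp_eq_of_locallyOfFinitePresentation
    (changeDiagram t b) τ f (changeCone h) (changeIsLimit h) a (by
      ext L : 2
      exact (toLevel_fst_assoc h _ _).trans ha)
  exact ⟨L.unop, g, hg, hg'⟩

/-- A quasi-compact open of the geometric base change is defined over a finite level. -/
lemma exists_level_open [FiniteDimensional k K] (O : W.Opens) (hO : IsCompact (O : Set W)) :
    ∃ (L : FiniteLevel K) (V : (levelChange t b L).Opens), IsCompact (V : Set (levelChange t b L)) ∧
      toLevel h L ⁻¹ᵁ V = O := by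
  obtain ⟨L, V, hV, hV'⟩ := exists_preimage_eq (changeDiagram t b) (changeCone h)
    (changeIsLimit h) O hO
  exact ⟨L.unop, V, hV, hV'⟩

end finiteLevel
end WeilEtale
end

noncomputable section
namespace WeilEtale

/-! ### Existence and finiteness properties of models over finite extensions. -/

section models

variable {k : Type u} [Field k] {X : Scheme.{u}} {p : X ⟶ Spec (.of k)} {E : ObjectProperty (Over X)}

/-- Finite extensions of a perfect field are separable. This is why enlarging the field of
definition of a scheme in `E` does not leave `E`. -/
lemma etale_specMap_of_finite [PerfectField k] (L : IntermediateField k (AlgebraicClosure k))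
    [FiniteDimensional k L] : Etale (Spec.map (CommRingCat.ofHom (algebraMap k L))) := by
  rw [HasRingHomProperty.Spec_iff (P := @Etale)]
  have : Algebra.FormallyEtale k L := Algebra.FormallyEtale.of_isSeparable k L
  have : Algebra.FinitePresentation k L := (Algebra.FinitePresentation.of_finiteType).1 inferInstance
  rw [CommRingCat.hom_ofHom, RingHom.etale_algebraMap]
  exact { }

/-- The base change of an object of `E` to the algebraic closure. -/
abbrev geomChange (p : X ⟶ Spec (.of k)) (Y : Over X) : Scheme.{u} :=
  pullback Y.hom (pullback.fst p (geomPoint k))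

/-- Pasting of two pullback squares: base change along X ×_k k̄ → X is base change from k to k̄. -/
lemma geomChange_isPullback (Y : Over X) :
    IsPullback (pullback.fst Y.hom (pullback.fst p (geomPoint k)))
      (pullback.snd Y.hom (pullback.fst p (geomPoint k)) ≫ pullback.snd p (geomPoint k))
      (Y.hom ≫ p) (geomPoint k) :=
  (IsPullback.paste_horiz (IsPullback.of_hasPullback Y.hom (pullback.fst p (geomPoint k))).flip
    (IsPullback.of_hasPullback p (geomPoint k)).flip).flip

namespace IsAdmissible

variable (hE : IsAdmissible p E) {Y : Over X} (hY : E Y)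
include hE hY

lemma isNoetherian : IsNoetherian Y.left := by
  have h1 := hE.locallyOfFiniteType Y hY
  have h2 := hE.quasiCompact Y hY
  have := LocallyOfFiniteType.isLocallyNoetherian (Y.hom ≫ p)
  have := QuasiCompact.compactSpace_of_compactSpace (Y.hom ≫ p)
  exact { }

lemma isNoetherian_geomChange : IsNoetherian (geomChange p Y) := by
  have h1 := hE.locallyOfFiniteType Y hY
  have h2 := hE.quasiCompact Y hY
  have h := geomChange_isPullback (p := p) Y
  have h3 : LocallyOfFiniteType (pullback.snd Y.hom (pullback.fst p (geomPoint k)) ≫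
    pullback.snd p (geomPoint k)) := MorphismProperty.of_isPullback h h1
  have h4 : QuasiCompact (pullback.snd Y.hom (pullback.fst p (geomPoint k)) ≫
    pullback.snd p (geomPoint k)) := MorphismProperty.of_isPullback h h2
  have := LocallyOfFiniteType.isLocallyNoetherian (pullback.snd Y.hom (pullback.fst p (geomPoint k)) ≫
    pullback.snd p (geomPoint k))
  have := QuasiCompact.compactSpace_of_compactSpace (pullback.snd Y.hom (pullback.fst p (geomPoint k)) ≫
    pullback.snd p (geomPoint k))
  exact { }

end IsAdmissible

/-- Irreducible components are connected and closed, and there are finitely many of them. The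
complement of a connected component is the union of those not contained in it, hence closed. -/
lemma isOpen_connectedComponent_of_noetherianSpace {S : Type*} [TopologicalSpace S]
    [TopologicalSpace.NoetherianSpace S] (x : S) : IsOpen (connectedComponent x) := by
  have h : (connectedComponent x)ᶜ =
      ⋃ Z ∈ {Z ∈ irreducibleComponents S | ¬ Z ⊆ connectedComponent x}, Z := by
    ext y
    simp only [Set.mem_compl_iff, Set.mem_iUnion, exists_prop, Set.mem_ofPred_eq]
    constructor
    · intro hy
      exact ⟨irreducibleComponent y, ⟨irreducibleComponent_mem_irreducibleComponents y,
        fun h => hy (h mem_irreducibleComponent)⟩, mem_irreducibleComponent⟩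
    · rintro ⟨Z, ⟨hZ, hZx⟩, hy⟩ hyx
      apply hZx
      rw [connectedComponent_eq hyx]
      exact hZ.1.isPreirreducible.isPreconnected.subset_connectedComponent hy
  rw [← isClosed_compl_iff, h]
  refine Set.Finite.isClosed_biUnion ?_ fun Z hZ => isClosed_of_mem_irreducibleComponents Z hZ.1
  exact TopologicalSpace.NoetherianSpace.finite_irreducibleComponents.subset fun Z hZ => hZ.1

/-- A model is good if its underlying scheme over `X` belongs to `E`. -/
def Model.IsGood {U : Ebar p E} (M : Model p E U) : Prop := E (Over.mk M.toX)

lemma compactSpace_ebar (hE : IsAdmissible p E) (U : Ebar p E) : CompactSpace U.obj.left := by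
  obtain ⟨Y, hY, i, hi, y, hy⟩ := U.property
  have hN : IsNoetherian (geomChange p Y) := hE.isNoetherian_geomChange hY
  have hN' : TopologicalSpace.NoetherianSpace (geomChange p Y) := inferInstance
  have hi' : IsOpenImmersion (show U.obj.left ⟶ geomChange p Y from i.left) := hi
  have : TopologicalSpace.NoetherianSpace U.obj.left :=
    (show U.obj.left ⟶ geomChange p Y from i.left).isOpenEmbedding.isInducing.noetherianSpace
  infer_instance

lemma specGeom_bot (k : Type u) [Field k] :
    specGeom (⊥ : IntermediateField k (AlgebraicClosure k)) ≫
      Spec.map (CommRingCat.ofHom (algebraMap k (⊥ : IntermediateField k (AlgebraicClosure k)))) =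
        geomPoint k := by
  rw [← Spec.map_comp]
  rfl

/-- A connected component of Y ×_k k̄ is a quasi-compact open subscheme, hence the preimage of an
open V in the base change of Y to some finite extension. V is étale over Y, so it belongs to `E`. -/
lemma exists_good_model [PerfectField k] (hE : IsAdmissible p E) (U : Ebar p E) :
    ∃ M : Model p E U, M.IsGood := by
  obtain ⟨Y, hY, i, hi, y, hy⟩ := U.property
  let j : U.obj.left ⟶ geomChange p Y := i.left
  have hj : IsOpenImmersion j := hi
  have hjw : j ≫ pullback.snd _ _ = U.obj.hom := Over.w i
  have hN : IsNoetherian (geomChange p Y) := hE.isNoetherian_geomChange hY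
  have hNY : IsNoetherian Y.left := hE.isNoetherian hY
  have hs := hE.separated Y hY
  have hft := hE.locallyOfFiniteType Y hY
  have hO : IsCompact (j.opensRange : Set (geomChange p Y)) :=
    TopologicalSpace.NoetherianSpace.isCompact _
  -- The base field is viewed as `⊥`, so that the finite levels are all the finite subextensions.
  have h : IsPullback (pullback.fst Y.hom (pullback.fst p (geomPoint k)))
      (pullback.snd Y.hom (pullback.fst p (geomPoint k)) ≫ pullback.snd p (geomPoint k))
      (Y.hom ≫ p) (specGeom ⊥ ≫ Spec.map (CommRingCat.ofHom (algebraMap k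
        (⊥ : IntermediateField k (AlgebraicClosure k))))) := by
    rw [specGeom_bot]
    exact geomChange_isPullback Y
  obtain ⟨L, V, hV, hVj⟩ := exists_level_open h j.opensRange hO
  have hLf := L.2.2
  have hb : specIncl L.2.1 ≫ Spec.map (CommRingCat.ofHom (algebraMap k
      (⊥ : IntermediateField k (AlgebraicClosure k)))) =
        Spec.map (CommRingCat.ofHom (algebraMap k L.1)) := by
    rw [← Spec.map_comp]
    rfl
  have hrange : Set.range (j ≫ toLevel h L) ⊆ Set.range V.ι := by
    rw [Scheme.Opens.range_ι]
    rintro _ ⟨z, rfl⟩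
    have : j z ∈ toLevel h L ⁻¹ᵁ V := by
      rw [hVj]
      exact ⟨z, rfl⟩
    exact this
  have hpb : IsPullback (IsOpenImmersion.lift V.ι (j ≫ toLevel h L) hrange) j V.ι (toLevel h L) :=
    IsOpenImmersion.isPullback _ _ _ _ (IsOpenImmersion.lift_fac _ _ _).symm (by
      rw [Scheme.Opens.opensRange_ι, hVj])
  refine ⟨{ K := L.1
            finite := L.2.2
            scheme := V
            toX := (V.ι ≫ pullback.fst _ _) ≫ Y.hom
            toField := V.ι ≫ pullback.snd _ _
            comm := ?_
            proj := IsOpenImmersion.lift V.ι (j ≫ toLevel h L) hrange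
            proj_toX := ?_
            isPullback := ?_ }, ?_⟩
  · have hfld := (congrArg (pullback.snd (Y.hom ≫ p) _ ≫ ·) hb.symm).trans
      (pullback.condition (f := Y.hom ≫ p)).symm
    rw [Category.assoc, Category.assoc, Category.assoc]
    exact congrArg (V.ι ≫ ·) hfld.symm
  · rw [Category.assoc, IsOpenImmersion.lift_fac_assoc, Category.assoc, toLevel_fst_assoc, pullback.condition,
      ← hjw, Category.assoc]
  · rw [← hjw]
    have := (hpb.flip.paste_horiz (toLevel_isPullback h L).flip).flip
    simpa only [Category.assoc] using this
  · have hV' : CompactSpace V := isCompact_iff_compactSpace.1 hV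
    have het := etale_specMap_of_finite L.1
    have h1 : Etale (pullback.fst (Y.hom ≫ p) (specIncl L.2.1 ≫ Spec.map (CommRingCat.ofHom
        (algebraMap k (⊥ : IntermediateField k (AlgebraicClosure k)))))) := by
      rw [hb]
      infer_instance
    have h2 : Etale (V.ι ≫ pullback.fst (Y.hom ≫ p) (specIncl L.2.1 ≫ Spec.map (CommRingCat.ofHom
        (algebraMap k (⊥ : IntermediateField k (AlgebraicClosure k)))))) := inferInstance
    have hNV : IsNoetherian V := by
      have := LocallyOfFiniteType.isLocallyNoetherian (V.ι ≫ pullback.fst (Y.hom ≫ p)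
        (specIncl L.2.1 ≫ Spec.map (CommRingCat.ofHom
        (algebraMap k (⊥ : IntermediateField k (AlgebraicClosure k))))))
      exact { }
    refine hE.etale_mem (Y := Y) (Over.homMk (V.ι ≫ pullback.fst _ _) rfl) hY h2 ?_ ?_
    · have h3 : QuasiCompact (V.ι ≫ pullback.fst (Y.hom ≫ p) (specIncl L.2.1 ≫ Spec.map
        (CommRingCat.ofHom (algebraMap k (⊥ : IntermediateField k (AlgebraicClosure k)))))) :=
        quasiCompact_of_noetherianSpace_source _
      exact h3
    · change IsSeparated (((V.ι ≫ pullback.fst _ _) ≫ Y.hom) ≫ p)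
      rw [Category.assoc]
      infer_instance

lemma Model.compactSpace (hE : IsAdmissible p E) {U : Ebar p E} (M : Model p E U) :
    CompactSpace M.scheme := by
  have h := compactSpace_ebar hE U
  have hs : Surjective M.proj := MorphismProperty.of_isPullback M.isPullback.flip inferInstance
  exact hs.surj.compactSpace M.proj.continuous

/-- U → U' is surjective and U is noetherian, so A ∩ B is the continuous image of its preimage in U,
which is compact. -/
lemma Model.quasiSeparatedSpace (hE : IsAdmissible p E) {U : Ebar p E} (M : Model p E U) :
    QuasiSeparatedSpace M.scheme := by
  have hs : Surjective M.proj := MorphismProperty.of_isPullback M.isPullback.flip inferInstance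
  have ha : IsAffineHom M.proj := MorphismProperty.of_isPullback M.isPullback.flip inferInstance
  obtain ⟨Y, hY, i, hi, y, hy⟩ := U.property
  have hN : IsNoetherian (geomChange p Y) := hE.isNoetherian_geomChange hY
  have hN' : TopologicalSpace.NoetherianSpace (geomChange p Y) := inferInstance
  have hi' : IsOpenImmersion (show U.obj.left ⟶ geomChange p Y from i.left) := hi
  have : TopologicalSpace.NoetherianSpace U.obj.left :=
    (show U.obj.left ⟶ geomChange p Y from i.left).isOpenEmbedding.isInducing.noetherianSpace
  refine ⟨fun A B hA _ hB _ => ?_⟩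
  have h : A ∩ B = M.proj '' (M.proj ⁻¹' (A ∩ B)) := (Set.image_preimage_eq _ hs.surj).symm
  rw [h]
  exact (TopologicalSpace.NoetherianSpace.isCompact _).image M.proj.continuous

end models
end WeilEtale
end

noncomputable section
namespace WeilEtale

open scoped Topology

/-! ### Galois elements close to 1 commute with a given morphism. -/

section conj

variable {k : Type u} [Field k] {X : Scheme.{u}} {p : X ⟶ Spec (.of k)} {E : ObjectProperty (Over X)}

lemma Model.isOpen_fixingSubgroup {U : Ebar p E} (M : Model p E U) :
    IsOpen (M.K.fixingSubgroup : Set (GHat k)) := by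
  have := M.finite
  exact IntermediateField.fixingSubgroup_isOpen M.K

lemma Model.eventually_mem {U : Ebar p E} (M : Model p E U) :
    ∀ᶠ g in 𝓝 (1 : GHat k), g ∈ M.K.fixingSubgroup :=
  M.isOpen_fixingSubgroup.mem_nhds (one_mem _)

lemma tendsto_conj (g₀ : GHat k) : Filter.Tendsto (fun g : GHat k => g₀ * g * g₀⁻¹) (𝓝 1) (𝓝 1) := by
  have h : Continuous fun g : GHat k => g₀ * g * g₀⁻¹ := by fun_prop
  simpa using h.tendsto 1

lemma Model.conjMap_proj {U : Ebar p E} (M : Model p E U) (g : M.K.fixingSubgroup) :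
    M.conjMap g ≫ M.proj = M.proj := M.isPullback.lift_fst _ _ _

lemma Model.conjMap_snd {U : Ebar p E} (M : Model p E U) (g : M.K.fixingSubgroup) :
    M.conjMap g ≫ U.obj.hom ≫ pullback.snd p (geomPoint k) =
      (U.obj.hom ≫ pullback.snd p (geomPoint k)) ≫
        specAct ((g⁻¹ : M.K.fixingSubgroup) : GHat k) := M.isPullback.lift_snd _ _ _

variable (hE : IsAdmissible p E)
include hE

/-- The composite U → V → V' with the projection to the model of V descends to a finite level L of
the model of U, because V' is of finite presentation over k. An element fixing L acts trivially on
that level, so both sides have the same projection to V'. On k̄ the two sides agree because g was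
conjugated by g₀. -/
lemma conjMap_comm_of_isGood {U V : Ebar p E} (f : U.obj.left ⟶ V.obj.left) (g₀ : GHat k)
    (hf : f ≫ V.obj.hom = U.obj.hom ≫ act p g₀) (M : Model p E U) (N : Model p E V)
    (hN : N.IsGood) :
    ∀ᶠ g in 𝓝 (1 : GHat k), ∀ (hg : g ∈ M.K.fixingSubgroup)
      (hg' : g₀ * g * g₀⁻¹ ∈ N.K.fixingSubgroup),
      M.conjMap ⟨g, hg⟩ ≫ f = f ≫ N.conjMap ⟨_, hg'⟩ := by
  have hMf := M.finite
  have h : IsPullback M.proj (U.obj.hom ≫ pullback.snd p (geomPoint k)) M.toField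
      (specGeom M.K ≫ 𝟙 _) := by
    rw [Category.comp_id]
    exact M.isPullback
  have hc := M.compactSpace hE
  have hq := M.quasiSeparatedSpace hE
  have hft : LocallyOfFiniteType (N.toX ≫ p) := hE.locallyOfFiniteType _ hN
  have hfp : LocallyOfFinitePresentation (N.toX ≫ p) := inferInstance
  obtain ⟨L, a, ha, -⟩ := exists_level_factor h (N.toX ≫ p)
    (M.toField ≫ Spec.map (CommRingCat.ofHom (algebraMap k M.K))) (f ≫ N.proj) (by
      rw [← M.comm, ← Category.assoc, M.proj_toX, Category.assoc, Category.assoc,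
        ← Category.assoc N.proj, N.proj_toX, Category.assoc, ← Category.assoc f, hf,
        Category.assoc, act_fst_assoc])
  have hLf := L.2.2
  filter_upwards [(IntermediateField.fixingSubgroup_isOpen L.1).mem_nhds (one_mem _)] with g hgL
    hg hg'
  have h1 : M.conjMap ⟨g, hg⟩ ≫ toLevel h L = toLevel h L := by
    apply pullback.hom_ext
    · rw [Category.assoc, toLevel_fst, M.conjMap_proj]
    · have h2 := specAct_fixing L.1 ⟨g⁻¹, inv_mem hgL⟩
      rw [Category.assoc, toLevel_snd, ← Category.assoc, M.conjMap_snd, Category.assoc]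
      exact congrArg (_ ≫ ·) h2
  apply N.isPullback.hom_ext
  · rw [Category.assoc, Category.assoc, N.conjMap_proj, ← ha, ← Category.assoc, h1]
  · have h3 : f ≫ V.obj.hom ≫ pullback.snd p (geomPoint k) =
        (U.obj.hom ≫ pullback.snd p (geomPoint k)) ≫ specAct g₀ := by
      rw [← Category.assoc, hf, Category.assoc, Category.assoc, act_snd]
    rw [Category.assoc, Category.assoc, N.conjMap_snd, h3, ← Category.assoc f, h3, ← Category.assoc,
      M.conjMap_snd]
    simp only [Category.assoc, ← specAct_mul]
    congr 3
    simp [mul_assoc]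

/-- The model of V need not be good, hence perhaps not of finite type. The good case applied to the
identity of V shows that any model and a good one induce the same automorphisms near 1. -/
lemma conjMap_comm [PerfectField k] {U V : Ebar p E} (f : U.obj.left ⟶ V.obj.left) (g₀ : GHat k)
    (hf : f ≫ V.obj.hom = U.obj.hom ≫ act p g₀) (M : Model p E U) (N : Model p E V) :
    ∀ᶠ g in 𝓝 (1 : GHat k), ∀ (hg : g ∈ M.K.fixingSubgroup)
      (hg' : g₀ * g * g₀⁻¹ ∈ N.K.fixingSubgroup),
      M.conjMap ⟨g, hg⟩ ≫ f = f ≫ N.conjMap ⟨_, hg'⟩ := by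
  obtain ⟨N', hN'⟩ := exists_good_model hE V
  have h1 := conjMap_comm_of_isGood hE f g₀ hf M N' hN'
  have h2 := (tendsto_conj g₀).eventually (conjMap_comm_of_isGood hE (𝟙 V.obj.left) 1
    (by rw [act_one, Category.id_comp, Category.comp_id]) N N' hN')
  filter_upwards [h1, h2, (tendsto_conj g₀).eventually N'.eventually_mem] with g h1 h2 h3 hg hg'
  have h4 := h2 hg' (by simpa using h3)
  rw [Category.comp_id, Category.id_comp] at h4
  rw [h1 hg h3, h4]
  congr 3

end conj
end WeilEtale
end

noncomputable section
namespace WeilEtale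

/-! ### Models as clopen pieces of their base change, and descent of morphisms to models. -/

section refinement

variable {k : Type u} [Field k] {X : Scheme.{u}} {p : X ⟶ Spec (.of k)} {E : ObjectProperty (Over X)}

/-- The diagonal of an unramified morphism is an open immersion, so open immersions cancel on the
left of such morphisms. -/
lemma isOpenImmersion_of_postcomp {S T Z : Scheme.{u}} (f : S ⟶ T) (g : T ⟶ Z)
    [IsOpenImmersion (f ≫ g)] [FormallyUnramified g] [LocallyOfFiniteType g] :
    IsOpenImmersion f := by
  have h0 : MorphismProperty.IsStableUnderBaseChange
      (@LocallyOfFiniteType ⊓ @FormallyUnramified : MorphismProperty Scheme.{u}) :=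
    MorphismProperty.IsStableUnderBaseChange.inf
  have h : MorphismProperty.HasOfPostcompProperty (@IsOpenImmersion : MorphismProperty Scheme.{u})
      (@LocallyOfFiniteType ⊓ @FormallyUnramified) := by
    rw [MorphismProperty.hasOfPostcompProperty_iff_le_diagonal]
    intro A B q ⟨_, _⟩
    exact inferInstanceAs (IsOpenImmersion (pullback.diagonal q))
  exact h.of_postcomp f g ⟨inferInstance, inferInstance⟩ inferInstance

lemma etale_specIncl [PerfectField k] {K L : IntermediateField k (AlgebraicClosure k)} (h : K ≤ L)
    [FiniteDimensional k K] [FiniteDimensional k L] : Etale (specIncl h) := by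
  have h1 := etale_specMap_of_finite K
  have h2 := etale_specMap_of_finite L
  have h3 : specIncl h ≫ Spec.map (CommRingCat.ofHom (algebraMap k K)) =
      Spec.map (CommRingCat.ofHom (algebraMap k L)) := by
    rw [← Spec.map_comp]
    rfl
  have h4 : Etale (specIncl h ≫ Spec.map (CommRingCat.ofHom (algebraMap k K))) := by rwa [h3]
  exact Etale.of_comp (specIncl h) (Spec.map (CommRingCat.ofHom (algebraMap k K)))

namespace Model

variable {U : Ebar p E} (M : Model p E U)

/-- The morphism from `U` to the base change to `k̄` of a model, considered over `k`. -/
def toGeom : U.obj.left ⟶ geomChange p (Over.mk M.toX) :=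
  pullback.lift M.proj U.obj.hom M.proj_toX

lemma toGeom_fst : M.toGeom ≫ pullback.fst _ _ = M.proj := pullback.lift_fst _ _ _

lemma toGeom_snd : M.toGeom ≫ pullback.snd _ _ = U.obj.hom := pullback.lift_snd _ _ _

/-- The geometric point of the spectrum of the field of definition, as a section. -/
def fieldSection : Spec (.of (AlgebraicClosure k)) ⟶
    pullback (Spec.map (CommRingCat.ofHom (algebraMap k M.K))) (geomPoint k) :=
  pullback.lift (specGeom M.K) (𝟙 _) (by
    rw [Category.id_comp, ← Spec.map_comp]
    rfl)

/-- U = U' ×_K k̄ sits in U' ×_k k̄ as the part over one point of Spec (K ⊗_k k̄), namely the point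
of the given embedding of K. -/
lemma toGeom_isPullback : ∃ c, IsPullback M.toGeom (U.obj.hom ≫ pullback.snd p (geomPoint k)) c
    M.fieldSection := by
  have h0 := geomChange_isPullback (p := p) (Over.mk M.toX)
  let c : geomChange p (Over.mk M.toX) ⟶
      pullback (Spec.map (CommRingCat.ofHom (algebraMap k M.K))) (geomPoint k) :=
    pullback.lift (pullback.fst _ _ ≫ M.toField) (pullback.snd _ _ ≫ pullback.snd _ _) (by
      rw [Category.assoc, ← M.comm]
      exact h0.w)
  refine ⟨c, IsPullback.of_right (h₁₂ := pullback.fst _ _) (v₁₃ := M.toField)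
    (h₂₂ := pullback.fst _ _) ?_ ?_ ?_⟩
  · rw [toGeom_fst, fieldSection, pullback.lift_fst]
    exact M.isPullback
  · apply pullback.hom_ext
    · rw [Category.assoc, pullback.lift_fst, ← Category.assoc, toGeom_fst, Category.assoc,
        fieldSection, pullback.lift_fst, M.isPullback.w]
    · rw [Category.assoc, pullback.lift_snd, ← Category.assoc, toGeom_snd, Category.assoc,
        fieldSection, pullback.lift_snd, Category.comp_id]
  · refine IsPullback.of_bot (h₃₁ := geomPoint k) (v₂₁ := pullback.snd _ _)
      (v₂₂ := Spec.map (CommRingCat.ofHom (algebraMap k M.K))) ?_ (pullback.lift_fst _ _ _).symm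
      (IsPullback.of_hasPullback _ _)
    rw [pullback.lift_snd, ← M.comm]
    exact h0

/-- `toGeom` is a base change of a section of an étale morphism, and such a section is an open
immersion. -/
lemma isOpenImmersion_toGeom [PerfectField k] : IsOpenImmersion M.toGeom := by
  obtain ⟨c, hc⟩ := M.toGeom_isPullback
  have := M.finite
  have := etale_specMap_of_finite M.K
  have h : M.fieldSection ≫ pullback.snd _ _ = 𝟙 _ := pullback.lift_snd _ _ _
  have : IsOpenImmersion (M.fieldSection ≫ pullback.snd _ _) := by rw [h]; infer_instance
  have : IsOpenImmersion M.fieldSection := isOpenImmersion_of_postcomp _ (pullback.snd _ _)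
  exact MorphismProperty.of_isPullback hc.flip this

/-- A section of a separated morphism is a closed immersion. With the open case, U is clopen in U'
×_k k̄. -/
lemma isClosedImmersion_toGeom : IsClosedImmersion M.toGeom := by
  obtain ⟨c, hc⟩ := M.toGeom_isPullback
  have h : M.fieldSection ≫ pullback.snd _ _ = 𝟙 _ := pullback.lift_snd _ _ _
  have : IsClosedImmersion (M.fieldSection ≫ pullback.snd _ _) := by rw [h]; infer_instance
  have : IsClosedImmersion M.fieldSection := IsClosedImmersion.of_comp _ (pullback.snd _ _)
  exact MorphismProperty.of_isPullback hc.flip this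

lemma isPullback_level : IsPullback M.proj (U.obj.hom ≫ pullback.snd p (geomPoint k)) M.toField
    (specGeom M.K ≫ 𝟙 _) := by
  rw [Category.comp_id]
  exact M.isPullback

/-- The base change of a model to a larger finite level. -/
def atLevel (L : FiniteLevel M.K) : Model p E U where
  K := L.1
  finite := L.2.2
  scheme := levelChange M.toField (𝟙 _) L
  toX := pullback.fst _ _ ≫ M.toX
  toField := pullback.snd _ _
  comm := by
    have h : specIncl L.2.1 ≫ Spec.map (CommRingCat.ofHom (algebraMap k M.K)) =
        Spec.map (CommRingCat.ofHom (algebraMap k L.1)) := by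
      rw [← Spec.map_comp]
      rfl
    rw [Category.assoc, M.comm, ← h, ← Category.assoc, pullback.condition, Category.assoc]
    exact congrArg (pullback.snd M.toField (specIncl L.2.1 ≫ 𝟙 _) ≫ ·) (by rw [Category.comp_id])
  proj := toLevel M.isPullback_level L
  proj_toX := by rw [toLevel_fst_assoc, M.proj_toX]
  isPullback := toLevel_isPullback _ L

/-- A flat surjection is an epimorphism of schemes here, so identities between morphisms out of a
model can be checked after pulling back to U. -/
lemma epi_proj : Epi M.proj := by
  have h1 : Flat M.proj := MorphismProperty.of_isPullback M.isPullback.flip inferInstance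
  have h2 : Surjective M.proj := MorphismProperty.of_isPullback M.isPullback.flip inferInstance
  exact Flat.epi_of_flat_of_surjective _

lemma isGood_atLevel [PerfectField k] (hE : IsAdmissible p E) (L : FiniteLevel M.K)
    (hM : M.IsGood) : (M.atLevel L).IsGood := by
  have := M.finite
  have := L.2.2
  have h1 := etale_specIncl L.2.1
  have h2 := hE.separated _ hM
  refine hE.etale_mem (Y := Over.mk M.toX) (Over.homMk (pullback.fst _ _) rfl) hM ?_ ?_ ?_
  · exact inferInstanceAs (Etale (pullback.fst M.toField (specIncl L.2.1 ≫ 𝟙 _)))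
  · exact inferInstanceAs (QuasiCompact (pullback.fst M.toField (specIncl L.2.1 ≫ 𝟙 _)))
  · change IsSeparated ((pullback.fst M.toField (specIncl L.2.1 ≫ 𝟙 _) ≫ M.toX) ≫ p)
    rw [Category.assoc]
    have h3 : IsSeparated (M.toX ≫ p) := h2
    infer_instance

end Model

variable [PerfectField k] (hE : IsAdmissible p E)

include hE in
-- The composite U → V → V' descends to a finite level because V' is of finite presentation over k.
-- Its compatibilities are inherited from those of U and V, since the projection from U is an
-- epimorphism.
lemma exists_model_hom {U V : Ebar p E} (f : U ⟶ V) (N : Model p E V) (hN : N.IsGood) :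
    ∃ (M : Model p E U) (hK : N.K ≤ M.K) (f' : M.scheme ⟶ N.scheme), M.IsGood ∧
      M.proj ≫ f' = f.hom.left ≫ N.proj ∧ f' ≫ N.toX = M.toX ∧
        f' ≫ N.toField = M.toField ≫ specIncl hK := by
  obtain ⟨M, hM⟩ := exists_good_model hE U
  have hfw : f.hom.left ≫ V.obj.hom = U.obj.hom := Over.w f.hom
  have hMf := M.finite
  have hNf := N.finite
  have hc := M.compactSpace hE
  have hq := M.quasiSeparatedSpace hE
  have hft : LocallyOfFiniteType (N.toX ≫ p) := hE.locallyOfFiniteType _ hN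
  have hfp : LocallyOfFinitePresentation (N.toX ≫ p) := inferInstance
  obtain ⟨L, a, ha, -⟩ := exists_level_factor M.isPullback_level (N.toX ≫ p)
    (M.toField ≫ Spec.map (CommRingCat.ofHom (algebraMap k M.K))) (f.hom.left ≫ N.proj) (by
      rw [← M.comm, ← Category.assoc, M.proj_toX, Category.assoc, Category.assoc,
        ← Category.assoc N.proj, N.proj_toX, ← hfw]
      simp only [Category.assoc])
  have hLf := L.2.2
  -- The level is enlarged to contain the field of `N`, without which the structure morphisms to the
  -- two fields could not be compared.
  let L' : FiniteLevel M.K := ⟨L.1 ⊔ N.K, L.2.1.trans le_sup_left, inferInstance⟩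
  have hL : L ≤ L' := (le_sup_left : L.1 ≤ L.1 ⊔ N.K)
  have hcone : toLevel M.isPullback_level L' ≫ (changeDiagram M.toField (𝟙 _)).map (homOfLE hL).op =
      toLevel M.isPullback_level L := (changeCone M.isPullback_level).w (homOfLE hL).op
  have hfac : (M.atLevel L').proj ≫ (changeDiagram M.toField (𝟙 _)).map (homOfLE hL).op ≫ a =
      f.hom.left ≫ N.proj := by
    rw [← ha, ← hcone, Category.assoc]
    rfl
  have he := (M.atLevel L').epi_proj
  have hNK : N.K ≤ (M.atLevel L').K := (le_sup_right : N.K ≤ L.1 ⊔ N.K)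
  have hgeom : specGeom (M.atLevel L').K ≫ specIncl hNK = specGeom N.K := specGeom_incl hNK
  refine ⟨M.atLevel L', hNK,
    (changeDiagram M.toField (𝟙 _)).map (homOfLE hL).op ≫ a, M.isGood_atLevel hE L' hM, hfac,
    ?_, ?_⟩
  · rw [← cancel_epi (M.atLevel L').proj, ← Category.assoc, hfac, Category.assoc, N.proj_toX,
      (M.atLevel L').proj_toX, ← Category.assoc, hfw]
  · rw [← cancel_epi (M.atLevel L').proj, ← Category.assoc, hfac, Category.assoc,
      N.isPullback.w, ← Category.assoc (M.atLevel L').proj, (M.atLevel L').isPullback.w,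
      Category.assoc]
    refine Eq.trans ?_ ((congrArg
      ((U.obj.hom ≫ pullback.snd p (geomPoint k)) ≫ ·) hgeom.symm).trans (Category.assoc _ _ _).symm)
    rw [← hfw]
    simp only [Category.assoc]

/-- Over the common field `M.K`, the morphism `f` is the base change of the descended one along a
faithfully flat quasi-compact morphism, and étaleness descends along it. Changing the field of `N`
to `M.K` is étale as well. -/
lemma etale_of_model_hom {U V : Ebar p E} (f : U ⟶ V) [Etale f.hom.left] (M : Model p E U)
    (N : Model p E V) (hK : N.K ≤ M.K) (f' : M.scheme ⟶ N.scheme)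
    (h1 : M.proj ≫ f' = f.hom.left ≫ N.proj) (h2 : f' ≫ N.toField = M.toField ≫ specIncl hK) :
    Etale f' := by
  have hMf := M.finite
  have hNf := N.finite
  have hfw : f.hom.left ≫ V.obj.hom = U.obj.hom := Over.w f.hom
  let L : FiniteLevel N.K := ⟨M.K, hK, hMf⟩
  let f'' : M.scheme ⟶ levelChange N.toField (𝟙 _) L := pullback.lift f' M.toField (by
    rw [h2, Category.comp_id])
  have hN := toLevel_isPullback N.isPullback_level L
  have hsq : IsPullback M.proj f.hom.left f'' (toLevel N.isPullback_level L) := by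
    refine IsPullback.of_bot (v₂₁ := V.obj.hom ≫ pullback.snd p (geomPoint k))
      (v₂₂ := pullback.snd _ _) (h₃₁ := specGeom M.K) ?_ ?_ hN
    · rw [pullback.lift_snd, ← Category.assoc, hfw]
      exact M.isPullback
    · apply pullback.hom_ext
      · rw [Category.assoc, Category.assoc, pullback.lift_fst, toLevel_fst, h1]
      · rw [Category.assoc, Category.assoc, pullback.lift_snd, toLevel_snd, M.isPullback.w,
          ← hfw]
        simp only [Category.assoc]
  have hs : Surjective (toLevel N.isPullback_level L) :=
    MorphismProperty.of_isPullback hN.flip inferInstance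
  have hf : Flat (toLevel N.isPullback_level L) :=
    MorphismProperty.of_isPullback hN.flip inferInstance
  have hq : QuasiCompact (toLevel N.isPullback_level L) :=
    MorphismProperty.of_isPullback hN.flip inferInstance
  have he : Etale f'' := MorphismProperty.of_isPullback_of_descendsAlong
    (Q := @Surjective ⊓ @Flat ⊓ @QuasiCompact) hsq.flip ⟨⟨hs, hf⟩, hq⟩ inferInstance
  have hi := etale_specIncl hK
  have : f'' ≫ pullback.fst _ _ = f' := pullback.lift_fst _ _ _
  rw [← this]
  infer_instance

end refinement
end WeilEtale
end

noncomputable section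
namespace WeilEtale

/-! ### The étale topology on `Ē`: pulling back étale morphisms, and finite covers. -/

section refinement

variable {k : Type u} [Field k] {X : Scheme.{u}} {p : X ⟶ Spec (.of k)} {E : ObjectProperty (Over X)}

/-- The base change to `k̄` of a morphism of schemes over `X`. -/
abbrev geomMap {Y Z : Over X} (f : Y ⟶ Z) : geomChange p Y ⟶ geomChange p Z :=
  pullback.lift (pullback.fst _ _ ≫ f.left) (pullback.snd _ _) (by
    rw [Category.assoc, Over.w f, pullback.condition])

lemma geomMap_isPullback {Y Z : Over X} (f : Y ⟶ Z) :
    IsPullback (geomMap (p := p) f) (pullback.fst _ _) (pullback.fst _ _) f.left := by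
  refine IsPullback.of_right (h₁₂ := pullback.snd Z.hom (pullback.fst p (geomPoint k)))
    (h₂₂ := Z.hom) (v₁₃ := pullback.fst p (geomPoint k)) ?_ (pullback.lift_fst _ _ _)
    (IsPullback.of_hasPullback _ _).flip
  rw [pullback.lift_snd, Over.w f]
  exact (IsPullback.of_hasPullback _ _).flip

lemma range_toGeom [PerfectField k] {U : Ebar p E} (M : Model p E U) :
    IsClopen (Set.range M.toGeom) := by
  have := M.isOpenImmersion_toGeom
  have := M.isClosedImmersion_toGeom
  exact ⟨M.toGeom.isClosedEmbedding.isClosed_range, M.toGeom.isOpenEmbedding.isOpen_range⟩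

variable (hE : IsAdmissible p E)

include hE in
lemma exists_component {Y : Over X} (hY : E Y) (y : geomChange p Y) :
    ∃ (W : Ebar p E) (i : W.obj.left ⟶ geomChange p Y), IsOpenImmersion i ∧
      i ≫ pullback.snd _ _ = W.obj.hom ∧ Set.range i = connectedComponent y := by
  have hN : IsNoetherian (geomChange p Y) := hE.isNoetherian_geomChange hY
  have hN' : TopologicalSpace.NoetherianSpace (geomChange p Y) := inferInstance
  let O : (geomChange p Y).Opens := ⟨connectedComponent y,
    isOpen_connectedComponent_of_noetherianSpace y⟩
  have hr : Set.range O.ι = connectedComponent y := O.range_ι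
  exact ⟨⟨Over.mk (O.ι ≫ pullback.snd Y.hom (pullback.fst p (geomPoint k))),
    Y, hY, Over.homMk O.ι rfl, inferInstanceAs (IsOpenImmersion O.ι), y, hr⟩, O.ι, inferInstance,
    rfl, hr⟩

variable [PerfectField k]

include hE in
-- `Ē` contains only connected schemes, so fibre products are replaced by components. The fibre
-- product of models is étale over the model of V, hence in `E`. The component of its base change
-- through a point over (v, v₁) is connected and meets the clopen pieces V and V₁, so it maps into
-- them.
lemma exists_refinement {U V V₁ : Ebar p E} (f : V ⟶ U) (j : V₁ ⟶ U) (hj : Etale j.hom.left)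
    (v : V.obj.left) (hv : f.hom.left v ∈ Set.range j.hom.left) :
    ∃ (W : Ebar p E) (a : W ⟶ V) (b : W ⟶ V₁), Etale a.hom.left ∧ v ∈ Set.range a.hom.left ∧
      a ≫ f = b ≫ j := by
  obtain ⟨v₁, hv₁⟩ := hv
  obtain ⟨M, hM⟩ := exists_good_model hE U
  obtain ⟨N, hNK, f', hN, hf', hfX, hfK⟩ := exists_model_hom hE f M hM
  obtain ⟨N₁, hNK₁, j', hN₁, hj', hjX, hjK⟩ := exists_model_hom hE j M hM
  have hj'et : Etale j' := etale_of_model_hom j N₁ M hNK₁ j' hj' hjK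
  have hN₁s : IsSeparated (N₁.toX ≫ p) := hE.separated _ hN₁
  have hNs : IsSeparated (N.toX ≫ p) := hE.separated _ hN
  have hN₁n : IsNoetherian N₁.scheme := hE.isNoetherian hN₁
  have hj's : IsSeparated j' := by
    have : IsSeparated (j' ≫ M.toX ≫ p) := by rwa [← Category.assoc, hjX]
    exact IsSeparated.of_comp j' (M.toX ≫ p)
  have hj'q : QuasiCompact j' := quasiCompact_of_noetherianSpace_source j'
  let F : Over X := Over.mk (pullback.fst f' j' ≫ N.toX)
  let F₀ : F ⟶ Over.mk N.toX := Over.homMk (pullback.fst f' j') rfl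
  let F₁ : F ⟶ Over.mk N₁.toX := Over.homMk (pullback.snd f' j')
    (show pullback.snd f' j' ≫ N₁.toX = pullback.fst f' j' ≫ N.toX by
      rw [← hjX, ← hfX, ← Category.assoc, ← pullback.condition, Category.assoc])
  have hF₀ : Etale F₀.left := inferInstanceAs (Etale (pullback.fst f' j'))
  have hF : E F := by
    refine hE.etale_mem F₀ hN hF₀ (inferInstanceAs (QuasiCompact (pullback.fst f' j'))) ?_
    change IsSeparated ((pullback.fst f' j' ≫ N.toX) ≫ p)
    rw [Category.assoc]
    infer_instance
  have hMo := M.isOpenImmersion_toGeom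
  have hNo := N.isOpenImmersion_toGeom
  have hN₁o := N₁.isOpenImmersion_toGeom
  -- the point of the base change of `F` determined by `v` and `v₁`
  let w : pullback f.hom.left j.hom.left ⟶ geomChange p F :=
    pullback.lift (pullback.lift (pullback.fst _ _ ≫ N.proj) (pullback.snd _ _ ≫ N₁.proj) (by
      rw [Category.assoc, Category.assoc, hf', hj', ← Category.assoc, ← Category.assoc,
        pullback.condition])) (pullback.fst _ _ ≫ V.obj.hom) (by
      change _ ≫ pullback.fst f' j' ≫ N.toX = _
      rw [← Category.assoc, pullback.lift_fst, Category.assoc, Category.assoc, N.proj_toX])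
  have hfw : f.hom.left ≫ U.obj.hom = V.obj.hom := Over.w f.hom
  have hjw : j.hom.left ≫ U.obj.hom = V₁.obj.hom := Over.w j.hom
  have hw₀ : w ≫ geomMap F₀ = pullback.fst _ _ ≫ N.toGeom := by
    apply pullback.hom_ext
    · rw [Category.assoc, pullback.lift_fst, Category.assoc, N.toGeom_fst, pullback.lift_fst_assoc]
      exact pullback.lift_fst _ _ _
    · rw [Category.assoc, pullback.lift_snd, Category.assoc, N.toGeom_snd]
      exact pullback.lift_snd _ _ _
  have hw₁ : w ≫ geomMap F₁ = pullback.snd _ _ ≫ N₁.toGeom := by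
    apply pullback.hom_ext
    · rw [Category.assoc, pullback.lift_fst, Category.assoc, N₁.toGeom_fst,
        pullback.lift_fst_assoc]
      exact pullback.lift_snd _ _ _
    · rw [Category.assoc, pullback.lift_snd, Category.assoc, N₁.toGeom_snd, ← hjw,
        ← Category.assoc, ← pullback.condition, Category.assoc, hfw]
      exact pullback.lift_snd _ _ _
  obtain ⟨z, hz₀, hz₁⟩ := Scheme.Pullback.exists_preimage_pullback v v₁ hv₁.symm
  obtain ⟨W, i, hi, hiW, hir⟩ := exists_component hE hF (w z)
  -- The image of the connected component meets the clopen range of `toGeom` at the image of `w z`,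
  -- hence lies inside it.
  have hlift : ∀ {V' : Ebar p E} (N' : Model p E V') (q : pullback f.hom.left j.hom.left ⟶ V'.obj.left)
      (F' : F ⟶ Over.mk N'.toX) (_ : w ≫ geomMap F' = q ≫ N'.toGeom),
      Set.range (i ≫ geomMap F') ⊆ Set.range N'.toGeom := by
    intro V' N' q F' h
    have h1 : Set.range (i ≫ geomMap F') = geomMap F' '' connectedComponent (w z) := by
      rw [← hir, ← Set.range_comp]
      rfl
    have h2 : geomMap F' (w z) = N'.toGeom (q z) := congrArg (fun t => t z) h
    rw [h1]
    refine ((geomMap F').continuous.image_connectedComponent_subset (w z)).trans ?_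
    exact (range_toGeom N').connectedComponent_subset ⟨q z, h2.symm⟩
  let a' : W.obj.left ⟶ V.obj.left := IsOpenImmersion.lift N.toGeom (i ≫ geomMap F₀)
    (hlift N _ F₀ hw₀)
  let b' : W.obj.left ⟶ V₁.obj.left := IsOpenImmersion.lift N₁.toGeom (i ≫ geomMap F₁)
    (hlift N₁ _ F₁ hw₁)
  have ha' : a' ≫ N.toGeom = i ≫ geomMap F₀ := IsOpenImmersion.lift_fac _ _ _
  have hb' : b' ≫ N₁.toGeom = i ≫ geomMap F₁ := IsOpenImmersion.lift_fac _ _ _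
  have ha'' : a' ≫ V.obj.hom = W.obj.hom := by
    rw [← N.toGeom_snd, ← Category.assoc, ha', Category.assoc, pullback.lift_snd, hiW]
  have hb'' : b' ≫ V₁.obj.hom = W.obj.hom := by
    rw [← N₁.toGeom_snd, ← Category.assoc, hb', Category.assoc, pullback.lift_snd, hiW]
  have haN : a' ≫ N.proj = i ≫ pullback.fst _ _ ≫ pullback.fst f' j' := by
    rw [← N.toGeom_fst, ← Category.assoc, ha', Category.assoc, pullback.lift_fst]
    rfl
  have hbN : b' ≫ N₁.proj = i ≫ pullback.fst _ _ ≫ pullback.snd f' j' := by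
    rw [← N₁.toGeom_fst, ← Category.assoc, hb', Category.assoc, pullback.lift_fst]
    rfl
  have haet : Etale a' := by
    have h1 : Etale (geomMap (p := p) F₀) :=
      MorphismProperty.of_isPullback (geomMap_isPullback F₀).flip hF₀
    have h2 : Etale (a' ≫ N.toGeom) := by
      rw [ha']
      infer_instance
    exact Etale.of_comp a' N.toGeom
  refine ⟨W, homMk a' ha'', homMk b' hb'', haet, ?_, ?_⟩
  · have h1 : w z ∈ Set.range i := by
      rw [hir]
      exact mem_connectedComponent
    obtain ⟨y, hy⟩ := h1
    refine ⟨y, N.toGeom.isOpenEmbedding.injective ?_⟩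
    have h2 : N.toGeom (a' y) = geomMap F₀ (i y) := congrArg (fun t => t y) ha'
    have h3 : geomMap F₀ (w z) = N.toGeom (pullback.fst f.hom.left j.hom.left z) :=
      congrArg (fun t => t z) hw₀
    refine h2.trans ?_
    rw [hy, h3, hz₀]
  · apply ebar_hom_ext
    change a' ≫ f.hom.left = b' ≫ j.hom.left
    -- U → U' ×_k k̄ is a monomorphism, so it is enough to compare the projections to the model of U
    -- and to X ×_k k̄.
    rw [← cancel_mono M.toGeom]
    apply pullback.hom_ext
    · simp only [Category.assoc, M.toGeom_fst]
      rw [← hf', ← hj', ← Category.assoc, haN, ← Category.assoc b', hbN]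
      simp only [Category.assoc, pullback.condition]
    · simp only [Category.assoc, M.toGeom_snd]
      rw [hfw, hjw, ha'', hb'']

include hE in
-- The topology demands refinements after every V' → U. `exists_refinement` produces them from étale
-- morphisms that are jointly surjective onto U alone.
lemma finite_cover_mem {U : Ebar p E} (S : Sieve U) {ι : Type*} (V : ι → Ebar p E)
    (f : ∀ i, V i ⟶ U) (hf : ∀ i, Etale (f i).hom.left) (hS : ∀ i, S (f i))
    (hcov : ∀ x : U.obj.left, ∃ i, x ∈ Set.range (f i).hom.left) : S ∈ etaleTopology p E U := by
  intro V' g x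
  obtain ⟨i, hi⟩ := hcov (g.hom.left x)
  obtain ⟨W, a, b, h1, h2, h3⟩ := exists_refinement hE g (f i) (hf i) x hi
  exact ⟨W, a, h1, h2, h3 ▸ S.downward_closed (hS i) b⟩

include hE in
-- Étale morphisms are open and U is compact. Finiteness is what later allows finitely many
-- neighbourhoods of 1 in the Galois group to be intersected.
lemma exists_finite_cover {U : Ebar p E} (S : Sieve U) (hS : S ∈ etaleTopology p E U) :
    ∃ (n : ℕ) (V : Fin n → Ebar p E) (f : ∀ i, V i ⟶ U), (∀ i, S (f i)) ∧
      Sieve.ofArrows V f ∈ etaleTopology p E U := by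
  have hc := compactSpace_ebar hE U
  choose V f hf hx hfS using fun x => hS (𝟙 U) x
  have ho : ∀ x, IsOpen (Set.range (f x).hom.left) := fun x =>
    have := hf x
    (f x).hom.left.isOpenMap.isOpen_range
  obtain ⟨t, ht⟩ := isCompact_univ.elim_finite_subcover _ ho
    fun x _ => Set.mem_iUnion.2 ⟨x, hx x⟩
  let e := t.equivFin.symm
  refine ⟨t.card, fun i => V (e i), fun i => f (e i), fun i => ?_, ?_⟩
  · simpa using hfS (e i)
  · refine finite_cover_mem hE _ (fun i => V (e i)) (fun i => f (e i)) (fun i => hf _)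
      (fun i => Sieve.ofArrows_mk _ _ i) fun x => ?_
    obtain ⟨y, hy, hxy⟩ := Set.mem_iUnion₂.1 (ht (Set.mem_univ x))
    refine ⟨e.symm ⟨y, hy⟩, ?_⟩
    rw [Equiv.apply_symm_apply]
    exact hxy

end refinement
end WeilEtale
end

noncomputable section
namespace WeilEtale

/-! ### Sheaves of abelian groups through their sections. -/

section sections

universe w
variable {C : Type (w + 1)} [Category.{w} C]

/-- Restriction of sections of a presheaf of abelian groups. -/
def res (P : Cᵒᵖ ⥤ AddCommGrpCat.{w + 1}) {U V : C} (f : V ⟶ U) : P.obj (op U) →+ P.obj (op V) :=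
  (P.map f.op).hom

lemma res_id (P : Cᵒᵖ ⥤ AddCommGrpCat.{w + 1}) {U : C} (x : P.obj (op U)) : res P (𝟙 U) x = x :=
  congrArg (fun t => t.hom x) (P.map_id (op U))

lemma res_res (P : Cᵒᵖ ⥤ AddCommGrpCat.{w + 1}) {U V W : C} (f : V ⟶ U) (g : W ⟶ V)
    (x : P.obj (op U)) : res P g (res P f x) = res P (g ≫ f) x :=
  (congrArg (fun t => t.hom x) (P.map_comp f.op g.op)).symm

/-- The map on sections of a morphism of presheaves of abelian groups. -/
def ap {P Q : Cᵒᵖ ⥤ AddCommGrpCat.{w + 1}} (α : P ⟶ Q) (U : C) : P.obj (op U) →+ Q.obj (op U) :=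
  (α.app (op U)).hom

lemma ap_res {P Q : Cᵒᵖ ⥤ AddCommGrpCat.{w + 1}} (α : P ⟶ Q) {U V : C} (f : V ⟶ U)
    (x : P.obj (op U)) : ap α V (res P f x) = res Q f (ap α U x) :=
  congrArg (fun t => t.hom x) (α.naturality f.op)

lemma psh_hom_ext {P Q : Cᵒᵖ ⥤ AddCommGrpCat.{w + 1}} {α β : P ⟶ Q}
    (h : ∀ U x, ap α U x = ap β U x) : α = β := by
  ext U x
  exact h U.unop x

/-- A morphism of presheaves from its values on sections. -/
def pshHom {P Q : Cᵒᵖ ⥤ AddCommGrpCat.{w + 1}} (f : ∀ U : C, P.obj (op U) →+ Q.obj (op U))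
    (h : ∀ {U V : C} (a : V ⟶ U) (x : P.obj (op U)), f V (res P a x) = res Q a (f U x)) : P ⟶ Q where
  app U := AddCommGrpCat.ofHom (f U.unop)
  naturality U V a := by
    ext x
    exact h a.unop x

/-- A presheaf of abelian groups from its sections and restriction maps. -/
def mkPsh (A : C → Type (w + 1)) [∀ U, AddCommGroup (A U)] (r : ∀ {U V : C}, (V ⟶ U) → A U →+ A V)
    (h1 : ∀ U (x : A U), r (𝟙 U) x = x)
    (h2 : ∀ {U V W : C} (f : V ⟶ U) (g : W ⟶ V) (x : A U), r (g ≫ f) x = r g (r f x)) :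
    Cᵒᵖ ⥤ AddCommGrpCat.{w + 1} where
  obj U := .of (A U.unop)
  map f := AddCommGrpCat.ofHom (r f.unop)
  map_id U := by
    ext x
    exact h1 _ x
  map_comp f g := by
    ext x
    exact h2 f.unop g.unop x

variable {J : GrothendieckTopology C}

/-- Unfolding through the underlying sheaf of sets lets gluing be done with elements. -/
lemma isSheaf_iff_existsUnique (P : Cᵒᵖ ⥤ AddCommGrpCat.{w + 1}) :
    Presheaf.IsSheaf J P ↔ ∀ (U : C) (S : Sieve U), S ∈ J U →
      ∀ (x : ∀ (V : C) (f : V ⟶ U), S f → P.obj (op V)),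
      (∀ (V W : C) (f : V ⟶ U) (hf : S f) (g : W ⟶ V),
        res P g (x V f hf) = x W (g ≫ f) (S.downward_closed hf g)) →
      ∃! t : P.obj (op U), ∀ (V : C) (f : V ⟶ U) (hf : S f), res P f t = x V f hf := by
  rw [Presheaf.isSheaf_iff_isSheaf_forget J P (forget AddCommGrpCat.{w + 1}),
    isSheaf_iff_isSheaf_of_type]
  constructor
  · intro h U S hS x hx
    obtain ⟨t, ht, ht'⟩ := h S hS (fun V f hf => x V f hf)
      ((Presieve.compatible_iff_sieveCompatible _).2
      fun V W f g hf => (hx V W f hf g).symm)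
    exact ⟨t, fun V f hf => ht f hf, fun s hs => ht' s fun V f hf => hs V f hf⟩
  · intro h U S hS x hx
    obtain ⟨t, ht, ht'⟩ := h U S hS (fun V f hf => x f hf) (fun V W f hf g =>
      ((Presieve.compatible_iff_sieveCompatible _).1 hx f g hf).symm)
    exact ⟨t, fun V f hf => ht V f hf, fun s hs => ht' s fun V f hf => hs f hf⟩

lemma sheaf_ext (F : Sheaf J AddCommGrpCat.{w + 1}) {U : C} (S : Sieve U) (hS : S ∈ J U)
    {x y : F.obj.obj (op U)} (h : ∀ (V : C) (f : V ⟶ U), S f → res F.obj f x = res F.obj f y) :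
    x = y :=
  ((isSheaf_iff_existsUnique F.obj).1 F.property U S hS (fun V f _ => res F.obj f y)
    (fun V W f _ g => res_res _ _ _ _)).unique h fun _ _ _ => rfl

lemma sheaf_glue (F : Sheaf J AddCommGrpCat.{w + 1}) {U : C} (S : Sieve U) (hS : S ∈ J U)
    (x : ∀ (V : C) (f : V ⟶ U), S f → F.obj.obj (op V))
    (h : ∀ (V W : C) (f : V ⟶ U) (hf : S f) (g : W ⟶ V),
        res F.obj g (x V f hf) = x W (g ≫ f) (S.downward_closed hf g)) :
    ∃ t : F.obj.obj (op U), ∀ (V : C) (f : V ⟶ U) (hf : S f), res F.obj f t = x V f hf :=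
  ((isSheaf_iff_existsUnique F.obj).1 F.property U S hS x h).exists

/-- Subgroups of the sections of a sheaf that form a subsheaf. -/
structure SubSheaf (F : Sheaf J AddCommGrpCat.{w + 1}) where
  carrier (U : C) : AddSubgroup (F.obj.obj (op U))
  res_mem {U V : C} (f : V ⟶ U) (x : F.obj.obj (op U)) : x ∈ carrier U → res F.obj f x ∈ carrier V
  local_mem {U : C} (S : Sieve U) (hS : S ∈ J U) (x : F.obj.obj (op U)) :
    (∀ (V : C) (f : V ⟶ U), S f → res F.obj f x ∈ carrier V) → x ∈ carrier U

namespace SubSheaf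

variable {F : Sheaf J AddCommGrpCat.{w + 1}} (N : SubSheaf F)

/-- The presheaf of a subsheaf. -/
def psh : Cᵒᵖ ⥤ AddCommGrpCat.{w + 1} :=
  mkPsh (fun U => N.carrier U)
    (fun f => ((res F.obj f).comp (N.carrier _).subtype).codRestrict _
      fun x => N.res_mem f _ x.2)
    (fun U x => Subtype.ext (res_id F.obj x.1))
    (fun f g x => Subtype.ext (res_res F.obj f g x.1).symm)

/-- A subsheaf as a sheaf. -/
def toSheaf : Sheaf J AddCommGrpCat.{w + 1} := ⟨N.psh, by
  rw [isSheaf_iff_existsUnique]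
  intro U S hS x hx
  obtain ⟨t, ht⟩ := sheaf_glue F S hS (fun V f hf => (x V f hf : N.carrier V).1)
    (fun V W f hf g => congrArg Subtype.val (hx V W f hf g))
  refine ⟨(⟨t, N.local_mem S hS t fun V f hf => ?_⟩ : N.carrier U), fun V f hf =>
    Subtype.ext (ht V f hf), fun s hs => Subtype.ext (sheaf_ext F S hS fun V f hf => ?_)⟩
  · rw [ht V f hf]
    exact (x V f hf : N.carrier V).2
  · exact (congrArg Subtype.val (hs V f hf)).trans (ht V f hf).symm⟩

/-- The inclusion of a subsheaf. -/
def incl : N.toSheaf ⟶ F := ⟨pshHom (fun U => (N.carrier U).subtype) fun _ _ => rfl⟩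

lemma incl_injective (U : C) : Function.Injective (ap N.incl.hom U) := Subtype.val_injective

/-- Factorization of a morphism through a subsheaf. -/
def lift {A : Sheaf J AddCommGrpCat.{w + 1}} (φ : A ⟶ F) (h : ∀ U x, ap φ.hom U x ∈ N.carrier U) :
    A ⟶ N.toSheaf :=
  ⟨pshHom (fun U => (ap φ.hom U).codRestrict _ (h U))
    fun a x => Subtype.ext (ap_res φ.hom a x)⟩

instance : Mono N.incl where
  right_cancellation f g h := by
    apply Sheaf.hom_ext
    apply psh_hom_ext
    intro U x
    exact N.incl_injective U (congrArg (fun t => ap t.hom U x) h)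

end SubSheaf

/-- The kernel of a morphism of sheaves, as a subsheaf. -/
def kerSubSheaf {F F' : Sheaf J AddCommGrpCat.{w + 1}} (φ : F ⟶ F') : SubSheaf F where
  carrier U := (ap φ.hom U).ker
  res_mem f x hx := by
    rw [AddMonoidHom.mem_ker] at hx ⊢
    rw [ap_res, hx, map_zero]
  local_mem S hS x h := by
    rw [AddMonoidHom.mem_ker]
    refine sheaf_ext F' S hS fun V f hf => ?_
    rw [← ap_res, map_zero]
    exact h V f hf

end sections

/-! ### Actions as transport maps F(U) → F(V) along morphisms V → gU. -/

section equivariant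

variable {k : Type u} [Field k] {X : Scheme.{u}} {p : X ⟶ Spec (.of k)} {E : ObjectProperty (Over X)}
  {Γ : Subgroup (GHat k)}

namespace EqSheaf

variable (F : EqSheaf p E Γ)

/-- The sections of a sheaf with action. -/
abbrev sec (U : Ebar p E) : Type (u + 1) := F.sheaf.obj.obj (op U)

/-- The map on sections `F(U) → F(V)` induced by a morphism `V → gU`. -/
def tr (g : Γ) {U V : Ebar p E} (a : V.obj.left ⟶ U.obj.left)
    (h : a ≫ U.obj.hom ≫ act p g = V.obj.hom) : F.sec U →+ F.sec V :=
  (res F.sheaf.obj (homMk a h : V ⟶ (twist p E g).obj U)).comp (ap (F.σ g).hom U)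

lemma tr_proof {g h : GHat k} {U V W : Ebar p E} {b : U.obj.left ⟶ W.obj.left}
    (hb : b ≫ W.obj.hom ≫ act p h = U.obj.hom) {a : V.obj.left ⟶ U.obj.left}
    (ha : a ≫ U.obj.hom ≫ act p g = V.obj.hom) :
    (a ≫ b) ≫ W.obj.hom ≫ act p (g * h) = V.obj.hom := by
  rw [act_mul, ← ha, ← hb]
  simp only [Category.assoc]

lemma mul_proof {g h : Γ} {U V W : Ebar p E} {b : U.obj.left ⟶ W.obj.left}
    (hb : b ≫ W.obj.hom ≫ act p h = U.obj.hom) {a : V.obj.left ⟶ U.obj.left}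
    (ha : a ≫ U.obj.hom ≫ act p g = V.obj.hom) :
    (a ≫ b) ≫ W.obj.hom ≫ act p (g * h : Γ) = V.obj.hom :=
  tr_proof hb ha

/-- Naturality of σ_g and the cocycle condition merge into one composition law. With it, every
equality of transports reduces to an equality in the group and an equality of scheme morphisms.
`ofTr` is the converse construction. -/
lemma tr_tr (g h : Γ) {U V W : Ebar p E} (b : U.obj.left ⟶ W.obj.left)
    (hb : b ≫ W.obj.hom ≫ act p h = U.obj.hom) (a : V.obj.left ⟶ U.obj.left)
    (ha : a ≫ U.obj.hom ≫ act p g = V.obj.hom) (x : F.sec W) :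
    F.tr g a ha (F.tr h b hb x) = F.tr (g * h) (a ≫ b) (mul_proof hb ha) x := by
  have h1 : ap (F.σ g).hom U (res F.sheaf.obj (homMk b hb : U ⟶ (twist p E h).obj W)
      (ap (F.σ h).hom W x)) = res F.sheaf.obj ((twist p E g).map
        (homMk b hb : U ⟶ (twist p E h).obj W))
        (ap (F.σ g).hom ((twist p E h).obj W) (ap (F.σ h).hom W x)) :=
    ap_res (F.σ g).hom (homMk b hb : U ⟶ (twist p E h).obj W) _
  have h2 : ap (F.σ (g * h)).hom W x = res F.sheaf.obj ((twistMul p E g h).app W)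
      (ap (F.σ g).hom ((twist p E h).obj W) (ap (F.σ h).hom W x)) :=
    congrArg (fun t => ap t.hom W x) (F.σ_mul g h)
  refine (congrArg _ h1).trans (((res_res _ _ _ _).trans ?_).trans (congrArg (res F.sheaf.obj
    (homMk (a ≫ b) (mul_proof hb ha) : V ⟶ (twist p E (g * h : Γ)).obj W)) h2).symm)
  refine Eq.trans ?_ (res_res _ _ _ _).symm
  refine congrArg (fun t => res F.sheaf.obj t _) ?_
  apply ebar_hom_ext
  exact (Category.comp_id (a ≫ b)).symm

lemma hom_proof (Γ : Subgroup (GHat k)) {U V : Ebar p E} (a : V ⟶ U) :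
    a.hom.left ≫ U.obj.hom ≫ act p (1 : Γ) = V.obj.hom := by
  rw [OneMemClass.coe_one, act_one, Category.comp_id]
  exact Over.w a.hom

lemma tr_one {U V : Ebar p E} (a : V ⟶ U) (x : F.sec U) :
    F.tr 1 a.hom.left (hom_proof Γ a) x = res F.sheaf.obj a x := by
  have h2 : ap (F.σ 1).hom U x = res F.sheaf.obj ((twistOne p E).app U) x :=
    congrArg (fun t => ap t.hom U x) F.σ_one
  refine (congrArg _ h2).trans ((res_res _ _ _ _).trans ?_)
  refine congrArg (fun t => res F.sheaf.obj t _) ?_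
  apply ebar_hom_ext
  exact Category.comp_id a.hom.left

lemma tr_congr {g g' : Γ} (hg : g = g') {U V : Ebar p E} {a a' : V.obj.left ⟶ U.obj.left}
    (ha : a = a') (h : a ≫ U.obj.hom ≫ act p g = V.obj.hom) (x : F.sec U) :
    F.tr g a h x = F.tr g' a' (hg ▸ ha ▸ h) x := by
  subst hg ha
  rfl

variable {F}

lemma tr_map {F' : EqSheaf p E Γ} (φ : F ⟶ F') (g : Γ) {U V : Ebar p E}
    (a : V.obj.left ⟶ U.obj.left) (h : a ≫ U.obj.hom ≫ act p g = V.obj.hom) (x : F.sec U) :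
    ap φ.hom.hom V (F.tr g a h x) = F'.tr g a h (ap φ.hom.hom U x) := by
  refine (ap_res φ.hom.hom _ _).trans (congrArg _ ?_)
  exact congrArg (fun t => ap t.hom U x) (φ.comm g)

end EqSheaf
end equivariant
end WeilEtale
end

noncomputable section
namespace WeilEtale

/-! ### Products of sheaves. -/

section pi

universe w
variable {C : Type (w + 1)} [Category.{w} C] {J : GrothendieckTopology C}

/-- The product of a family of sheaves of abelian groups. -/
def piSheaf {ι : Type w} (B : ι → Sheaf J AddCommGrpCat.{w + 1}) : Sheaf J AddCommGrpCat.{w + 1} :=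
  ⟨mkPsh (fun U => ∀ i, (B i).obj.obj (op U))
    (fun f => AddMonoidHom.mk' (fun x i => res (B i).obj f (x i))
      fun x y => funext fun i => map_add _ (x i) (y i))
    (fun U x => funext fun i => res_id _ (x i))
    (fun f g x => funext fun i => (res_res (B i).obj f g (x i)).symm), by
  rw [isSheaf_iff_existsUnique]
  intro U S hS x hx
  have h : ∀ i, ∃ t : (B i).obj.obj (op U), ∀ (V : C) (f : V ⟶ U) (hf : S f),
      res (B i).obj f t = (x V f hf : ∀ i, (B i).obj.obj (op V)) i := fun i =>
    sheaf_glue (B i) S hS (fun V f hf => (x V f hf : ∀ i, (B i).obj.obj (op V)) i)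
      fun V W f hf g => congrFun (hx V W f hf g) i
  choose t ht using h
  refine ⟨(t : ∀ i, (B i).obj.obj (op U)), fun V f hf => funext fun i => ht i V f hf,
    fun s hs => funext fun i => sheaf_ext (B i) S hS fun V f hf => ?_⟩
  exact (congrFun (hs V f hf) i).trans (ht i V f hf).symm⟩

end pi

variable {k : Type u} [Field k] {X : Scheme.{u}} {p : X ⟶ Spec (.of k)} {E : ObjectProperty (Over X)}

lemma twist_proof {g h g' : GHat k} (hg : g * h = g') {U V : Ebar p E} {a : V.obj.left ⟶ U.obj.left}
    (ha : a ≫ U.obj.hom ≫ act p h = V.obj.hom) :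
    a ≫ U.obj.hom ≫ act p g' = V.obj.hom ≫ act p g := by
  rw [← hg, act_mul, ← ha]
  simp only [Category.assoc]

variable (p E) in
/-- The identification of the scheme underlying `gU` with that underlying `U`. -/
def twId (g : GHat k) (U : Ebar p E) : ((twist p E g).obj U).obj.left ⟶ U.obj.left :=
  𝟙 U.obj.left

variable (p E) in
lemma twId_hom (g : GHat k) (U : Ebar p E) :
    twId p E g U ≫ U.obj.hom ≫ act p g = ((twist p E g).obj U).obj.hom :=
  Category.id_comp (U.obj.hom ≫ act p g)

variable (p E) in
lemma twId_naturality (g : GHat k) {U V : Ebar p E} (a : V ⟶ U) :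
    twId p E g V ≫ a.hom.left = ((twist p E g).map a).hom.left ≫ twId p E g U :=
  (Category.id_comp a.hom.left).trans (Category.comp_id a.hom.left).symm

variable {Γ : Subgroup (GHat k)}

namespace EqSheaf

lemma ofTr_aux (A : AbSheaf p E) (s : ∀ (g : Γ) {U V : Ebar p E} (a : V.obj.left ⟶ U.obj.left)
      (_ : a ≫ U.obj.hom ≫ act p g = V.obj.hom), A.obj.obj (op U) →+ A.obj.obj (op V))
    {g g' : Γ} (hg : g = g') {U V : Ebar p E} {a a' : V.obj.left ⟶ U.obj.left} (ha : a = a')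
    (h : a ≫ U.obj.hom ≫ act p g = V.obj.hom) (x : A.obj.obj (op U)) :
    s g a h x = s g' a' (hg ▸ ha ▸ h) x := by
  subst hg ha
  rfl

/-- Constructor for sheaves with action from the maps `F(U) → F(V)` attached to all `V → gU`. -/
def ofTr (A : AbSheaf p E) (s : ∀ (g : Γ) {U V : Ebar p E} (a : V.obj.left ⟶ U.obj.left)
      (_ : a ≫ U.obj.hom ≫ act p g = V.obj.hom), A.obj.obj (op U) →+ A.obj.obj (op V))
    (s_one : ∀ {U V : Ebar p E} (a : V ⟶ U) (x : A.obj.obj (op U)),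
      s 1 a.hom.left (hom_proof Γ a) x = res A.obj a x)
    (s_s : ∀ (g h : Γ) {U V W : Ebar p E} (b : U.obj.left ⟶ W.obj.left)
      (hb : b ≫ W.obj.hom ≫ act p h = U.obj.hom) (a : V.obj.left ⟶ U.obj.left)
      (ha : a ≫ U.obj.hom ≫ act p g = V.obj.hom) (x : A.obj.obj (op W)),
      s g a ha (s h b hb x) = s (g * h) (a ≫ b) (mul_proof hb ha) x) : EqSheaf p E Γ where
  sheaf := A
  σ g := ⟨pshHom (Q := ((pull p E g).obj A).obj) (fun U => s g (twId p E g U) (twId_hom p E g U)) (by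
    intro U V a x
    refine (congrArg (s g (twId p E g V) (twId_hom p E g V)) (s_one a x).symm).trans
      (Eq.trans ?_ (s_one ((twist p E g).map a) (s g (twId p E g U) (twId_hom p E g U) x)))
    refine (s_s _ _ _ _ _ _ x).trans (Eq.trans ?_ (s_s _ _ _ _ _ _ x).symm)
    exact ofTr_aux A s ((mul_one g).trans (one_mul g).symm) (twId_naturality p E g a) _ x)⟩
  σ_one := by
    apply Sheaf.hom_ext
    apply psh_hom_ext
    intro U x
    exact s_one ((twistOne p E).app U) x
  σ_mul g h := by
    apply Sheaf.hom_ext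
    apply psh_hom_ext
    intro U x
    refine Eq.trans ?_ (s_one ((twistMul p E g h).app U) _)
    refine Eq.trans ?_ (s_s 1 g _ (twId_hom p E g ((twist p E h).obj U)) _ _ _).symm
    refine Eq.trans ?_ (s_s _ h _ (twId_hom p E h U) _ _ _).symm
    exact ofTr_aux A s (by rw [one_mul]) (((Category.comp_id _).trans (Category.comp_id _)).symm) _ x

lemma tr_ofTr (A : AbSheaf p E) (s) (s_one) (s_s) (g : Γ) {U V : Ebar p E}
    (a : V.obj.left ⟶ U.obj.left) (h : a ≫ U.obj.hom ≫ act p g = V.obj.hom)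
    (x : A.obj.obj (op U)) : (ofTr A s s_one s_s).tr g a h x = s g a h x := by
  refine (s_one (homMk a h : V ⟶ (twist p E g).obj U) _).symm.trans ?_
  refine (s_s 1 g _ (twId_hom p E g U) _ _ x).trans ?_
  exact ofTr_aux A s (one_mul g) (Category.comp_id _) _ x

variable {F F' : EqSheaf p E Γ}

lemma tr_id (g : Γ) {U : Ebar p E} (x : F.sec U) :
    F.tr g (twId p E g U) (twId_hom p E g U) x = ap (F.σ g).hom U x :=
  res_id F.sheaf.obj _

/-- Constructor for morphisms of sheaves with action. -/
def mkHom (φ : F.sheaf ⟶ F'.sheaf) (h : ∀ (g : Γ) {U V : Ebar p E} (a : V.obj.left ⟶ U.obj.left)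
    (ha : a ≫ U.obj.hom ≫ act p g = V.obj.hom) (x : F.sec U),
    ap φ.hom V (F.tr g a ha x) = F'.tr g a ha (ap φ.hom U x)) : F ⟶ F' where
  hom := φ
  comm g := by
    apply Sheaf.hom_ext
    apply psh_hom_ext
    intro U x
    have := h g (twId p E g U) (twId_hom p E g U) x
    rw [tr_id, tr_id] at this
    exact this

/-- A subsheaf stable under the action, as a sheaf with action. -/
def sub (F : EqSheaf p E Γ) (N : SubSheaf F.sheaf) (h : ∀ (g : Γ) {U V : Ebar p E}
    (a : V.obj.left ⟶ U.obj.left) (ha : a ≫ U.obj.hom ≫ act p g = V.obj.hom) (x : F.sec U),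
    x ∈ N.carrier U → F.tr g a ha x ∈ N.carrier V) : EqSheaf p E Γ :=
  ofTr N.toSheaf (fun g U V a ha => ((F.tr g a ha).comp (N.carrier U).subtype).codRestrict
      (N.carrier V) fun x => h g a ha _ x.2)
    (fun a x => Subtype.ext (F.tr_one a _))
    (fun g h {U V W} b hb a ha x => Subtype.ext (F.tr_tr g h b hb a ha _))

lemma tr_sub (F : EqSheaf p E Γ) (N : SubSheaf F.sheaf) (h) (g : Γ) {U V : Ebar p E}
    (a : V.obj.left ⟶ U.obj.left) (ha : a ≫ U.obj.hom ≫ act p g = V.obj.hom) (x : N.carrier U) :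
    (F.sub N h).tr g a ha x = (⟨F.tr g a ha x.1, h g a ha _ x.2⟩ : N.carrier V) :=
  tr_ofTr N.toSheaf _ _ _ g a ha x

/-- The inclusion of a stable subsheaf. -/
def subIncl (F : EqSheaf p E Γ) (N : SubSheaf F.sheaf) (h) : F.sub N h ⟶ F :=
  mkHom (F := F.sub N h) N.incl fun g U V a ha x => congrArg Subtype.val (F.tr_sub N h g a ha x)

/-- Factorization through a stable subsheaf. -/
def subLift {N : SubSheaf F'.sheaf} {h} (φ : F ⟶ F') (hφ : ∀ U x, ap φ.hom.hom U x ∈ N.carrier U) :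
    F ⟶ F'.sub N h :=
  mkHom (F' := F'.sub N h) (N.lift φ.hom hφ) fun g U V a ha x =>
    (Subtype.ext (tr_map φ g a ha x)).trans (F'.tr_sub N h g a ha _).symm

lemma res_proof {g : GHat k} {U Z W : Ebar p E} {s : Z.obj.left ⟶ U.obj.left}
    (hs : s ≫ U.obj.hom ≫ act p g = Z.obj.hom) (b : W ⟶ Z) :
    (b.hom.left ≫ s) ≫ U.obj.hom ≫ act p g = W.obj.hom := by
  rw [Category.assoc, hs]
  exact Over.w b.hom

lemma res_tr (F : EqSheaf p E Γ) (g : Γ) {U Z W : Ebar p E} (s : Z.obj.left ⟶ U.obj.left)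
    (hs : s ≫ U.obj.hom ≫ act p g = Z.obj.hom) (b : W ⟶ Z) (x : F.sec U) :
    res F.sheaf.obj b (F.tr g s hs x) = F.tr g (b.hom.left ≫ s) (res_proof hs b) x := by
  refine (F.tr_one b (F.tr g s hs x)).symm.trans ?_
  refine (F.tr_tr 1 g s hs b.hom.left (hom_proof Γ b) x).trans ?_
  exact F.tr_congr (one_mul g) rfl _ x

lemma tr_eq_self (F : EqSheaf p E Γ) {U : Ebar p E} (a : U.obj.left ⟶ U.obj.left)
    (ha : a = 𝟙 U.obj.left) (h : a ≫ U.obj.hom ≫ act p (1 : Γ) = U.obj.hom) (x : F.sec U) :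
    F.tr 1 a h x = x := by
  subst ha
  exact (F.tr_one (𝟙 U) x).trans (res_id _ _)

/-- Two ways of composing transport maps agree. -/
lemma tr_tr_eq_res_tr (F : EqSheaf p E Γ) {g h c : Γ} (hc : g * h = c) {U V W Z : Ebar p E}
    (a : V.obj.left ⟶ U.obj.left) (ha : a ≫ U.obj.hom ≫ act p h = V.obj.hom)
    (t : W.obj.left ⟶ V.obj.left) (ht : t ≫ V.obj.hom ≫ act p g = W.obj.hom)
    (s : Z.obj.left ⟶ U.obj.left) (hs : s ≫ U.obj.hom ≫ act p c = Z.obj.hom) (b : W ⟶ Z)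
    (hb : t ≫ a = b.hom.left ≫ s) (x : F.sec U) :
    F.tr g t ht (F.tr h a ha x) = res F.sheaf.obj b (F.tr c s hs x) := by
  refine Eq.trans ?_ (F.tr_one b (F.tr c s hs x))
  refine (F.tr_tr g h a ha t ht x).trans (Eq.trans ?_
    (F.tr_tr 1 c s hs b.hom.left (hom_proof Γ b) x).symm)
  exact F.tr_congr (hc.trans (one_mul c).symm) hb _ x

end EqSheaf

/-! ### Coinduction, the right adjoint of forgetting the action. -/

section coind

variable (Γ) (A : AbSheaf p E)

/-- The underlying sheaf `∏ g^* A` of the coinduced sheaf. -/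
abbrev coindSheaf : AbSheaf p E := piSheaf fun g : Γ => (pull p E g).obj A

/-- The sections of the coinduced sheaf. -/
abbrev coindSec (U : Ebar p E) : Type (u + 1) := ∀ g : Γ, A.obj.obj (op ((twist p E g).obj U))

variable {Γ A}

lemma coind_res_congr {U W : Ebar p E} (f : coindSec Γ A U) {g g' : Γ} (hg : g = g')
    {a a' : W.obj.left ⟶ U.obj.left} (ha : a = a')
    (h : a ≫ U.obj.hom ≫ act p g = W.obj.hom) :
    res A.obj (homMk a h : W ⟶ (twist p E g).obj U) (f g) =
      res A.obj (homMk a' (hg ▸ ha ▸ h) : W ⟶ (twist p E g').obj U) (f g') := by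
  subst hg ha
  rfl

variable (p E) in
/-- The morphism `gV → (gh)U` determined by a morphism `V → hU`. -/
def twistHom (g h : Γ) {U V : Ebar p E} (a : V.obj.left ⟶ U.obj.left)
    (ha : a ≫ U.obj.hom ≫ act p h = V.obj.hom) :
    (twist p E g).obj V ⟶ (twist p E (g * h : Γ)).obj U :=
  homMk a (twist_proof (Subgroup.coe_mul Γ g h).symm ha)

/-- The maps defining the action on the coinduced sheaf. -/
def coindTr (h : Γ) {U V : Ebar p E} (a : V.obj.left ⟶ U.obj.left)
    (ha : a ≫ U.obj.hom ≫ act p h = V.obj.hom) : coindSec Γ A U →+ coindSec Γ A V :=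
  AddMonoidHom.mk' (fun f g => res A.obj (twistHom p E g h a ha) (f (g * h)))
    fun f f' => funext fun g => map_add (res A.obj (twistHom p E g h a ha)) _ _

variable (Γ A)

/-- The coinduced sheaf with action. -/
def coindObj : EqSheaf p E Γ :=
  EqSheaf.ofTr (coindSheaf Γ A) (fun h _ _ a ha => coindTr (A := A) h a ha)
    (fun {U V} a x => funext fun g => coind_res_congr (W := (twist p E g).obj V) x (mul_one g) rfl _)
    (fun g h {U V W} b hb a ha x => funext fun c => by
      refine (res_res A.obj _ _ _).trans ?_
      exact coind_res_congr (W := (twist p E c).obj V) (a := a ≫ b) (U := W) x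
        (mul_assoc c g h) rfl (twist_proof (by simp [mul_assoc]) (EqSheaf.tr_proof hb ha)))

/-- The action is by right translation, (hf)(g) = f(gh). Left translation stays free for the shift
by Frobenius. -/
lemma coind_tr (h : Γ) {U V : Ebar p E} (a : V.obj.left ⟶ U.obj.left)
    (ha : a ≫ U.obj.hom ≫ act p h = V.obj.hom) (f : coindSec Γ A U) (g : Γ) :
    ((coindObj Γ A).tr h a ha f : coindSec Γ A V) g =
      res A.obj (twistHom p E g h a ha) (f (g * h)) :=
  congrFun (EqSheaf.tr_ofTr (coindSheaf Γ A) _ _ _ h a ha f : (_ : coindSec Γ A V) = _) g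

variable {A} in
/-- The map of coinduced sheaves induced by a morphism of sheaves. -/
def coindSheafMap {B : AbSheaf p E} (α : A ⟶ B) : coindSheaf Γ A ⟶ coindSheaf Γ B :=
  ⟨pshHom (P := (coindSheaf Γ A).obj) (Q := (coindSheaf Γ B).obj)
    (fun U => AddMonoidHom.mk' (fun (f : coindSec Γ A U) g => (ap α.hom _ (f g) :
        B.obj.obj (op ((twist p E g).obj U))))
      fun f f' => funext fun g => map_add (ap α.hom _) (f g) (f' g))
    fun {U V} a f => funext fun g => ap_res α.hom ((twist p E g).map a) ((f : coindSec Γ A U) g)⟩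

variable (p E) in
/-- The right adjoint of the functor forgetting the action. -/
def coind (Γ : Subgroup (GHat k)) : AbSheaf p E ⥤ EqSheaf p E Γ where
  obj A := coindObj Γ A
  map {A B} α := EqSheaf.mkHom (F := coindObj Γ A) (F' := coindObj Γ B) (coindSheafMap Γ α)
    fun h U V a ha f => funext fun g =>
      (congrArg (ap α.hom ((twist p E g).obj V)) (coind_tr Γ A h a ha f g)).trans
        ((ap_res α.hom (twistHom p E g h a ha) ((f : coindSec Γ A U) (g * h))).trans
          (coind_tr Γ B h a ha (fun g => ap α.hom _ ((f : coindSec Γ A U) g)) g).symm)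
  map_id A := rfl
  map_comp α β := rfl

lemma one_proof (U : Ebar p E) : 𝟙 U.obj.left ≫ U.obj.hom ≫ act p (1 : Γ) = U.obj.hom := by
  rw [OneMemClass.coe_one, act_one, Category.comp_id, Category.id_comp]

/-- The morphism `U → 1U`. -/
def oneHom (U : Ebar p E) : U ⟶ (twist p E (1 : Γ)).obj U :=
  homMk (𝟙 U.obj.left) (one_proof Γ U)

lemma oneHom_naturality {U V : Ebar p E} (a : V ⟶ U) :
    oneHom Γ V ≫ (twist p E (1 : Γ)).map a = a ≫ oneHom Γ U :=
  ebar_hom_ext _ _ ((Category.id_comp a.hom.left).trans (Category.comp_id a.hom.left).symm)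

/-- Evaluation at the neutral element. -/
def coindEval : coindSheaf Γ A ⟶ A :=
  ⟨pshHom (P := (coindSheaf Γ A).obj) (fun U => AddMonoidHom.mk'
      (fun (f : coindSec Γ A U) => res A.obj (oneHom Γ U) (f 1))
      fun f f' => map_add (res A.obj (oneHom Γ U)) (f 1) (f' 1))
    fun {U V} a f => (res_res A.obj ((twist p E (1 : Γ)).map a) (oneHom Γ V)
        ((f : coindSec Γ A U) 1)).trans
      ((congrArg (fun t => res A.obj t ((f : coindSec Γ A U) 1)) (oneHom_naturality Γ a)).trans
        (res_res A.obj (oneHom Γ U) a _).symm)⟩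

variable {A} {U : Ebar p E}

/-- The map to the coinduced sheaf determined by a morphism of sheaves. -/
def coindLiftSheaf {F : EqSheaf p E Γ} (ψ : F.sheaf ⟶ A) : F.sheaf ⟶ coindSheaf Γ A :=
  ⟨pshHom (Q := (coindSheaf Γ A).obj)
    (fun U => AddMonoidHom.mk' (fun x (g : Γ) => (ap ψ.hom ((twist p E g).obj U)
      (ap (F.σ g).hom U x) : A.obj.obj (op ((twist p E g).obj U))))
      fun x y => funext fun g => (congrArg (ap ψ.hom ((twist p E g).obj U))
        (map_add (ap (F.σ g).hom U) x y)).trans (map_add (ap ψ.hom ((twist p E g).obj U)) _ _))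
    fun {U V} a x => funext fun g =>
      (congrArg (ap ψ.hom ((twist p E g).obj V)) (ap_res (F.σ g).hom a x)).trans
        (ap_res ψ.hom ((twist p E g).map a) _)⟩

lemma ap_coindLiftSheaf {F : EqSheaf p E Γ} (ψ : F.sheaf ⟶ A) (U : Ebar p E) (x : F.sec U) (g : Γ) :
    (ap (coindLiftSheaf Γ ψ).hom U x : coindSec Γ A U) g =
      ap ψ.hom ((twist p E g).obj U) (F.tr g (twId p E g U) (twId_hom p E g U) x) :=
  congrArg (ap ψ.hom ((twist p E g).obj U)) (F.tr_id g x).symm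

lemma tr_twId_tr (F : EqSheaf p E Γ) (g h : Γ) {U V : Ebar p E} (a : V.obj.left ⟶ U.obj.left)
    (ha : a ≫ U.obj.hom ≫ act p h = V.obj.hom) (x : F.sec U) :
    F.tr g (twId p E g V) (twId_hom p E g V) (F.tr h a ha x) =
      res F.sheaf.obj (twistHom p E g h a ha)
        (F.tr (g * h) (twId p E (g * h : Γ) U) (twId_hom p E (g * h : Γ) U) x) :=
  F.tr_tr_eq_res_tr rfl a ha (twId p E g V) (twId_hom p E g V) (twId p E (g * h : Γ) U)
    (twId_hom p E (g * h : Γ) U) (twistHom p E g h a ha)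
    ((Category.id_comp a).trans (Category.comp_id a).symm) x

lemma coindLift_comm {F : EqSheaf p E Γ} (ψ : F.sheaf ⟶ A) (h : Γ) {U V : Ebar p E}
    (a : V.obj.left ⟶ U.obj.left) (ha : a ≫ U.obj.hom ≫ act p h = V.obj.hom) (x : F.sec U) (g : Γ) :
    (ap (coindLiftSheaf Γ ψ).hom V (F.tr h a ha x) : coindSec Γ A V) g =
      res A.obj (twistHom p E g h a ha)
        ((ap (coindLiftSheaf Γ ψ).hom U x : coindSec Γ A U) (g * h)) := by
  refine (ap_coindLiftSheaf Γ ψ V (F.tr h a ha x) g).trans ?_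
  refine (congrArg (ap ψ.hom ((twist p E g).obj V)) (tr_twId_tr Γ F g h a ha x)).trans ?_
  refine (ap_res ψ.hom (twistHom p E g h a ha) _).trans ?_
  exact congrArg (res A.obj (twistHom p E g h a ha)) (ap_coindLiftSheaf Γ ψ U x (g * h)).symm

/-- The morphism to a coinduced sheaf determined by a morphism of sheaves. -/
def coindLift {F : EqSheaf p E Γ} (ψ : F.sheaf ⟶ A) : F ⟶ coindObj Γ A :=
  EqSheaf.mkHom (F' := coindObj Γ A) (coindLiftSheaf Γ ψ) fun h U V a ha x => funext fun g =>
    (coindLift_comm Γ ψ h a ha x g).trans (coind_tr Γ A h a ha _ g).symm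

lemma one_coindTr (f : coindSec Γ A U) (g : Γ) :
    res A.obj (oneHom Γ ((twist p E g).obj U))
      (res A.obj (twistHom p E 1 g (twId p E g U) (twId_hom p E g U)) (f (1 * g))) = f g := by
  have key : ∀ (c : Γ) (_ : c = g) (t : (twist p E g).obj U ⟶ (twist p E c).obj U)
      (_ : t.hom.left = 𝟙 U.obj.left), res A.obj t (f c) = f g := by
    rintro c rfl t ht
    have : t = 𝟙 _ := ebar_hom_ext _ _ ht
    rw [this]
    exact res_id _ _
  refine (res_res A.obj (twistHom p E 1 g (twId p E g U) (twId_hom p E g U))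
    (oneHom Γ ((twist p E g).obj U)) (f (1 * g))).trans (key (1 * g) (one_mul g) _ ?_)
  exact Category.comp_id (𝟙 U.obj.left)

/-- For a coinduced section f(g) = (gf)(1), so an equivariant morphism to a coinduced sheaf is
determined by its values at 1. -/
lemma coindLiftSheaf_eval {F : EqSheaf p E Γ} (φ : F ⟶ coindObj Γ A) (x : F.sec U) (g : Γ) :
    (ap (coindLiftSheaf Γ (φ.hom ≫ coindEval Γ A)).hom U x : coindSec Γ A U) g =
      (ap φ.hom.hom U x : coindSec Γ A U) g := by
  refine (ap_coindLiftSheaf Γ (φ.hom ≫ coindEval Γ A) U x g).trans ?_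
  have h1 := EqSheaf.tr_map φ g (twId p E g U) (twId_hom p E g U) x
  refine (congrArg (fun t : coindSec Γ A ((twist p E g).obj U) =>
    res A.obj (oneHom Γ ((twist p E g).obj U)) (t 1)) h1).trans ?_
  refine (congrArg (res A.obj (oneHom Γ ((twist p E g).obj U))) (coind_tr Γ A g (twId p E g U)
    (twId_hom p E g U) (ap φ.hom.hom U x) 1)).trans ?_
  exact one_coindTr Γ (ap φ.hom.hom U x) g

lemma eval_coindLiftSheaf {F : EqSheaf p E Γ} (ψ : F.sheaf ⟶ A) (x : F.sec U) :
    res A.obj (oneHom Γ U) ((ap (coindLiftSheaf Γ ψ).hom U x : coindSec Γ A U) 1) =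
      ap ψ.hom U x := by
  refine (congrArg (res A.obj (oneHom Γ U)) (ap_coindLiftSheaf Γ ψ U x 1)).trans ?_
  refine (ap_res ψ.hom (oneHom Γ U) _).symm.trans (congrArg (ap ψ.hom U) ?_)
  refine (F.res_tr 1 (twId p E (1 : Γ) U) (twId_hom p E (1 : Γ) U) (oneHom Γ U) x).trans ?_
  exact F.tr_eq_self _ (Category.comp_id (𝟙 U.obj.left)) _ x

/-- Morphisms to a coinduced sheaf. -/
def coindEquiv (F : EqSheaf p E Γ) (A : AbSheaf p E) : (F.sheaf ⟶ A) ≃ (F ⟶ coindObj Γ A) where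
  toFun ψ := coindLift Γ ψ
  invFun φ := φ.hom ≫ coindEval Γ A
  left_inv ψ := by
    apply Sheaf.hom_ext
    apply psh_hom_ext
    intro U x
    exact eval_coindLiftSheaf Γ ψ x
  right_inv φ := by
    apply EqSheaf.hom_ext
    apply Sheaf.hom_ext
    apply psh_hom_ext
    intro U x
    exact funext fun g => coindLiftSheaf_eval Γ φ x g

lemma coindLift_eval {F : EqSheaf p E Γ} (ψ : F.sheaf ⟶ A) :
    (coindLift Γ ψ).hom ≫ coindEval Γ A = ψ :=
  (coindEquiv Γ F A).symm_apply_apply ψ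

lemma coindLift_comp {F F' : EqSheaf p E Γ} (f : F' ⟶ F) (ψ : F.sheaf ⟶ A) :
    coindLift Γ (f.hom ≫ ψ) = f ≫ coindLift Γ ψ :=
  (coindEquiv Γ F' A).symm.injective ((coindLift_eval Γ (f.hom ≫ ψ)).trans
    (congrArg (f.hom ≫ ·) (coindLift_eval Γ ψ)).symm)

variable (p E) in
/-- The adjunction between forgetting the action and coinduction. -/
def coindAdj (Γ : Subgroup (GHat k)) : EqSheaf.forget p E Γ ⊣ coind p E Γ :=
  Adjunction.mkOfHomEquiv
    { homEquiv := coindEquiv Γ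
      homEquiv_naturality_left_symm := fun f g => rfl
      homEquiv_naturality_right := fun f g => rfl }

end coind

end WeilEtale
end

noncomputable section
namespace WeilEtale

open scoped Topology

/-! ### Smooth sections and the reformulation of continuity. -/

section smooth

variable {k : Type u} [Field k] {X : Scheme.{u}} {p : X ⟶ Spec (.of k)} {E : ObjectProperty (Over X)}

lemma Model.conjMap_one {U : Ebar p E} (M : Model p E U) : M.conjMap 1 = 𝟙 _ := by
  apply M.isPullback.hom_ext
  · rw [M.conjMap_proj, Category.id_comp]
  · rw [M.conjMap_snd]
    simp [specAct_one]

lemma Model.conjMap_mul {U : Ebar p E} (M : Model p E U) (g h : M.K.fixingSubgroup) :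
    M.conjMap (g * h) = M.conjMap g ≫ M.conjMap h := by
  apply M.isPullback.hom_ext
  · rw [Category.assoc, M.conjMap_proj, M.conjMap_proj, M.conjMap_proj]
  · rw [Category.assoc, M.conjMap_snd, M.conjMap_snd, ← Category.assoc, M.conjMap_snd]
    simp only [Category.assoc, ← specAct_mul, mul_inv_rev, Subgroup.coe_mul]

lemma Model.conjMap_congr {U : Ebar p E} (M : Model p E U) {g g' : GHat k} (h : g = g')
    (hg : g ∈ M.K.fixingSubgroup) :
    M.conjMap ⟨g, hg⟩ = M.conjMap ⟨g', h ▸ hg⟩ := by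
  subst h
  rfl

variable (F : EqSheaf p E (⊤ : Subgroup (GHat k)))

lemma Model.conjMap_act {U : Ebar p E} (M : Model p E U) (h : GHat k)
    (hh : h ∈ M.K.fixingSubgroup) : M.conjMap ⟨h, hh⟩ ≫ U.obj.hom ≫ act p h = U.obj.hom :=
  M.conjMap_comp ⟨h, hh⟩

/-- The action of an element fixing the field of definition of a model. -/
def Model.conjTr {U : Ebar p E} (M : Model p E U) (h : GHat k) (hh : h ∈ M.K.fixingSubgroup) :
    F.sec U →+ F.sec U :=
  F.tr ⟨h, Subgroup.mem_top h⟩ (M.conjMap ⟨h, hh⟩) (M.conjMap_act h hh)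

lemma Model.galAct_apply {U : Ebar p E} (M : Model p E U) (g : M.K.fixingSubgroup) (x : F.sec U) :
    (M.galAct F g).hom x = M.conjTr F g g.2 x := rfl

lemma Model.conjTr_congr {U : Ebar p E} (M : Model p E U) {g g' : GHat k} (h : g = g')
    (hg : g ∈ M.K.fixingSubgroup) (x : F.sec U) :
    M.conjTr F g hg x = M.conjTr F g' (h ▸ hg) x := by
  subst h
  rfl

lemma Model.conjTr_one {U : Ebar p E} (M : Model p E U) (x : F.sec U) :
    M.conjTr F 1 (one_mem _) x = x :=
  F.tr_eq_self (M.conjMap ⟨1, one_mem _⟩) M.conjMap_one (M.conjMap_act 1 (one_mem _)) x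

lemma Model.conjTr_mul {U : Ebar p E} (M : Model p E U) (g h : GHat k)
    (hg : g ∈ M.K.fixingSubgroup) (hh : h ∈ M.K.fixingSubgroup) (x : F.sec U) :
    M.conjTr F (g * h) (mul_mem hg hh) x = M.conjTr F g hg (M.conjTr F h hh x) := by
  have h2 : M.conjMap ⟨g * h, mul_mem hg hh⟩ = M.conjMap ⟨g, hg⟩ ≫ M.conjMap ⟨h, hh⟩ :=
    M.conjMap_mul ⟨g, hg⟩ ⟨h, hh⟩
  rw [Model.conjTr, Model.conjTr, Model.conjTr,
    F.tr_tr ⟨g, Subgroup.mem_top g⟩ ⟨h, Subgroup.mem_top h⟩ (M.conjMap ⟨h, hh⟩)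
      (M.conjMap_act h hh) (M.conjMap ⟨g, hg⟩) (M.conjMap_act g hg) x]
  simp only [h2]
  congr 1

/-- A section is smooth if it is fixed by the elements near `1`. -/
def IsSmooth {U : Ebar p E} (x : F.sec U) : Prop :=
  ∀ M : Model p E U, ∀ᶠ h in 𝓝 (1 : GHat k), ∀ hh, M.conjTr F h hh x = x

lemma isContinuous_iff_conjTr : isContinuous p E F ↔ ∀ (U : Ebar p E) (M : Model p E U)
    (t : TopologicalSpace (F.sec U)), t = ⊥ →
    Continuous fun x : M.K.fixingSubgroup × F.sec U => M.conjTr F x.1 x.1.2 x.2 := by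
  refine forall_congr' fun U => forall_congr' fun M => ?_
  simp only [Model.galAct_apply]
  exact ⟨fun h t ht => ht ▸ h, fun h => h ⊥ rfl⟩

/-- For a discrete target, joint continuity means that each section has an open stabilizer. Near (g,
x) one writes g' = g · (g⁻¹g') and uses that g⁻¹g' is close to 1. -/
lemma isContinuous_iff : isContinuous p E F ↔ ∀ (U : Ebar p E) (x : F.sec U), IsSmooth F x := by
  rw [isContinuous_iff_conjTr]
  constructor
  · intro h U x M
    let t : TopologicalSpace (F.sec U) := ⊥
    have _ : DiscreteTopology (F.sec U) := ⟨rfl⟩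
    have h0 := h U M t rfl
    have h1 : Continuous fun g : M.K.fixingSubgroup => ((g, x) : M.K.fixingSubgroup × F.sec U) := by
      fun_prop
    have h2 : ∀ᶠ g : M.K.fixingSubgroup in 𝓝 1, M.conjTr F g g.2 x =
        M.conjTr F (1 : M.K.fixingSubgroup) (one_mem _) x := by
      have h4 := (h0.comp h1).tendsto 1
      rw [nhds_discrete (F.sec U), Filter.tendsto_pure] at h4
      exact h4
    have h3 : M.conjTr F (1 : M.K.fixingSubgroup) (one_mem _) x = x :=
      (M.conjTr_congr F (OneMemClass.coe_one _) _ x).trans (M.conjTr_one F x)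
    rw [h3] at h2
    rw [nhds_subtype_eq_comap, Filter.eventually_comap, OneMemClass.coe_one] at h2
    filter_upwards [h2] with g hg hh
    exact hg ⟨g, hh⟩ rfl
  · intro h U M t ht
    have _ : DiscreteTopology (F.sec U) := ⟨ht⟩
    rw [continuous_iff_continuousAt]
    rintro ⟨g, x⟩
    refine Filter.Tendsto.mono_right ?_ (pure_le_nhds _)
    rw [nhds_prod_eq, nhds_discrete (F.sec U), Filter.tendsto_pure, Filter.prod_pure, Filter.eventually_map]
    have h1 : Filter.Tendsto (fun g' : M.K.fixingSubgroup => (g : GHat k)⁻¹ * g') (𝓝 g) (𝓝 1) := by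
      have : Continuous (fun g' : M.K.fixingSubgroup => (g : GHat k)⁻¹ * g') :=
        continuous_const.mul continuous_subtype_val
      simpa using this.tendsto g
    filter_upwards [h1.eventually (h U x M)] with g' hg'
    have h3 := M.conjTr_mul F g (g.1⁻¹ * g'.1) g.2 (mul_mem (inv_mem g.2) g'.2) x
    rw [hg' (mul_mem (inv_mem g.2) g'.2)] at h3
    rw [← h3]
    exact M.conjTr_congr F (mul_inv_cancel_left _ _).symm _ x

section

variable [PerfectField k] (hE : IsAdmissible p E) {F}
include hE

/-- The group identity is hg = g(g⁻¹hg). The underlying scheme automorphisms are intertwined only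
for h near 1, by `conjMap_comm`. -/
lemma eventually_conjTr_tr (g : (⊤ : Subgroup (GHat k))) {U V : Ebar p E}
    (a : V.obj.left ⟶ U.obj.left) (ha : a ≫ U.obj.hom ≫ act p g = V.obj.hom)
    (N : Model p E V) (M : Model p E U) :
    ∀ᶠ h in 𝓝 (1 : GHat k), ∀ hh hh', ∀ x : F.sec U, N.conjTr F h hh (F.tr g a ha x) =
      F.tr g a ha (M.conjTr F ((g : GHat k)⁻¹ * h * g) hh' x) := by
  have h1 : a ≫ U.obj.hom = V.obj.hom ≫ act p (g : GHat k)⁻¹ := by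
    rw [← ha, Category.assoc, Category.assoc, ← act_mul, inv_mul_cancel, act_one, Category.comp_id]
  filter_upwards [conjMap_comm hE a _ h1 N M] with h h2 hh hh' x
  have h3 : g.1⁻¹ * h * g.1⁻¹⁻¹ ∈ M.K.fixingSubgroup := by rwa [inv_inv]
  have h4 : N.conjMap ⟨h, hh⟩ ≫ a = a ≫ M.conjMap ⟨(g : GHat k)⁻¹ * h * g, hh'⟩ :=
    (h2 hh h3).trans (congrArg (a ≫ ·) (M.conjMap_congr (by rw [inv_inv]) h3))
  have h5 : (⟨h, Subgroup.mem_top h⟩ : (⊤ : Subgroup (GHat k))) * g =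
      g * ⟨(g : GHat k)⁻¹ * h * g, Subgroup.mem_top _⟩ := by
    apply Subtype.ext
    change h * g.1 = g.1 * (g.1⁻¹ * h * g.1)
    simp only [mul_assoc, mul_inv_cancel_left]
  rw [Model.conjTr, Model.conjTr, F.tr_tr ⟨h, Subgroup.mem_top h⟩ g a ha (N.conjMap ⟨h, hh⟩)
    (N.conjMap_act h hh), F.tr_tr g ⟨(g : GHat k)⁻¹ * h * g, Subgroup.mem_top _⟩
    (M.conjMap ⟨_, hh'⟩) (M.conjMap_act _ hh') a ha]
  simp only [h5, h4]

lemma IsSmooth.tr {g : (⊤ : Subgroup (GHat k))} {U V : Ebar p E}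
    {a : V.obj.left ⟶ U.obj.left} (ha : a ≫ U.obj.hom ≫ act p g = V.obj.hom)
    {x : F.sec U} (hx : IsSmooth F x) : IsSmooth F (F.tr g a ha x) := by
  intro N
  obtain ⟨M, -⟩ := exists_good_model hE U
  have ht := tendsto_conj (g : GHat k)⁻¹
  rw [inv_inv] at ht
  filter_upwards [eventually_conjTr_tr (F := F) hE g a ha N M, ht.eventually (hx M),
    ht.eventually M.eventually_mem] with h h1 h2 h3 hh
  rw [h1 hh h3 x, h2 h3]

/-- Any two models of U induce the same action of elements near 1, by transport along the identity
of U. One model therefore tests smoothness. -/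
lemma IsSmooth.of_model {U : Ebar p E} {x : F.sec U} (M : Model p E U)
    (h : ∀ᶠ h in 𝓝 (1 : GHat k), ∀ hh, M.conjTr F h hh x = x) : IsSmooth F x := by
  intro N
  filter_upwards [h, eventually_conjTr_tr (F := F) hE 1 (𝟙 U.obj.left) (one_proof ⊤ U) N M,
    M.eventually_mem] with h h1 h2 h3 hh
  have h4 := h2 hh (by simpa using h3) x
  rw [F.tr_eq_self _ rfl, F.tr_eq_self _ rfl] at h4
  rw [h4]
  exact (M.conjTr_congr F (by simp) _ x).trans (h1 h3)

lemma IsSmooth.res {U V : Ebar p E} (a : V ⟶ U) {x : F.sec U} (hx : IsSmooth F x) :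
    IsSmooth F (res F.sheaf.obj a x) := by
  rw [← F.tr_one a x]
  exact hx.tr hE _

/-- A finite subcover suffices. Elements in the intersection of the finitely many neighbourhoods fix
all restrictions of the section, hence the section. -/
lemma isSmooth_of_local {U : Ebar p E} (S : Sieve U) (hS : S ∈ etaleTopology p E U) (x : F.sec U)
    (h : ∀ (V : Ebar p E) (f : V ⟶ U), S f → IsSmooth F (WeilEtale.res F.sheaf.obj f x)) :
    IsSmooth F x := by
  obtain ⟨n, V, f, hf, hcov⟩ := exists_finite_cover hE S hS
  intro M
  choose N hN using fun i => exists_good_model hE (V i)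
  have h1 : ∀ᶠ g in 𝓝 (1 : GHat k), ∀ i, ∀ hh, (N i).conjTr F g hh (WeilEtale.res F.sheaf.obj (f i) x) =
      WeilEtale.res F.sheaf.obj (f i) x := by
    rw [Filter.eventually_all]
    exact fun i => h (V i) (f i) (hf i) (N i)
  have h2 : ∀ᶠ g in 𝓝 (1 : GHat k), ∀ i, g ∈ (N i).K.fixingSubgroup := by
    rw [Filter.eventually_all]
    exact fun i => (N i).eventually_mem
  have h3 : ∀ᶠ g in 𝓝 (1 : GHat k), ∀ i, ∀ hh hh', ∀ x : F.sec U, (N i).conjTr F g hh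
      (F.tr 1 (f i).hom.left (EqSheaf.hom_proof ⊤ (f i)) x) = F.tr 1 (f i).hom.left (EqSheaf.hom_proof ⊤ (f i))
        (M.conjTr F (((1 : (⊤ : Subgroup (GHat k))) : GHat k)⁻¹ * g *
          (1 : (⊤ : Subgroup (GHat k)))) hh' x) := by
    rw [Filter.eventually_all]
    exact fun i => eventually_conjTr_tr (F := F) hE 1 (f i).hom.left (EqSheaf.hom_proof ⊤ (f i)) (N i) M
  filter_upwards [h1, h2, h3] with g h1 h2 h3 hh
  refine sheaf_ext F.sheaf _ hcov ?_
  rintro W t ⟨W', a, b, ⟨i⟩, rfl⟩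
  rw [← res_res, ← res_res]
  congr 1
  rw [← h1 i (h2 i)]
  have h4 := h3 i (h2 i) (by simpa using hh) x
  rw [F.tr_one (f i), F.tr_one (f i)] at h4
  rw [h4]
  exact congrArg (WeilEtale.res F.sheaf.obj (f i)) (M.conjTr_congr F (by simp) hh x)

lemma isSmooth_iff_of_model {U : Ebar p E} {x : F.sec U} (M : Model p E U) :
    IsSmooth F x ↔ ∀ᶠ h in 𝓝 (1 : GHat k), ∀ hh, M.conjTr F h hh x = x :=
  ⟨fun h => h M, IsSmooth.of_model hE M⟩

end

variable [PerfectField k] (hE : IsAdmissible p E)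

/-- The subsheaf of smooth sections. -/
def smoothSub : SubSheaf F.sheaf where
  carrier U :=
    { carrier := {x | IsSmooth F x}
      zero_mem' := fun M => .of_forall fun h hh => map_zero _
      add_mem' := fun {x y} hx hy M => by
        filter_upwards [hx M, hy M] with h h1 h2 hh
        rw [map_add, h1, h2]
      neg_mem' := fun {x} hx M => by
        filter_upwards [hx M] with h h1 hh
        rw [map_neg, h1] }
  res_mem f x hx := IsSmooth.res hE f hx
  local_mem S hS x h := isSmooth_of_local hE S hS x h

lemma isContinuous_sub (N : SubSheaf F.sheaf) (h) (hN : ∀ U x, x ∈ N.carrier U → IsSmooth F x) :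
    isContinuous p E (F.sub N h) := by
  rw [isContinuous_iff]
  intro U x M
  filter_upwards [hN U (x : N.carrier U).1 (x : N.carrier U).2 M] with g hg hh
  exact (EqSheaf.tr_sub F N h _ _ _ x).trans (Subtype.ext (hg hh))

lemma IsSmooth.map {F F' : EqSheaf p E (⊤ : Subgroup (GHat k))} (φ : F ⟶ F') {U : Ebar p E}
    {x : F.sec U} (hx : IsSmooth F x) : IsSmooth F' (ap φ.hom.hom U x) := by
  intro M
  filter_upwards [hx M] with g hg hh
  exact (EqSheaf.tr_map φ _ _ _ x).symm.trans (congrArg _ (hg hh))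

/-- The étale sheaf of smooth sections. -/
def smoothPart : TGHat p E :=
  ⟨F.sub (smoothSub F hE) fun _ _ _ _ ha _ hx => IsSmooth.tr hE ha hx,
    isContinuous_sub F _ _ fun _ _ h => h⟩

end smooth
end WeilEtale
end

noncomputable section
namespace WeilEtale

open scoped Topology

/-! ### Conjugating a sheaf morphism by a group element. -/

section shift

variable {k : Type u} [Field k] {X : Scheme.{u}} {p : X ⟶ Spec (.of k)} {E : ObjectProperty (Over X)}

variable (p E) in
/-- The identification of the schemes underlying `gU` and `hU`. -/
def twCh (g h : GHat k) (U : Ebar p E) :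
    ((twist p E g).obj U).obj.left ⟶ ((twist p E h).obj U).obj.left :=
  𝟙 U.obj.left

variable (p E) in
lemma twCh_hom {c g h : GHat k} (H : c * h = g) (U : Ebar p E) :
    twCh p E g h U ≫ ((twist p E h).obj U).obj.hom ≫ act p c = ((twist p E g).obj U).obj.hom := by
  subst H
  have h1 : (U.obj.hom ≫ act p h) ≫ act p c = U.obj.hom ≫ act p (c * h) := by
    rw [Category.assoc, ← act_mul]
  exact (Category.id_comp ((U.obj.hom ≫ act p h) ≫ act p c)).trans h1

variable (p E) in
/-- The identification of the schemes underlying `U` and `gU`. -/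
def twInv (g : GHat k) (U : Ebar p E) : U.obj.left ⟶ ((twist p E g).obj U).obj.left :=
  𝟙 U.obj.left

variable (p E) in
lemma twInv_hom {c g : GHat k} (H : c * g = 1) (U : Ebar p E) :
    twInv p E g U ≫ ((twist p E g).obj U).obj.hom ≫ act p c = U.obj.hom := by
  have h : (U.obj.hom ≫ act p g) ≫ act p c = U.obj.hom := by
    rw [Category.assoc, ← act_mul, H, act_one, Category.comp_id]
  exact (Category.id_comp ((U.obj.hom ≫ act p g) ≫ act p c)).trans h

variable (p E) in
lemma twInv_naturality (g : GHat k) {U V : Ebar p E} (a : V ⟶ U) :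
    twInv p E g V ≫ ((twist p E g).map a).hom.left = a.hom.left ≫ twInv p E g U :=
  (Category.id_comp a.hom.left).trans (Category.comp_id a.hom.left).symm

namespace EqSheaf
variable {Γ : Subgroup (GHat k)}

lemma tr_res_proof {g : GHat k} {U Z W : Ebar p E} {s : W.obj.left ⟶ Z.obj.left}
    (hs : s ≫ Z.obj.hom ≫ act p g = W.obj.hom) (b : Z ⟶ U) :
    (s ≫ b.hom.left) ≫ U.obj.hom ≫ act p g = W.obj.hom := by
  rw [← hs, Category.assoc, ← Category.assoc b.hom.left]
  congr 2
  exact Over.w b.hom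

lemma tr_res (F : EqSheaf p E Γ) (g : Γ) {U Z W : Ebar p E} (s : W.obj.left ⟶ Z.obj.left)
    (hs : s ≫ Z.obj.hom ≫ act p g = W.obj.hom) (b : Z ⟶ U) (x : F.sec U) :
    F.tr g s hs (res F.sheaf.obj b x) = F.tr g (s ≫ b.hom.left) (tr_res_proof hs b) x := by
  rw [← F.tr_one b x, F.tr_tr]
  simp only [mul_one]

lemma tr_res_eq (F : EqSheaf p E Γ) (g : Γ) {U U' V V' : Ebar p E} (s : V.obj.left ⟶ U.obj.left)
    (hs : s ≫ U.obj.hom ≫ act p g = V.obj.hom) (s' : V'.obj.left ⟶ U'.obj.left)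
    (hs' : s' ≫ U'.obj.hom ≫ act p g = V'.obj.hom) (b : U ⟶ U') (b' : V ⟶ V')
    (h : s ≫ b.hom.left = b'.hom.left ≫ s') (x : F.sec U') :
    F.tr g s hs (res F.sheaf.obj b x) = res F.sheaf.obj b' (F.tr g s' hs' x) := by
  rw [F.tr_res, F.res_tr]
  simp only [h]

lemma tr_one_eq (F : EqSheaf p E Γ) {U V : Ebar p E} (a : V.obj.left ⟶ U.obj.left)
    (ha : a ≫ U.obj.hom ≫ act p (1 : Γ) = V.obj.hom) (ha' : a ≫ U.obj.hom = V.obj.hom)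
    (x : F.sec U) : F.tr 1 a ha x = res F.sheaf.obj (homMk a ha' : V ⟶ U) x :=
  F.tr_one (homMk a ha' : V ⟶ U) x

lemma tr_inv_tr (F : EqSheaf p E Γ) (g : Γ) {U : Ebar p E} (x : F.sec U) :
    F.tr g⁻¹ (twInv p E g U) (twInv_hom p E (inv_mul_cancel (g : GHat k)) U)
      (F.tr g (twId p E g U) (twId_hom p E g U) x) = x := by
  refine (F.tr_tr g⁻¹ g (twId p E g U) (twId_hom p E g U) (twInv p E g U)
    (twInv_hom p E (inv_mul_cancel (g : GHat k)) U) x).trans ?_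
  simp only [inv_mul_cancel]
  exact F.tr_eq_self _ (Category.comp_id (𝟙 U.obj.left)) _ x

lemma tr_injective (F : EqSheaf p E Γ) (g : Γ) (U : Ebar p E) :
    Function.Injective (F.tr g (twId p E g U) (twId_hom p E g U)) :=
  Function.LeftInverse.injective fun x => F.tr_inv_tr g x

lemma tr_mul (F : EqSheaf p E Γ) (g h : Γ) {U V : Ebar p E} (a : V.obj.left ⟶ U.obj.left)
    (ha : a ≫ U.obj.hom ≫ act p (g * h : Γ) = V.obj.hom)
    (ha' : (a ≫ twInv p E h U) ≫ ((twist p E h).obj U).obj.hom ≫ act p g = V.obj.hom)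
    (x : F.sec U) : F.tr (g * h) a ha x =
      F.tr g (a ≫ twInv p E h U) ha' (F.tr h (twId p E h U) (twId_hom p E h U) x) := by
  refine Eq.trans ?_ (F.tr_tr g h (twId p E h U) (twId_hom p E h U) (a ≫ twInv p E h U) ha' x).symm
  refine F.tr_congr rfl ?_ ha x
  have h1 : a = (a ≫ 𝟙 U.obj.left) ≫ 𝟙 U.obj.left := by simp
  exact h1

lemma tr_mul_proof {g h : GHat k} {U V : Ebar p E} {a : V.obj.left ⟶ U.obj.left}
    (ha : a ≫ U.obj.hom ≫ act p (g * h) = V.obj.hom) :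
    (a ≫ twInv p E h U) ≫ ((twist p E h).obj U).obj.hom ≫ act p g = V.obj.hom := by
  have h1 : (a ≫ 𝟙 U.obj.left) ≫ (U.obj.hom ≫ act p h) ≫ act p g = V.obj.hom := by
    rw [← ha, act_mul, Category.comp_id, Category.assoc]
  exact h1

lemma compat_one {F F' : EqSheaf p E Γ} (ψ : F.sheaf ⟶ F'.sheaf) {U V : Ebar p E}
    (a : V.obj.left ⟶ U.obj.left) (ha : a ≫ U.obj.hom ≫ act p (1 : Γ) = V.obj.hom) (x : F.sec U) :
    ap ψ.hom V (F.tr 1 a ha x) = F'.tr 1 a ha (ap ψ.hom U x) := by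
  have h1 : a ≫ U.obj.hom = V.obj.hom := by
    rw [← ha, OneMemClass.coe_one, act_one, Category.comp_id]
  rw [F.tr_one_eq a ha h1, F'.tr_one_eq a ha h1]
  exact ap_res _ _ _

/-- The elements of the group with which a morphism of sheaves is compatible. -/
def compatSubgroup {F F' : EqSheaf p E Γ} (ψ : F.sheaf ⟶ F'.sheaf) : Subgroup Γ where
  carrier := {g | ∀ (U V : Ebar p E) (a : V.obj.left ⟶ U.obj.left)
    (ha : a ≫ U.obj.hom ≫ act p g = V.obj.hom) (x : F.sec U),
    ap ψ.hom V (F.tr g a ha x) = F'.tr g a ha (ap ψ.hom U x)}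
  one_mem' U V a ha x := compat_one ψ a ha x
  mul_mem' {g h} hg hh U V a ha x := by
    rw [F.tr_mul g h a ha (tr_mul_proof ha), F'.tr_mul g h a ha (tr_mul_proof ha), hg, hh]
  inv_mem' {g} hg U V a ha x := by
    apply F'.tr_injective g V
    rw [← hg, F.tr_tr, F'.tr_tr]
    simp only [mul_inv_cancel]
    exact compat_one ψ _ _ x

/-- The conjugate of a morphism of sheaves by an element of the group. -/
def conj {F F' : EqSheaf p E Γ} (c : Γ) (ψ : F.sheaf ⟶ F'.sheaf) : F.sheaf ⟶ F'.sheaf :=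
  ⟨pshHom (fun U => (F'.tr c⁻¹ (twInv p E c U) (twInv_hom p E (inv_mul_cancel (c : GHat k)) U)).comp
    ((ap ψ.hom ((twist p E c).obj U)).comp (F.tr c (twId p E c U) (twId_hom p E c U)))) (by
    intro U V a x
    have h1 := F.tr_res_eq c (twId p E c V) (twId_hom p E c V) (twId p E c U) (twId_hom p E c U) a
      ((twist p E c).map a) (twId_naturality p E c a) x
    have h2 := F'.tr_res_eq c⁻¹ (twInv p E c V) (twInv_hom p E (inv_mul_cancel (c : GHat k)) V)
      (twInv p E c U) (twInv_hom p E (inv_mul_cancel (c : GHat k)) U) ((twist p E c).map a) a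
      (twInv_naturality p E c a) (ap ψ.hom ((twist p E c).obj U)
        (F.tr c (twId p E c U) (twId_hom p E c U) x))
    refine Eq.trans (congrArg (F'.tr c⁻¹ (twInv p E c V)
      (twInv_hom p E (inv_mul_cancel (c : GHat k)) V)) ?_) h2
    exact (congrArg (ap ψ.hom ((twist p E c).obj V)) h1).trans
      (ap_res ψ.hom ((twist p E c).map a) _))⟩

lemma ap_conj {F F' : EqSheaf p E Γ} (c : Γ) (ψ : F.sheaf ⟶ F'.sheaf) (U : Ebar p E) (x : F.sec U) :
    ap (conj c ψ).hom U x = F'.tr c⁻¹ (twInv p E c U) (twInv_hom p E (inv_mul_cancel (c : GHat k)) U)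
      (ap ψ.hom ((twist p E c).obj U) (F.tr c (twId p E c U) (twId_hom p E c U) x)) := rfl

/-- As conj c ψ = σ_c⁻¹ ψ σ_c, being fixed means commuting with σ_c. For a generator c this turns
equivariance into a single equation, which a kernel can express. -/
lemma conj_eq_self_iff {F F' : EqSheaf p E Γ} (c : Γ) (ψ : F.sheaf ⟶ F'.sheaf) :
    conj c ψ = ψ ↔ c ∈ compatSubgroup ψ := by
  constructor
  · intro h U V a ha x
    have h1 : ap ψ.hom U x = ap (conj c ψ).hom U x := by rw [h]
    rw [h1, ap_conj, F'.tr_tr]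
    have h2 : F.tr c a ha x = res F.sheaf.obj (homMk a ha : V ⟶ (twist p E c).obj U)
        (F.tr c (twId p E c U) (twId_hom p E c U) x) :=
      congrArg _ (F.tr_id c x).symm
    rw [h2, ap_res]
    simp only [mul_inv_cancel]
    have h3 : (a ≫ twInv p E c U) = a := Category.comp_id a
    have h4 : (a ≫ twInv p E c U) ≫ ((twist p E c).obj U).obj.hom = V.obj.hom :=
      (congrArg (· ≫ ((twist p E c).obj U).obj.hom) h3).trans ha
    rw [F'.tr_one_eq _ _ h4]
    exact congrArg (fun t => res F'.sheaf.obj t (ap ψ.hom ((twist p E c).obj U)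
      (F.tr c (twId p E c U) (twId_hom p E c U) x))) (ebar_hom_ext _ _ h3.symm)
  · intro h
    apply Sheaf.hom_ext
    apply psh_hom_ext
    intro U x
    rw [ap_conj, h, F'.tr_inv_tr]

/-- A morphism of sheaves compatible with a generator is a morphism of sheaves with action. -/
def homOfConj {F F' : EqSheaf p E Γ} (c : Γ) (hc : Subgroup.zpowers c = ⊤) (ψ : F.sheaf ⟶ F'.sheaf)
    (h : conj c ψ = ψ) : F ⟶ F' :=
  mkHom ψ fun g U V a ha x => by
    have h1 : Subgroup.zpowers c ≤ compatSubgroup ψ :=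
      (Subgroup.zpowers_le).2 ((conj_eq_self_iff c ψ).1 h)
    rw [hc] at h1
    exact h1 (Subgroup.mem_top g) U V a ha x

lemma conj_hom {F F' : EqSheaf p E Γ} (c : Γ) (φ : F ⟶ F') : conj c φ.hom = φ.hom :=
  (conj_eq_self_iff c φ.hom).2 fun U V a ha x => tr_map φ c a ha x

end EqSheaf

end shift
end WeilEtale
end

noncomputable section
namespace WeilEtale

/-! ### The shift on a coinduced sheaf. -/

section shift

variable {k : Type u} [Field k] {X : Scheme.{u}} {p : X ⟶ Spec (.of k)} {E : ObjectProperty (Over X)}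
  {Γ Δ : Subgroup (GHat k)} (hΓ : Γ ≤ Δ) (c : Γ)

lemma shift_eq (g : Δ) :
    ((c⁻¹ : Γ) : GHat k) * ((Subgroup.inclusion hΓ c * g : Δ) : GHat k) = g := by
  rw [Subgroup.coe_mul, Subgroup.coe_inclusion, InvMemClass.coe_inv, inv_mul_cancel_left]

variable (F : EqSheaf p E Γ)

/-- The component at `g` of the shift by `c`. -/
def shiftTr (g : Δ) (U : Ebar p E) :
    F.sec ((twist p E (Subgroup.inclusion hΓ c * g : Δ)).obj U) →+
      F.sec ((twist p E g).obj U) :=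
  F.tr c⁻¹ (twCh p E g (Subgroup.inclusion hΓ c * g : Δ) U)
    (twCh_hom p E (shift_eq hΓ c g) U)

lemma shiftTr_res (g : Δ) {U V : Ebar p E} (a : V ⟶ U)
    (x : F.sec ((twist p E (Subgroup.inclusion hΓ c * g : Δ)).obj U)) :
    shiftTr hΓ c F g V (res F.sheaf.obj ((twist p E (Subgroup.inclusion hΓ c * g : Δ)).map a) x) =
      res F.sheaf.obj ((twist p E g).map a) (shiftTr hΓ c F g U x) :=
  F.tr_res_eq c⁻¹ (twCh p E g (Subgroup.inclusion hΓ c * g : Δ) V)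
    (twCh_hom p E (shift_eq hΓ c g) V) (twCh p E g (Subgroup.inclusion hΓ c * g : Δ) U)
    (twCh_hom p E (shift_eq hΓ c g) U) ((twist p E (Subgroup.inclusion hΓ c * g : Δ)).map a)
    ((twist p E g).map a) ((Category.id_comp a.hom.left).trans
    (Category.comp_id a.hom.left).symm) x

/-- The shift `f ↦ (g ↦ σ_c⁻¹ f(cg))` on the sheaf coinduced from a sheaf with action. -/
def shiftSheaf : coindSheaf Δ F.sheaf ⟶ coindSheaf Δ F.sheaf :=
  ⟨pshHom (P := (coindSheaf Δ F.sheaf).obj) (Q := (coindSheaf Δ F.sheaf).obj)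
    (fun U => AddMonoidHom.mk' (fun (f : coindSec Δ F.sheaf U) g =>
        (shiftTr hΓ c F g U (f (Subgroup.inclusion hΓ c * g)) :
          F.sheaf.obj.obj (op ((twist p E g).obj U))))
      fun f f' => funext fun g => map_add (shiftTr hΓ c F g U) _ _)
    fun {U V} a f => funext fun g => shiftTr_res hΓ c F g a
      ((f : coindSec Δ F.sheaf U) (Subgroup.inclusion hΓ c * g))⟩

/-- The shift translates on the left and the action translates on the right, so they commute. -/
lemma shiftTr_coindTr (g h : Δ) {U V : Ebar p E} (a : V.obj.left ⟶ U.obj.left)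
    (ha : a ≫ U.obj.hom ≫ act p h = V.obj.hom) (f : coindSec Δ F.sheaf U) :
    shiftTr hΓ c F g V (res F.sheaf.obj (twistHom p E (Subgroup.inclusion hΓ c * g) h a ha)
      (f (Subgroup.inclusion hΓ c * g * h))) =
    res F.sheaf.obj (twistHom p E g h a ha) (shiftTr hΓ c F (g * h) U
      (f (Subgroup.inclusion hΓ c * (g * h)))) := by
  -- The index is generalised, since (cg)h and c(gh) are equal only through associativity while f(d)
  -- lives over dU.
  have key : ∀ (d : Δ) (hd : d = Subgroup.inclusion hΓ c * (g * h))
      (b : (twist p E (Subgroup.inclusion hΓ c * g : Δ)).obj V ⟶ (twist p E d).obj U)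
      (hb : b.hom.left = a), shiftTr hΓ c F g V (res F.sheaf.obj b (f d)) =
      res F.sheaf.obj (twistHom p E g h a ha) (shiftTr hΓ c F (g * h) U
      (f (Subgroup.inclusion hΓ c * (g * h)))) := by
    rintro _ rfl b hb
    refine F.tr_res_eq c⁻¹ _ _ _ _ b (twistHom p E g h a ha) ?_ _
    exact (Category.id_comp b.hom.left).trans (hb.trans (Category.comp_id a).symm)
  exact key _ (mul_assoc _ _ _) _ rfl

/-- The shift as a morphism of sheaves with action. -/
def shift : coindObj Δ F.sheaf ⟶ coindObj Δ F.sheaf :=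
  EqSheaf.mkHom (F := coindObj Δ F.sheaf) (F' := coindObj Δ F.sheaf) (shiftSheaf hΓ c F)
    fun h U V a ha f => funext fun g =>
      (congrArg (shiftTr hΓ c F g V)
        (coind_tr Δ F.sheaf h a ha f (Subgroup.inclusion hΓ c * g))).trans
      ((shiftTr_coindTr hΓ c F g h a ha f).trans
        (coind_tr Δ F.sheaf h a ha (ap (shiftSheaf hΓ c F).hom U f) g).symm)

variable {F}

lemma shift_naturality {F' : EqSheaf p E Γ} (α : F ⟶ F') :
    (coind p E Δ).map α.hom ≫ shift hΓ c F' = shift hΓ c F ≫ (coind p E Δ).map α.hom := by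
  apply EqSheaf.hom_ext
  apply Sheaf.hom_ext
  apply psh_hom_ext
  intro U f
  exact funext fun g => (EqSheaf.tr_map α c⁻¹ _ _ _).symm

lemma coindLift_shift_apply {K : EqSheaf p E Δ} (ψ : K.sheaf ⟶ F.sheaf) (g : Δ) {U : Ebar p E}
    (x : K.sec U) :
    shiftTr hΓ c F g U (ap ψ.hom _ (K.tr (Subgroup.inclusion hΓ c * g)
      (twId p E (Subgroup.inclusion hΓ c * g : Δ) U) (twId_hom p E _ U) x)) =
    ap (EqSheaf.conj (F := (EqSheaf.restrict hΓ).obj K) c ψ).hom ((twist p E g).obj U)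
      (K.tr g (twId p E g U) (twId_hom p E g U) x) := by
  refine Eq.trans ?_ (congrArg (F.tr c⁻¹ (twInv p E c ((twist p E g).obj U))
    (twInv_hom p E (inv_mul_cancel (c : GHat k)) ((twist p E g).obj U))) ((congrArg (ap ψ.hom _)
    (tr_twId_tr Δ K (Subgroup.inclusion hΓ c) g (twId p E g U) (twId_hom p E g U) x)).trans
    (ap_res ψ.hom (twistHom p E (Subgroup.inclusion hΓ c) g (twId p E g U) (twId_hom p E g U))
    (K.tr (Subgroup.inclusion hΓ c * g) (twId p E (Subgroup.inclusion hΓ c * g : Δ) U)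
      (twId_hom p E _ U) x)))).symm
  refine Eq.trans ?_ (F.tr_res c⁻¹ _ _ (twistHom p E (Subgroup.inclusion hΓ c) g (twId p E g U)
    (twId_hom p E g U)) _).symm
  refine F.tr_congr rfl ?_ _ _
  exact (Category.id_comp (𝟙 U.obj.left)).symm

/-- Under the adjunction the shift becomes conjugation: σ_c⁻¹ ψ σ_{cg} = (σ_c⁻¹ ψ σ_c) σ_g. -/
lemma coindLift_shift {K : EqSheaf p E Δ} (ψ : K.sheaf ⟶ F.sheaf) :
    coindLift Δ ψ ≫ shift hΓ c F =
      coindLift Δ (EqSheaf.conj (F := (EqSheaf.restrict hΓ).obj K) c ψ) := by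
  apply EqSheaf.hom_ext
  apply Sheaf.hom_ext
  apply psh_hom_ext
  intro U x
  refine funext fun g => ?_
  refine (congrArg (shiftTr hΓ c F g U)
    (ap_coindLiftSheaf Δ ψ U x (Subgroup.inclusion hΓ c * g))).trans ?_
  refine Eq.trans ?_ (ap_coindLiftSheaf Δ (F := K)
    (EqSheaf.conj (F := (EqSheaf.restrict hΓ).obj K) c ψ) U x g).symm
  exact coindLift_shift_apply hΓ c ψ g x

end shift
end WeilEtale
end

noncomputable section
namespace WeilEtale

/-! ### Kernels, smooth parts, and the right adjoint of `gammaUpper`. -/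

section adjoint

variable {k : Type u} [Field k] {X : Scheme.{u}} {p : X ⟶ Spec (.of k)} {E : ObjectProperty (Over X)}
  {Γ : Subgroup (GHat k)}

namespace EqSheaf

variable {F F' : EqSheaf p E Γ} (φ : F ⟶ F')

/-- The kernel of a morphism of sheaves with action. -/
def ker : EqSheaf p E Γ :=
  F.sub (kerSubSheaf φ.hom) fun g U V a ha x hx => by
    change ap φ.hom.hom V (F.tr g a ha x) = 0
    have hx' : ap φ.hom.hom U x = 0 := hx
    rw [tr_map, hx', map_zero]

def kerι : ker φ ⟶ F := F.subIncl _ _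

lemma hom_ext_ap {f f' : F ⟶ F'} (h : ∀ U x, ap f.hom.hom U x = ap f'.hom.hom U x) : f = f' :=
  hom_ext (Sheaf.hom_ext (psh_hom_ext h))

lemma kerι_comp : kerι φ ≫ φ = 0 :=
  hom_ext_ap fun _ x => (x : (kerSubSheaf φ.hom).carrier _).2

variable {φ} in
def kerLift {K : EqSheaf p E Γ} (f : K ⟶ F) (hf : f ≫ φ = 0) : K ⟶ ker φ :=
  subLift (N := kerSubSheaf φ.hom) f fun U x =>
    show ap φ.hom.hom U (ap f.hom.hom U x) = 0 from
      congrArg (fun t : K ⟶ F' => ap t.hom.hom U x) hf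

instance : Mono (kerι φ) where
  right_cancellation f g h := hom_ext_ap fun U x =>
    (kerSubSheaf φ.hom).incl_injective U (congrArg (fun t => ap t.hom.hom U x) h)

end EqSheaf

section smooth

variable [PerfectField k] (hE : IsAdmissible p E)

/-- The inclusion of the smooth part. -/
def smoothι (F : EqSheaf p E ⊤) : (smoothPart F hE).obj ⟶ F :=
  F.subIncl (smoothSub F hE) fun _ _ _ _ ha _ hx => IsSmooth.tr hE ha hx

instance (F : EqSheaf p E ⊤) : Mono (smoothι hE F) where
  right_cancellation f g h := EqSheaf.hom_ext_ap fun U x =>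
    (smoothSub F hE).incl_injective U (congrArg (fun t => ap t.hom.hom U x) h)

/-- Factorization through the smooth part. -/
def smoothLift {K : TGHat p E} {F : EqSheaf p E ⊤} (f : K.obj ⟶ F) : K ⟶ smoothPart F hE :=
  ⟨EqSheaf.subLift (N := smoothSub F hE) (h := fun _ _ _ _ ha _ hx => IsSmooth.tr hE ha hx) f
    fun U x => IsSmooth.map f ((isContinuous_iff K.obj).1 K.property U x)⟩

/-- Morphisms into the smooth part. -/
def smoothEquiv (K : TGHat p E) (F : EqSheaf p E ⊤) : (K.obj ⟶ F) ≃ (K ⟶ smoothPart F hE) where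
  toFun f := smoothLift hE f
  invFun f := f.hom ≫ smoothι hE F
  left_inv f := rfl
  right_inv f := (isContinuous p E).hom_ext ((cancel_mono (smoothι hE F)).1 rfl)

lemma smoothEquiv_naturality (K' K : TGHat p E) (F : EqSheaf p E ⊤) (f : K' ⟶ K) (g : K.obj ⟶ F) :
    smoothEquiv hE K' F (f.hom ≫ g) = f ≫ smoothEquiv hE K F g :=
  (isContinuous p E).hom_ext ((cancel_mono (smoothι hE F)).1 rfl)

/-- The smooth part functor. -/
def smooth : EqSheaf p E ⊤ ⥤ TGHat p E :=
  Adjunction.rightAdjointOfEquiv (F := (isContinuous p E).ι) (G_obj := fun F => smoothPart F hE)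
    (smoothEquiv hE) (smoothEquiv_naturality hE)

def smoothAdj : (isContinuous p E).ι ⊣ smooth hE :=
  Adjunction.adjunctionOfEquivRight (F := (isContinuous p E).ι)
    (G_obj := fun F => smoothPart F hE) (smoothEquiv hE) (smoothEquiv_naturality hE)

/-- The right adjoint of the functor from étale sheaves to the underlying sheaves. -/
def coindHat : AbSheaf p E ⥤ TGHat p E := coind p E ⊤ ⋙ smooth hE

def coindHatAdj : underlyingHat p E ⊣ coindHat hE := (smoothAdj hE).comp (coindAdj p E ⊤)

instance : (coindHat hE).Additive := (coindHatAdj hE).right_adjoint_additive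

end smooth

section gamma

variable [Fintype k]

variable (k) in
/-- The Frobenius as an element of the Weil group. -/
def weilGen : weilGroup k := ⟨frobenius k, Subgroup.mem_zpowers _⟩

lemma zpowers_weilGen : Subgroup.zpowers (weilGen k) = ⊤ := by
  rw [eq_top_iff]
  rintro ⟨g, n, rfl⟩ -
  exact ⟨n, rfl⟩

variable (hE : IsAdmissible p E)

/-- The shift by Frobenius minus the identity. -/
abbrev shiftSubOne {Γ Δ : Subgroup (GHat k)} (h : Γ ≤ Δ) (c : Γ) (F : EqSheaf p E Γ) :
    coindObj Δ F.sheaf ⟶ coindObj Δ F.sheaf := shift h c F - 𝟙 _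

/-- By `coindLift_shift`, being killed by shift − 1 is the same as being fixed under conjugation by
`c`. It translates equivariance for the smaller group into a kernel condition over the larger one.
-/
lemma comp_shiftSubOne {Γ Δ : Subgroup (GHat k)} (h : Γ ≤ Δ) (c : Γ) (F : EqSheaf p E Γ)
    {K : EqSheaf p E Δ} (ψ : K.sheaf ⟶ F.sheaf) : coindLift Δ ψ ≫ shiftSubOne h c F = 0 ↔
      EqSheaf.conj (F := (EqSheaf.restrict h).obj K) c ψ = ψ := by
  rw [Preadditive.comp_sub, sub_eq_zero, coindLift_shift, Category.comp_id]
  exact (coindEquiv Δ K F.sheaf).apply_eq_iff_eq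

lemma conj_eq_of_comp (F : TG p E) (K : TGHat p E)
    (Θ : K.obj ⟶ coindObj ⊤ F.sheaf) (h : Θ ≫ shiftSubOne le_top (weilGen k) F = 0) :
    EqSheaf.conj (F := (gammaUpper p E).obj K) (weilGen k)
      ((coindEquiv ⊤ K.obj F.sheaf).symm Θ) =
      (coindEquiv ⊤ K.obj F.sheaf).symm Θ := by
  refine (comp_shiftSubOne le_top (weilGen k) F (K := K.obj) _).1 ?_
  have h1 : coindLift ⊤ ((coindEquiv ⊤ K.obj F.sheaf).symm Θ) = Θ :=
    (coindEquiv ⊤ K.obj F.sheaf).apply_symm_apply Θ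
  rw [h1, h]

/-- Morphisms of Weil-étale sheaves in terms of coinduced sheaves. -/
def kerShiftEquiv (K : TGHat p E) (F : TG p E) : ((gammaUpper p E).obj K ⟶ F) ≃
    (K.obj ⟶ EqSheaf.ker (shiftSubOne le_top (weilGen k) F)) where
  toFun φ := EqSheaf.kerLift (coindLift ⊤ (F := K.obj) φ.hom)
    ((comp_shiftSubOne _ _ F (K := K.obj) φ.hom).2
      (EqSheaf.conj_hom (F := (gammaUpper p E).obj K) (weilGen k) φ))
  invFun θ := EqSheaf.homOfConj (F := (gammaUpper p E).obj K) (weilGen k) zpowers_weilGen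
    ((coindEquiv ⊤ K.obj F.sheaf).symm (θ ≫ EqSheaf.kerι _))
    (conj_eq_of_comp F K _ (by rw [Category.assoc, EqSheaf.kerι_comp, comp_zero]))
  left_inv φ := EqSheaf.hom_ext ((coindEquiv ⊤ K.obj F.sheaf).symm_apply_apply φ.hom)
  right_inv θ := by
    rw [← cancel_mono (EqSheaf.kerι _)]
    exact (coindEquiv ⊤ K.obj F.sheaf).apply_symm_apply (θ ≫ EqSheaf.kerι _)

include hE in
-- The value of the right adjoint at F is the smooth part of ker(shift − 1) on the sheaf coinduced
-- from F to the whole Galois group. Commuting with Frobenius suffices because it generates the Weil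
-- group.
lemma gammaUpper_isLeftAdjoint : (gammaUpper p E).IsLeftAdjoint :=
  (Adjunction.adjunctionOfEquivRight (G_obj := fun F => smoothPart (EqSheaf.ker
    (shiftSubOne le_top (weilGen k) F)) hE) (fun K F => (kerShiftEquiv K F).trans
      (smoothEquiv hE K (EqSheaf.ker (shiftSubOne le_top (weilGen k) F))))
    fun K' K F f g => by
      refine Eq.trans ?_ (smoothEquiv_naturality hE K' K _ f (kerShiftEquiv K F g))
      refine congrArg (smoothEquiv hE K' _) ?_
      rw [← cancel_mono (EqSheaf.kerι _)]
      exact coindLift_comp ⊤ f.hom g.hom).isLeftAdjoint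

end gamma

end adjoint
end WeilEtale
end

noncomputable section
namespace WeilEtale

/-! ### The direct image of a coinduced sheaf is the smooth coinduced sheaf. -/

section gammaCoind

variable {k : Type u} [Field k] [Fintype k] {X : Scheme.{u}} {p : X ⟶ Spec (.of k)}
  {E : ObjectProperty (Over X)} (hE : IsAdmissible p E)

/-- The inclusion of the smooth coinduced sections into all coinduced sections. -/
def coindHatι (A : AbSheaf p E) : ((coindHat hE).obj A).obj ⟶ coindObj ⊤ A :=
  smoothι hE (coindObj ⊤ A)

/-- Evaluation of smooth coinduced sections at the neutral element. -/
def coindHatEval (A : AbSheaf p E) : ((coindHat hE).obj A).obj.sheaf ⟶ A :=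
  (coindHatι hE A).hom ≫ coindEval ⊤ A

/-- The shift by Frobenius on the smooth coinduced sheaf. -/
def shiftHat (F : TG p E) : (coindHat hE).obj F.sheaf ⟶ (coindHat hE).obj F.sheaf :=
  (smooth hE).map (shift le_top (weilGen k) F)

lemma shiftHat_ι (F : TG p E) : (shiftHat hE F).hom ≫ coindHatι hE F.sheaf =
    coindHatι hE F.sheaf ≫ shift le_top (weilGen k) F := rfl

lemma coindLift_coindHatEval (A : AbSheaf p E) :
    coindLift ⊤ (F := ((coindHat hE).obj A).obj) (coindHatEval hE A) = coindHatι hE A :=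
  (coindEquiv ⊤ ((coindHat hE).obj A).obj A).apply_symm_apply (coindHatι hE A)

/-- This is `coindLift_shift` for the inclusion of the smooth part, whose transpose is evaluation at
1. -/
lemma shiftHat_eval (F : TG p E) : (shiftHat hE F).hom.hom ≫ coindHatEval hE F.sheaf =
    EqSheaf.conj (F := (gammaUpper p E).obj ((coindHat hE).obj F.sheaf)) (weilGen k)
      (coindHatEval hE F.sheaf) := by
  have h1 := coindLift_shift le_top (weilGen k) (K := ((coindHat hE).obj F.sheaf).obj)
    (coindHatEval hE F.sheaf)
  rw [coindLift_coindHatEval, ← shiftHat_ι] at h1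
  have h2 := congrArg (fun t => t.hom ≫ coindEval ⊤ F.sheaf) h1
  exact h2.trans (coindLift_eval ⊤ (F := ((coindHat hE).obj F.sheaf).obj) _)

variable [(gammaUpper p E).IsLeftAdjoint]

/-- The functor `γ_*` of a coinduced sheaf. -/
def coindHatIso : coindHat hE ≅ coind p E (weilGroup k) ⋙ gammaLower p E :=
  Adjunction.rightAdjointUniq (coindHatAdj hE)
    ((Adjunction.ofIsLeftAdjoint (gammaUpper p E)).comp (coindAdj p E (weilGroup k)))

variable (p E) in
/-- The adjunction between `γ^*` and `γ_*`. -/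
abbrev gammaAdj : gammaUpper p E ⊣ gammaLower p E := Adjunction.ofIsLeftAdjoint (gammaUpper p E)

/-- `coindHatIso` comes from uniqueness of adjoints and has no formula of its own. Its transpose
along γ^* ⊣ γ_* does have one, and that is what allows computing with it. -/
lemma homEquiv_symm_coindHatIso (A : AbSheaf p E) :
    ((gammaAdj p E).homEquiv _ _).symm ((coindHatIso hE).hom.app A) =
      coindLift (weilGroup k) (F := (gammaUpper p E).obj ((coindHat hE).obj A))
        (coindHatEval hE A) := by
  have h1 := Adjunction.homEquiv_symm_rightAdjointUniq_hom_app (coindHatAdj hE)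
    ((gammaAdj p E).comp (coindAdj p E (weilGroup k))) A
  apply (coindEquiv (weilGroup k) ((gammaUpper p E).obj ((coindHat hE).obj A)) A).symm.injective
  refine Eq.trans ?_ (coindLift_eval (weilGroup k)
    (F := (gammaUpper p E).obj ((coindHat hE).obj A)) (coindHatEval hE A)).symm
  refine Eq.trans ?_ (h1.trans ?_)
  · rfl
  · rfl

/-- After transposing along γ^* ⊣ γ_*, both sides become the lift of the evaluation map conjugated
by Frobenius. -/
lemma coindHatIso_shift (F : TG p E) :
    (coindHatIso hE).hom.app F.sheaf ≫ (gammaLower p E).map (shift le_rfl (weilGen k) F) =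
      shiftHat hE F ≫ (coindHatIso hE).hom.app F.sheaf := by
  apply ((gammaAdj p E).homEquiv _ _).symm.injective
  refine ((gammaAdj p E).homEquiv_naturality_right_symm _ _).trans
    (Eq.trans ?_ ((gammaAdj p E).homEquiv_naturality_left_symm _ _).symm)
  refine (congrArg (· ≫ shift le_rfl (weilGen k) F) (homEquiv_symm_coindHatIso hE F.sheaf)).trans
    (Eq.trans ?_ (congrArg ((gammaUpper p E).map (shiftHat hE F) ≫ ·)
      (homEquiv_symm_coindHatIso hE F.sheaf)).symm)
  have h1 := coindLift_comp (weilGroup k) ((gammaUpper p E).map (shiftHat hE F))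
    (coindHatEval hE F.sheaf)
  refine Eq.trans ?_ h1
  refine (coindLift_shift le_rfl (weilGen k)
    (K := (gammaUpper p E).obj ((coindHat hE).obj F.sheaf)) (coindHatEval hE F.sheaf)).trans ?_
  exact congrArg (coindLift (weilGroup k)) (shiftHat_eval hE F).symm

end gammaCoind
end WeilEtale
end

noncomputable section
namespace WeilEtale

open scoped Topology

/-! ### Smooth coinduction preserves epimorphisms, by compactness of the Galois group. -/

section epi

variable {k : Type u} [Field k] {X : Scheme.{u}} {p : X ⟶ Spec (.of k)} {E : ObjectProperty (Over X)}

/-- An element of the Galois group as an element of the full subgroup. -/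
abbrev topElt (h : GHat k) : (⊤ : Subgroup (GHat k)) := ⟨h, Subgroup.mem_top h⟩

lemma functorPullback_twist_mem (g : GHat k) {U : Ebar p E} (S : Sieve ((twist p E g).obj U))
    (hS : S ∈ etaleTopology p E _) : S.functorPullback (twist p E g) ∈ etaleTopology p E U := by
  intro V f x
  obtain ⟨W, j, h1, h2, h3⟩ := hS ((twist p E g).map f) x
  refine ⟨(twist p E g⁻¹).obj W, untwistHom j, h1, h2, ?_⟩
  have h4 : (twist p E g).map (untwistHom j ≫ f) =
      fromTwistTwistInv g W ≫ j ≫ (twist p E g).map f := by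
    apply ebar_hom_ext
    exact (Category.id_comp (j.hom.left ≫ f.hom.left)).symm
  change S ((twist p E g).map (untwistHom j ≫ f))
  rw [h4]
  exact S.downward_closed h3 _

variable {A B : AbSheaf p E} (β : A ⟶ B) {U V : Ebar p E}

variable (A) in
/-- The action on coinduced sections of an element fixing the field of definition of a model. -/
def coindConj (M : Model p E V) (h : GHat k) (hh : h ∈ M.K.fixingSubgroup) :
    coindSec ⊤ A V →+ coindSec ⊤ A V :=
  M.conjTr (coindObj ⊤ A) h hh

/-- The morphism `gV → (gh)V` induced by an element `h` fixing the field of definition of a model. -/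
def conjTwist (M : Model p E V) (h : GHat k) (hh : h ∈ M.K.fixingSubgroup)
    (g : (⊤ : Subgroup (GHat k))) : (twist p E g).obj V ⟶
      (twist p E (g * topElt h)).obj V :=
  twistHom p E g (topElt h) (U := V) (V := V) (M.conjMap ⟨h, hh⟩) (M.conjMap_act h hh)

lemma coindConj_apply (M : Model p E V) (h : GHat k) (hh) (f : coindSec ⊤ A V)
    (g : (⊤ : Subgroup (GHat k))) : coindConj A M h hh f g =
      res A.obj (conjTwist M h hh g) (f (g * topElt h)) :=
  coind_tr ⊤ A (topElt h) (U := V) (V := V) (M.conjMap ⟨h, hh⟩) (M.conjMap_act h hh) f g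

lemma coindConj_congr (M : Model p E V) (h : GHat k) (hh) {f f' : coindSec ⊤ A V}
    {g : (⊤ : Subgroup (GHat k))}
    (hf : f (g * topElt h) = f' (g * topElt h)) :
    coindConj A M h hh f g = coindConj A M h hh f' g := by
  rw [coindConj_apply, coindConj_apply, hf]

lemma coindConj_mul (M : Model p E V) (g h : GHat k)
    (hg : g ∈ M.K.fixingSubgroup) (hh : h ∈ M.K.fixingSubgroup) (f : coindSec ⊤ A V) :
    coindConj A M (g * h) (mul_mem hg hh) f = coindConj A M g hg (coindConj A M h hh f) :=
  M.conjTr_mul (coindObj ⊤ A) g h hg hh f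

lemma coindConj_congr_left (M : Model p E V) {h h' : GHat k} (e : h = h')
    (hh : h ∈ M.K.fixingSubgroup) (f : coindSec ⊤ A V) :
    coindConj A M h hh f = coindConj A M h' (e ▸ hh) f := by
  subst e
  rfl

variable (A) in
/-- Restriction of coinduced sections. -/
def coindRes (a : V ⟶ U) : coindSec ⊤ A U →+ coindSec ⊤ A V :=
  res (coindSheaf (⊤ : Subgroup (GHat k)) A).obj a

/-- The map on coinduced sections. -/
def coindAp (U : Ebar p E) : coindSec ⊤ A U →+ coindSec ⊤ B U :=
  ap ((coind p E (⊤ : Subgroup (GHat k))).map β).hom.hom U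

lemma coindAp_conj (M : Model p E V) (h : GHat k) (hh) (f : coindSec ⊤ A V) :
    coindAp β V (coindConj A M h hh f) = coindConj B M h hh (coindAp β V f) :=
  EqSheaf.tr_map ((coind p E (⊤ : Subgroup (GHat k))).map β) (topElt h) (U := V) (V := V)
    (M.conjMap ⟨h, hh⟩) (M.conjMap_act h hh) f

lemma coindAp_apply (f : coindSec ⊤ A V) (g : (⊤ : Subgroup (GHat k))) :
    coindAp β V f g = ap β.hom _ (f g) := rfl

/-- The morphisms along which the value at `g` of a coinduced section lifts. -/
def liftSieve (F : coindSec ⊤ B U) (g : (⊤ : Subgroup (GHat k))) : Sieve U :=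
  Sieve.functorPullback (twist p E g) (Presheaf.imageSieve β.hom
    (F g : B.obj.obj (op ((twist p E g).obj U))))

open scoped Classical in
lemma liftSieve_iff (F : coindSec ⊤ B U) (g : (⊤ : Subgroup (GHat k))) (a : V ⟶ U) :
    liftSieve β F g a ↔ ∃ y : coindSec ⊤ A V,
      coindAp β V y g = coindRes B a F g := by
  constructor
  · rintro ⟨x, hx⟩
    refine ⟨Function.update 0 g x, ?_⟩
    rw [coindAp_apply, Function.update_self]
    exact hx
  · rintro ⟨y, hy⟩
    exact ⟨y g, hy⟩

variable [PerfectField k] (hE : IsAdmissible p E)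
include hE

lemma liftSieve_mem [Epi β] (F : coindSec ⊤ B U) (g : (⊤ : Subgroup (GHat k))) :
    liftSieve β F g ∈ etaleTopology p E U := by
  have h1 : Sheaf.IsLocallySurjective β := (Sheaf.isLocallySurjective_iff_epi' _ β).2 inferInstance
  exact functorPullback_twist_mem _ _ (Presheaf.imageSieve_mem _ β.hom _)

/-- For h near 1 the restriction of F to V is fixed by h⁻¹. If y lifts F|V at index g, then h⁻¹y
lifts it at index gh. -/
lemma eventually_liftSieve (F : coindSec ⊤ B U)
    (hF : IsSmooth (coindObj ⊤ B) F) (a : V ⟶ U) :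
    ∀ᶠ h in 𝓝 (1 : GHat k), ∀ g, liftSieve β F g a →
      liftSieve β F (g * topElt h) a := by
  obtain ⟨N, -⟩ := exists_good_model hE V
  have h1 : IsSmooth (coindObj ⊤ B) (coindRes B a F) :=
    IsSmooth.res (F := coindObj ⊤ B) hE a hF
  have ht : Filter.Tendsto (fun h : GHat k => h⁻¹) (𝓝 1) (𝓝 1) := by
    simpa using (continuous_inv (G := GHat k)).tendsto 1
  filter_upwards [ht.eventually (h1 N), ht.eventually N.eventually_mem] with h h2 h3 g
  rw [liftSieve_iff, liftSieve_iff]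
  rintro ⟨y, hy⟩
  refine ⟨coindConj A N h⁻¹ h3 y, ?_⟩
  rw [coindAp_conj]
  conv_rhs => rw [← h2 h3]
  apply coindConj_congr
  have h4 : g * topElt h * topElt h⁻¹ = g :=
    mul_inv_cancel_right g (topElt h)
  rw [h4]
  exact hy

/-- Each value F(g) lifts on a cover that depends on g. The same finite cover works for all indices
near g, and compactness of the Galois group leaves finitely many covers, which are intersected. -/
lemma exists_cover_le_liftSieve [Epi β] (F : coindSec ⊤ B U)
    (hF : IsSmooth (coindObj ⊤ B) F) :
    ∃ R ∈ etaleTopology p E U, ∀ g, R ≤ liftSieve β F g := by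
  have key : ∃ R ∈ etaleTopology p E U, ∀ g ∈ (Set.univ : Set (GHat k)),
      R ≤ liftSieve β F (topElt g) := by
    have hc : IsCompact (Set.univ : Set (GHat k)) := isCompact_univ
    refine hc.induction_on (p := fun s => ∃ R ∈ etaleTopology p E U, ∀ g ∈ s,
      R ≤ liftSieve β F (topElt g)) ⟨⊤, (etaleTopology p E).top_mem U, by simp⟩
      ?_ ?_ ?_
    · rintro s t hst ⟨R, hR, h⟩
      exact ⟨R, hR, fun g hg => h g (hst hg)⟩
    · rintro s t ⟨R, hR, h⟩ ⟨R', hR', h'⟩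
      refine ⟨R ⊓ R', (etaleTopology p E).intersection_covering hR hR', fun g hg => ?_⟩
      rcases hg with hg | hg
      · exact inf_le_left.trans (h g hg)
      · exact inf_le_right.trans (h' g hg)
    · rintro g₀ -
      obtain ⟨n, V, a, ha, hcov⟩ := exists_finite_cover hE _
        (liftSieve_mem β hE F (topElt g₀))
      have h1 : ∀ᶠ h in 𝓝 (1 : GHat k), ∀ i, ∀ g, liftSieve β F g (a i) →
          liftSieve β F (g * topElt h) (a i) := by
        rw [Filter.eventually_all]
        exact fun i => eventually_liftSieve β hE F hF (a i)
      have ht : Filter.Tendsto (fun g : GHat k => g₀⁻¹ * g) (𝓝 g₀) (𝓝 1) := by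
        simpa using (continuous_const_mul (g₀⁻¹ : GHat k)).tendsto g₀
      refine ⟨_, mem_nhdsWithin_of_mem_nhds (ht.eventually h1), _, hcov, fun g hg => ?_⟩
      rw [Sieve.ofArrows, Sieve.generate_le_iff]
      rintro W _ ⟨i⟩
      have h2 := hg i _ (ha i)
      have h3 : topElt g₀ *
          topElt (g₀⁻¹ * g) = topElt g :=
        Subtype.ext (mul_inv_cancel_left g₀ g)
      rwa [h3] at h2
  obtain ⟨R, hR, h⟩ := key
  exact ⟨R, hR, fun g => h g.1 (Set.mem_univ _)⟩

omit hE in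
/-- Coinduced sections with prescribed values on representatives of the cosets of an open subgroup. -/
lemma exists_invariant (N : Model p E V) (H : Subgroup (GHat k)) (hH : H ≤ N.K.fixingSubgroup)
    (y : coindSec ⊤ A V) : ∃ f : coindSec ⊤ A V,
      (∀ h (hh : h ∈ H), coindConj A N h (hH hh) f = f) ∧
      ∀ g, ∃ h, ∃ hh : h ∈ H, f g = coindConj A N h (hH hh) y g := by
  -- g · r(g) is the chosen representative of gH, so (r(g)y)(g) depends only on the value of y at
  -- that representative. Invariance under h ∈ H is the relation h · r(gh) = r(g).
  let r : (⊤ : Subgroup (GHat k)) → GHat k := fun g => (g : GHat k)⁻¹ *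
    Quotient.out ((g : GHat k) : GHat k ⧸ H)
  have hr : ∀ g, r g ∈ H := fun g => by
    have := QuotientGroup.mk_out_eq_mul H (g : GHat k)
    obtain ⟨h, hh⟩ := this
    change (g : GHat k)⁻¹ * _ ∈ H
    rw [hh, inv_mul_cancel_left]
    exact h.2
  refine ⟨fun g => coindConj A N (r g) (hH (hr g)) y g,
    fun h hh => funext fun g => ?_, fun g => ⟨r g, hr g, rfl⟩⟩
  have h1 : h * r (g * topElt h) = r g := by
    have h2 : ((((g * topElt h) : GHat k)) : GHat k ⧸ H) =
        ((g : GHat k) : GHat k ⧸ H) := by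
      rw [eq_comm, QuotientGroup.eq]
      simpa using hh
    have h3 : r (g * topElt h) = (g * h : GHat k)⁻¹ * Quotient.out ((g : GHat k) : GHat k ⧸ H) :=
      congrArg (fun t => (g * h : GHat k)⁻¹ * Quotient.out t) h2
    rw [h3, mul_inv_rev, mul_assoc, mul_inv_cancel_left]
  refine (coindConj_congr N h (hH hh) (f' := coindConj A N
    (r (g * topElt h)) (hH (hr _)) y) rfl).trans ?_
  rw [← coindConj_mul]
  exact congrFun (coindConj_congr_left N h1 _ y) g

/-- Take an open subgroup H fixing F and replace y by the H-invariant family built from its values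
on coset representatives. It still lifts F, because β(hy) = hF = F for h in H. -/
lemma exists_smooth_lift (F : coindSec ⊤ B V) (hF : IsSmooth (coindObj ⊤ B) F)
    (y : coindSec ⊤ A V) (hy : coindAp β V y = F) :
    ∃ f : coindSec ⊤ A V, IsSmooth (coindObj ⊤ A) f ∧ coindAp β V f = F := by
  obtain ⟨N, -⟩ := exists_good_model hE V
  have h0 : ∀ᶠ h in 𝓝 (1 : GHat k), ∀ hh, coindConj B N h hh F = F := hF N
  obtain ⟨L, hL, hH⟩ := (krullTopology_mem_nhds_one_iff _ _ _).1 (h0.and N.eventually_mem)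
  have hHN : L.fixingSubgroup ≤ N.K.fixingSubgroup := fun h hh => (hH hh).2
  obtain ⟨f, hf, hf'⟩ := exists_invariant N L.fixingSubgroup hHN y
  refine ⟨f, IsSmooth.of_model (F := coindObj ⊤ A) hE N ?_, funext fun g => ?_⟩
  · filter_upwards [(IntermediateField.fixingSubgroup_isOpen L).mem_nhds (one_mem _)] with h hh hh'
    exact hf h hh
  · obtain ⟨h, hh, e⟩ := hf' g
    have h1 : coindAp β V (coindConj A N h (hHN hh) y) = F := by
      rw [coindAp_conj, hy]
      exact (hH hh).1 _
    rw [coindAp_apply, e, ← coindAp_apply, h1]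

lemma epi_coindHat_map [Epi β] : Epi ((coindHat hE ⋙ underlyingHat p E).map β) := by
  rw [← Sheaf.isLocallySurjective_iff_epi' AddCommGrpCat.{u + 1}]
  refine ⟨fun {U} F => ?_⟩
  let F' : (smoothSub (coindObj ⊤ B) hE).carrier U := F
  obtain ⟨R, hR, h⟩ := exists_cover_le_liftSieve β hE F'.1 F'.2
  refine (etaleTopology p E).superset_covering ?_ hR
  intro V a ha
  -- Each `y g` is correct only at the index g. The diagonal g ↦ y g g lifts all values at once, but
  -- it need not be smooth yet.
  choose y hy using fun g => (liftSieve_iff β F'.1 g a).1 (h g _ ha)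
  obtain ⟨f, hf, hf'⟩ := exists_smooth_lift β hE (coindRes B a F'.1)
    (IsSmooth.res (F := coindObj ⊤ B) hE a F'.2) (fun g => y g g) (funext fun g => hy g)
  let f' : (smoothSub (coindObj ⊤ A) hE).carrier V := ⟨f, hf⟩
  exact ⟨f', Subtype.ext hf'⟩

end epi

/-! ### Kernels of étale sheaves and exactness of smooth coinduction. -/

section kernel

variable {k : Type u} [Field k] {X : Scheme.{u}} {p : X ⟶ Spec (.of k)} {E : ObjectProperty (Over X)}
  {Γ : Subgroup (GHat k)}

/-- The kernel subsheaf is a kernel. -/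
def kerSubSheafIsLimit {F F' : AbSheaf p E} (φ : F ⟶ F') (w : (kerSubSheaf φ).incl ≫ φ = 0) :
    IsLimit (KernelFork.ofι (kerSubSheaf φ).incl w) :=
  KernelFork.IsLimit.ofι' _ _ fun {W} f hf =>
    ⟨(kerSubSheaf φ).lift f fun U x => congrArg (fun t : W ⟶ F' => ap t.hom U x) hf, rfl⟩

variable [PerfectField k]

/-- The kernel of a morphism of étale sheaves. -/
def kerHat {K L : TGHat p E} (φ : K ⟶ L) : TGHat p E :=
  ⟨EqSheaf.ker φ.hom, isContinuous_sub _ _ _ fun U x _ => (isContinuous_iff _).1 K.property U x⟩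

def kerHatι {K L : TGHat p E} (φ : K ⟶ L) : kerHat φ ⟶ K := ⟨EqSheaf.kerι φ.hom⟩

lemma kerHatι_comp {K L : TGHat p E} (φ : K ⟶ L) : kerHatι φ ≫ φ = 0 :=
  (isContinuous p E).hom_ext (EqSheaf.kerι_comp φ.hom)

def kerHatIsLimit {K L : TGHat p E} (φ : K ⟶ L) :
    IsLimit (KernelFork.ofι (kerHatι φ) (kerHatι_comp φ)) :=
  haveI : Mono (kerHatι φ) := ⟨fun f g h => (isContinuous p E).hom_ext
    ((cancel_mono (EqSheaf.kerι φ.hom)).1 (congrArg (fun t => t.hom) h))⟩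
  KernelFork.IsLimit.ofι' _ _ fun f hf =>
    ⟨⟨EqSheaf.kerLift f.hom (congrArg (fun t => t.hom) hf)⟩, rfl⟩

/-- Subsheaves of a continuous sheaf are continuous, so kernels of étale sheaves are computed on
underlying sheaves. -/
instance {K L : TGHat p E} (φ : K ⟶ L) : PreservesLimit (parallelPair φ 0) (underlyingHat p E) :=
  preservesLimit_of_preserves_limit_cone (kerHatIsLimit φ)
    ((KernelFork.isLimitMapConeEquiv _ (underlyingHat p E)).symm
      (kerSubSheafIsLimit φ.hom.hom (congrArg (fun t => t.hom) (EqSheaf.kerι_comp φ.hom))))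

variable (hE : IsAdmissible p E)

instance : (coindHat hE ⋙ underlyingHat p E).Additive := inferInstance

/-- Kernels are preserved because `coindHat` is a right adjoint and kernels in étale sheaves are the
underlying ones. Epimorphisms are preserved by the compactness argument. -/
lemma preservesHomology_coindHat : (coindHat hE ⋙ underlyingHat p E).PreservesHomology := by
  have h1 : PreservesLimits (coindHat hE) := (coindHatAdj hE).rightAdjoint_preservesLimits
  have h2 : ∀ {A B : AbSheaf p E} (f : A ⟶ B),
      PreservesLimit (parallelPair f 0) (coindHat hE ⋙ underlyingHat p E) := fun {A B} f => by
    have h3 : PreservesLimit (parallelPair f 0 ⋙ coindHat hE) (underlyingHat p E) :=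
      preservesLimit_of_iso_diagram (underlyingHat p E)
        (parallelPair.ext (Iso.refl _) (Iso.refl _) (by simp) (by simp) :
          parallelPair ((coindHat hE).map f) 0 ≅ parallelPair f 0 ⋙ coindHat hE)
    infer_instance
  have h4 : (coindHat hE ⋙ underlyingHat p E).PreservesEpimorphisms :=
    ⟨fun f hf => epi_coindHat_map f hE⟩
  exact Functor.preservesHomology_of_preservesEpis_and_kernels _

end kernel
end WeilEtale
end

noncomputable section
namespace WeilEtale

/-! ### Homotopy fibres, by axioms that survive additive functors. -/

section fibre

variable {C : Type*} [Category* C] [Preadditive C]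

/-- A complex `X` presented as the shifted mapping cone (the homotopy fibre) of a morphism of
complexes. -/
structure FibData {K L : CochainComplex C ℤ} (φ : K ⟶ L) (X : CochainComplex C ℤ) where
  inl (n : ℤ) : K.X n ⟶ X.X n
  inr (m n : ℤ) (h : m + 1 = n) : L.X m ⟶ X.X n
  fst (n : ℤ) : X.X n ⟶ K.X n
  snd (m n : ℤ) (h : m + 1 = n) : X.X n ⟶ L.X m
  inl_fst (n : ℤ) : inl n ≫ fst n = 𝟙 _
  inl_snd (m n : ℤ) (h : m + 1 = n) : inl n ≫ snd m n h = 0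
  inr_fst (m n : ℤ) (h : m + 1 = n) : inr m n h ≫ fst n = 0
  inr_snd (m n : ℤ) (h : m + 1 = n) : inr m n h ≫ snd m n h = 𝟙 _
  total (m n : ℤ) (h : m + 1 = n) : fst n ≫ inl n + snd m n h ≫ inr m n h = 𝟙 _
  inl_d (m n : ℤ) (h : m + 1 = n) : inl m ≫ X.d m n = K.d m n ≫ inl n + φ.f m ≫ inr m n h
  inr_d (m n l : ℤ) (h : m + 1 = n) (h' : n + 1 = l) :
    inr m n h ≫ X.d n l = - L.d m n ≫ inr n l h'

namespace FibData

variable {K L : CochainComplex C ℤ} {φ : K ⟶ L} {X : CochainComplex C ℤ} (F : FibData φ X)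

attribute [simp] inl_fst inl_snd inr_fst inr_snd

@[simp] lemma inl_fst_assoc (n : ℤ) {Z : C} (f : K.X n ⟶ Z) : F.inl n ≫ F.fst n ≫ f = f := by
  rw [← Category.assoc, inl_fst, Category.id_comp]
@[simp] lemma inl_snd_assoc (m n : ℤ) (h : m + 1 = n) {Z : C} (f : L.X m ⟶ Z) :
    F.inl n ≫ F.snd m n h ≫ f = 0 := by rw [← Category.assoc, inl_snd, zero_comp]
@[simp] lemma inr_fst_assoc (m n : ℤ) (h : m + 1 = n) {Z : C} (f : K.X n ⟶ Z) :
    F.inr m n h ≫ F.fst n ≫ f = 0 := by rw [← Category.assoc, inr_fst, zero_comp]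
@[simp] lemma inr_snd_assoc (m n : ℤ) (h : m + 1 = n) {Z : C} (f : L.X m ⟶ Z) :
    F.inr m n h ≫ F.snd m n h ≫ f = f := by rw [← Category.assoc, inr_snd, Category.id_comp]

include F in
lemma hom_ext_from (m n : ℤ) (h : m + 1 = n) {Z : C} {f g : X.X n ⟶ Z}
    (h₁ : F.inl n ≫ f = F.inl n ≫ g) (h₂ : F.inr m n h ≫ f = F.inr m n h ≫ g) : f = g := by
  rw [← Category.id_comp f, ← Category.id_comp g, ← F.total m n h, Preadditive.add_comp,
    Preadditive.add_comp, Category.assoc, Category.assoc, Category.assoc, Category.assoc, h₁, h₂]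

lemma d_fst (m n : ℤ) (h : m + 1 = n) : X.d m n ≫ F.fst n = F.fst m ≫ K.d m n := by
  apply F.hom_ext_from (m - 1) m (by lia)
  · rw [← Category.assoc, F.inl_d m n h]; simp
  · rw [← Category.assoc, F.inr_d (m - 1) m n (by lia) h]; simp

/-- The image under an additive functor. -/
def map {D : Type*} [Category* D] [Preadditive D] (Ψ : C ⥤ D) [Ψ.Additive] :
    FibData ((Ψ.mapHomologicalComplex (ComplexShape.up ℤ)).map φ)
      ((Ψ.mapHomologicalComplex (ComplexShape.up ℤ)).obj X) where
  inl n := Ψ.map (F.inl n)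
  inr m n h := Ψ.map (F.inr m n h)
  fst n := Ψ.map (F.fst n)
  snd m n h := Ψ.map (F.snd m n h)
  inl_fst n := (Ψ.map_comp _ _).symm.trans ((congrArg Ψ.map (F.inl_fst n)).trans (Ψ.map_id _))
  inl_snd m n h := (Ψ.map_comp _ _).symm.trans ((congrArg Ψ.map (F.inl_snd m n h)).trans
    (Ψ.map_zero _ _))
  inr_fst m n h := (Ψ.map_comp _ _).symm.trans ((congrArg Ψ.map (F.inr_fst m n h)).trans
    (Ψ.map_zero _ _))
  inr_snd m n h := (Ψ.map_comp _ _).symm.trans ((congrArg Ψ.map (F.inr_snd m n h)).trans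
    (Ψ.map_id _))
  total m n h := by
    refine Eq.trans ?_ ((congrArg Ψ.map (F.total m n h)).trans (Ψ.map_id _))
    rw [Ψ.map_add, Ψ.map_comp, Ψ.map_comp]
    rfl
  inl_d m n h := by
    refine ((Ψ.map_comp _ _).symm.trans (congrArg Ψ.map (F.inl_d m n h))).trans ?_
    rw [Ψ.map_add, Ψ.map_comp, Ψ.map_comp]
    rfl
  inr_d m n l h h' := by
    refine ((Ψ.map_comp _ _).symm.trans (congrArg Ψ.map (F.inr_d m n l h h'))).trans ?_
    exact Ψ.map_neg.trans (congrArg Neg.neg (Ψ.map_comp _ _))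

section functoriality

variable {K' L' : CochainComplex C ℤ} {φ' : K' ⟶ L'} {X' : CochainComplex C ℤ} (F' : FibData φ' X')
  {K'' L'' : CochainComplex C ℤ} {φ'' : K'' ⟶ L''} {X'' : CochainComplex C ℤ}
  (F'' : FibData φ'' X'')

/-- The morphism of homotopy fibres induced by a commutative square. -/
def desc (f : K ⟶ K') (g : L ⟶ L') (w : f ≫ φ' = φ ≫ g) : X ⟶ X' where
  f n := F.fst n ≫ f.f n ≫ F'.inl n +
    F.snd (n - 1) n (by lia) ≫ g.f (n - 1) ≫ F'.inr (n - 1) n (by lia)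
  comm' m n h := by
    have hmn : m + 1 = n := h
    obtain rfl : m = n - 1 := by lia
    have w' := HomologicalComplex.congr_hom w (n - 1)
    simp only [HomologicalComplex.comp_f] at w'
    apply F.hom_ext_from (n - 1 - 1) (n - 1) (by lia)
    · rw [← Category.assoc (F.inl _) (X.d _ _), F.inl_d (n - 1) n hmn]
      simp [F'.inl_d (n - 1) n hmn, reassoc_of% w']
    · rw [← Category.assoc (F.inr _ _ _) (X.d _ _), F.inr_d (n - 1 - 1) (n - 1) n (by lia) hmn]
      simp [F'.inr_d (n - 1 - 1) (n - 1) n (by lia) hmn]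

variable (f : K ⟶ K') (g : L ⟶ L') (w : f ≫ φ' = φ ≫ g)

@[simp] lemma inl_desc (n : ℤ) : F.inl n ≫ (F.desc F' f g w).f n = f.f n ≫ F'.inl n := by
  simp [desc]

@[simp] lemma inr_desc (m n : ℤ) (h : m + 1 = n) :
    F.inr m n h ≫ (F.desc F' f g w).f n = g.f m ≫ F'.inr m n h := by
  obtain rfl : m = n - 1 := by lia
  simp [desc]

@[simp] lemma inl_desc_assoc (n : ℤ) {Z : C} (t : X'.X n ⟶ Z) :
    F.inl n ≫ (F.desc F' f g w).f n ≫ t = f.f n ≫ F'.inl n ≫ t := by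
  rw [← Category.assoc, inl_desc, Category.assoc]

@[simp] lemma inr_desc_assoc (m n : ℤ) (h : m + 1 = n) {Z : C} (t : X'.X n ⟶ Z) :
    F.inr m n h ≫ (F.desc F' f g w).f n ≫ t = g.f m ≫ F'.inr m n h ≫ t := by
  rw [← Category.assoc, inr_desc, Category.assoc]

include F in
lemma complex_hom_ext {Z : CochainComplex C ℤ} {a b : X ⟶ Z}
    (h₁ : ∀ n, F.inl n ≫ a.f n = F.inl n ≫ b.f n)
    (h₂ : ∀ m n h, F.inr m n h ≫ a.f n = F.inr m n h ≫ b.f n) : a = b := by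
  ext n
  exact F.hom_ext_from (n - 1) n (by lia) (h₁ n) (h₂ _ _ _)

lemma desc_comp (f' : K' ⟶ K'') (g' : L' ⟶ L'') (w' : f' ≫ φ'' = φ' ≫ g')
    (w'' : (f ≫ f') ≫ φ'' = φ ≫ (g ≫ g')) :
    F.desc F' f g w ≫ F'.desc F'' f' g' w' = F.desc F'' (f ≫ f') (g ≫ g') w'' := by
  apply F.complex_hom_ext <;> intros <;> simp

lemma map_desc {D : Type*} [Category* D] [Preadditive D] (Ψ : C ⥤ D) [Ψ.Additive]
    (w' : (Ψ.mapHomologicalComplex (ComplexShape.up ℤ)).map f ≫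
      (Ψ.mapHomologicalComplex (ComplexShape.up ℤ)).map φ' =
      (Ψ.mapHomologicalComplex (ComplexShape.up ℤ)).map φ ≫
      (Ψ.mapHomologicalComplex (ComplexShape.up ℤ)).map g) :
    (Ψ.mapHomologicalComplex (ComplexShape.up ℤ)).map (F.desc F' f g w) =
      (F.map Ψ).desc (F'.map Ψ) ((Ψ.mapHomologicalComplex (ComplexShape.up ℤ)).map f)
        ((Ψ.mapHomologicalComplex (ComplexShape.up ℤ)).map g) w' := by
  apply (F.map Ψ).complex_hom_ext
  · intro n
    refine Eq.trans ?_ ((F.map Ψ).inl_desc (F'.map Ψ) _ _ w' n).symm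
    refine (Ψ.map_comp _ _).symm.trans ((congrArg Ψ.map (F.inl_desc F' f g w n)).trans ?_)
    exact Ψ.map_comp _ _
  · intro m n h
    refine Eq.trans ?_ ((F.map Ψ).inr_desc (F'.map Ψ) _ _ w' m n h).symm
    refine (Ψ.map_comp _ _).symm.trans ((congrArg Ψ.map (F.inr_desc F' f g w m n h)).trans ?_)
    exact Ψ.map_comp _ _

/-- Homotopy fibres of isomorphic morphisms are isomorphic. -/
def isoOfIso (e : K ≅ K') (e' : L ≅ L') (w : e.hom ≫ φ' = φ ≫ e'.hom) : X ≅ X' where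
  hom := F.desc F' e.hom e'.hom w
  inv := F'.desc F e.inv e'.inv (by rw [Iso.inv_comp_eq, reassoc_of% w]; simp)
  hom_inv_id := by
    rw [F.desc_comp F' F _ _ w _ _ _ (by simp)]
    apply F.complex_hom_ext <;> intros <;> simp
  inv_hom_id := by
    rw [F'.desc_comp F F' _ _ _ _ _ w (by simp)]
    apply F'.complex_hom_ext <;> intros <;> simp

end functoriality

end FibData

section construction

variable [HasBinaryBiproducts C] {K L : CochainComplex C ℤ} (φ : K ⟶ L)

/-- The differential of the homotopy fibre. -/
def fibD (m n : ℤ) (h : m + 1 = n) : K.X m ⊞ L.X (m - 1) ⟶ K.X n ⊞ L.X (n - 1) :=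
  biprod.fst ≫ K.d m n ≫ biprod.inl +
    (biprod.fst ≫ φ.f m ≫ (L.XIsoOfEq (eq_sub_of_add_eq h)).hom -
      biprod.snd ≫ L.d (m - 1) (n - 1)) ≫ biprod.inr

lemma fibD_comp (m n l : ℤ) (h : m + 1 = n) (h' : n + 1 = l) : fibD φ m n h ≫ fibD φ n l h' = 0 := by
  have key : ∀ i (h : n = i), K.d m n ≫ φ.f n ≫ (L.XIsoOfEq h).hom - K.d m i ≫ φ.f i = 0 := by
    rintro _ rfl; simp
  apply biprod.hom_ext'
  · apply biprod.hom_ext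
    · simp [fibD]
    · simpa [fibD] using key _ (eq_sub_of_add_eq h')
  · apply biprod.hom_ext <;> simp [fibD]

/-- The homotopy fibre of a morphism of complexes. -/
def fib : CochainComplex C ℤ :=
  CochainComplex.of (fun n => K.X n ⊞ L.X (n - 1)) (fun n => fibD φ n (n + 1) rfl)
    fun n => fibD_comp φ _ _ _ _ _

lemma fib_d (m n : ℤ) (h : m + 1 = n) : (fib φ).d m n = fibD φ m n h := by
  subst h
  exact CochainComplex.of_d (fun n => K.X n ⊞ L.X (n - 1)) (fun n => fibD φ n (n + 1) rfl) m

lemma inl_fibD (m n : ℤ) (h : m + 1 = n) : biprod.inl ≫ fibD φ m n h = K.d m n ≫ biprod.inl +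
    φ.f m ≫ (L.XIsoOfEq (eq_sub_of_add_eq h)).hom ≫ biprod.inr := by
  simp [fibD]

lemma inr_fibD (m n l : ℤ) (h : m + 1 = n) (h' : n + 1 = l) :
    ((L.XIsoOfEq (eq_sub_of_add_eq h)).hom ≫ biprod.inr) ≫ fibD φ n l h' =
      - L.d m n ≫ (L.XIsoOfEq (eq_sub_of_add_eq h')).hom ≫ biprod.inr := by
  simp [fibD]

lemma biprod_total (m n : ℤ) (h : m + 1 = n) :
    (biprod.fst ≫ biprod.inl + (biprod.snd ≫ (L.XIsoOfEq (eq_sub_of_add_eq h)).inv) ≫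
      (L.XIsoOfEq (eq_sub_of_add_eq h)).hom ≫ biprod.inr) = 𝟙 (K.X n ⊞ L.X (n - 1)) := by
  simp

/-- The homotopy fibre is a homotopy fibre. -/
def fibData : FibData φ (fib φ) where
  inl n := (biprod.inl : K.X n ⟶ K.X n ⊞ L.X (n - 1))
  inr m n h := ((L.XIsoOfEq (eq_sub_of_add_eq h)).hom ≫ biprod.inr : L.X m ⟶ K.X n ⊞ L.X (n - 1))
  fst n := (biprod.fst : K.X n ⊞ L.X (n - 1) ⟶ K.X n)
  snd m n h := (biprod.snd ≫ (L.XIsoOfEq (eq_sub_of_add_eq h)).inv : K.X n ⊞ L.X (n - 1) ⟶ L.X m)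
  inl_fst n := biprod.inl_fst
  inl_snd m n h := show (biprod.inl : K.X n ⟶ K.X n ⊞ L.X (n - 1)) ≫ biprod.snd ≫
    (L.XIsoOfEq (eq_sub_of_add_eq h)).inv = 0 by simp
  inr_fst m n h := show ((L.XIsoOfEq (eq_sub_of_add_eq h)).hom ≫ biprod.inr) ≫
    (biprod.fst : K.X n ⊞ L.X (n - 1) ⟶ K.X n) = 0 by simp
  inr_snd m n h := show ((L.XIsoOfEq (eq_sub_of_add_eq h)).hom ≫ biprod.inr) ≫
    (biprod.snd : K.X n ⊞ L.X (n - 1) ⟶ _) ≫ (L.XIsoOfEq (eq_sub_of_add_eq h)).inv = 𝟙 _ by simp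
  total m n h := biprod_total m n h
  inl_d m n h := (congrArg (biprod.inl ≫ ·) (fib_d φ m n h)).trans (inl_fibD φ m n h)
  inr_d m n l h h' := (congrArg (((L.XIsoOfEq (eq_sub_of_add_eq h)).hom ≫ biprod.inr) ≫ ·)
    (fib_d φ n l h')).trans (inr_fibD φ m n l h h')

end construction
end fibre
end WeilEtale
end

noncomputable section
namespace WeilEtale

/-! ### Quasi-isomorphisms between homotopy fibres. -/

section fibreHomology

variable {A : Type*} [Category* A] [Abelian A]

/-- The sequence `0 ⟶ a ⟶ b ⟶ c ⟶ 0` is split exact. -/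
def SplitSeq {C : Type*} [Category* C] [Preadditive C] {a b c : C} (f : a ⟶ b) (g : b ⟶ c) : Prop :=
  ∃ (r : b ⟶ a) (s : c ⟶ b), f ≫ r = 𝟙 a ∧ s ≫ g = 𝟙 c ∧ r ≫ f + g ≫ s = 𝟙 b

section
open ComposableArrows HomologicalComplex.HomologySequence

variable {S₁ S₂ : ShortComplex (CochainComplex A ℤ)} (φ : S₁ ⟶ S₂) (hS₁ : S₁.ShortExact)
  (hS₂ : S₂.ShortExact)

include hS₁ hS₂ in
-- The five lemma on the long exact homology sequences, done as two four lemmas.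
lemma quasiIso_τ₂ (h₁ : QuasiIso φ.τ₁) (h₃ : QuasiIso φ.τ₃) : QuasiIso φ.τ₂ := by
  rw [quasiIso_iff]
  intro j
  rw [quasiIsoAt_iff_isIso_homologyMap]
  have hij : (ComplexShape.up ℤ).Rel (j - 1) j := by simp
  have hjl : (ComplexShape.up ℤ).Rel j (j + 1) := by simp
  have hm : Mono (HomologicalComplex.homologyMap φ.τ₂ j) := by
    refine Abelian.mono_of_epi_of_mono_of_mono
      ((δ₀Functor ⋙ δ₀Functor).map (mapComposableArrows₅ φ hS₁ hS₂ (j - 1) j hij)) ?_ ?_ ?_ ?_ ?_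
    · exact (composableArrows₅_exact hS₁ (j - 1) j hij).δ₀.δ₀
    · exact (composableArrows₅_exact hS₂ (j - 1) j hij).δ₀.δ₀
    · exact inferInstanceAs (Epi (HomologicalComplex.homologyMap φ.τ₃ (j - 1)))
    · exact inferInstanceAs (Mono (HomologicalComplex.homologyMap φ.τ₁ j))
    · exact inferInstanceAs (Mono (HomologicalComplex.homologyMap φ.τ₃ j))
  have he : Epi (HomologicalComplex.homologyMap φ.τ₂ j) := by
    refine Abelian.epi_of_epi_of_epi_of_mono
      ((δlastFunctor ⋙ δlastFunctor).map (mapComposableArrows₅ φ hS₁ hS₂ j (j + 1) hjl)) ?_ ?_ ?_ ?_ ?_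
    · exact (composableArrows₅_exact hS₁ j (j + 1) hjl).δlast.δlast
    · exact (composableArrows₅_exact hS₂ j (j + 1) hjl).δlast.δlast
    · exact inferInstanceAs (Epi (HomologicalComplex.homologyMap φ.τ₁ j))
    · exact inferInstanceAs (Epi (HomologicalComplex.homologyMap φ.τ₃ j))
    · exact inferInstanceAs (Mono (HomologicalComplex.homologyMap φ.τ₁ (j + 1)))
  exact isIso_of_mono_of_epi _

include hS₁ in
lemma quasiIso_f_of_acyclic (h : S₁.X₃.Acyclic) : QuasiIso S₁.f := by
  rw [quasiIso_iff]
  intro j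
  rw [quasiIsoAt_iff_isIso_homologyMap]
  have hij : (ComplexShape.up ℤ).Rel (j - 1) j := by simp
  have hz : ∀ i, IsZero (S₁.X₃.homology i) := fun i =>
    ((S₁.X₃.exactAt_iff_isZero_homology i).1 (h i))
  have hm : Mono (HomologicalComplex.homologyMap S₁.f j) :=
    (hS₁.homology_exact₁ (j - 1) j hij).mono_g ((hz _).eq_of_src _ _)
  have he : Epi (HomologicalComplex.homologyMap S₁.f j) :=
    (hS₁.homology_exact₂ j).epi_f ((hz _).eq_of_tgt _ _)
  exact isIso_of_mono_of_epi _

end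

namespace FibData

section
variable {C : Type*} [Category* C] [Preadditive C] {K L : CochainComplex C ℤ}
  {φ : K ⟶ L} {X : CochainComplex C ℤ} (F : FibData φ X)

/-- The inclusion of the shifted target in the homotopy fibre. -/
def shiftIncl : L⟦(-1 : ℤ)⟧ ⟶ X where
  f n := F.inr (n + -1) n (neg_add_cancel_right n 1)
  comm' n l h := by
    have h' : n + 1 = l := h
    refine (F.inr_d (n + -1) n l (neg_add_cancel_right n 1) h').trans ?_
    have key : ∀ m (hm : m + 1 = l) (hnm : n = m),
        (- L.d (n + -1) n ≫ F.inr n l h') = - L.d (n + -1) m ≫ F.inr m l hm := by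
      rintro _ _ rfl; rfl
    refine (key (l + -1) (neg_add_cancel_right l 1) (by lia)).trans ?_
    have h2 : (CategoryTheory.shiftFunctor (CochainComplex C ℤ) (-1 : ℤ)).obj L =
      (CochainComplex.shiftFunctor C (-1)).obj L := rfl
    have h3 : ((CategoryTheory.shiftFunctor (CochainComplex C ℤ) (-1 : ℤ)).obj L).d n l =
      - L.d (n + -1) (l + -1) := by simp
    rw [h3]
    exact (Preadditive.neg_comp _ _).symm

/-- The projection to the source. -/
def proj : X ⟶ K where
  f n := F.fst n
  comm' m n h := (F.d_fst m n h).symm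

lemma shiftIncl_proj : F.shiftIncl ≫ F.proj = 0 := by
  ext n
  exact F.inr_fst _ _ _

/-- The short complex `L[-1] ⟶ X ⟶ K`. -/
def shortComplex : ShortComplex (CochainComplex C ℤ) := .mk _ _ F.shiftIncl_proj

/-- The short complex `L[-1] ⟶ X ⟶ K` is degreewise split. -/
def splitting (n : ℤ) : (F.shortComplex.map (HomologicalComplex.eval C _ n)).Splitting where
  r := F.snd (n + -1) n (neg_add_cancel_right n 1)
  s := F.inl n
  f_r := F.inr_snd _ _ _
  s_g := F.inl_fst n
  id := (add_comm _ _).trans (F.total _ _ _)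

variable {K' L' : CochainComplex C ℤ} {φ' : K' ⟶ L'} {X' : CochainComplex C ℤ} (F' : FibData φ' X')
  (f : K ⟶ K') (g : L ⟶ L') (w : f ≫ φ' = φ ≫ g)

/-- The morphism of short complexes induced by a commutative square. -/
def shortComplexMap : F.shortComplex ⟶ F'.shortComplex where
  τ₁ := g⟦(-1 : ℤ)⟧'
  τ₂ := F.desc F' f g w
  τ₃ := f
  comm₁₂ := by
    ext n
    exact (F.inr_desc F' f g w (n + -1) n _).symm
  comm₂₃ := by
    apply F.complex_hom_ext
    · intro n
      exact (F.inl_desc_assoc F' f g w n (F'.fst n)).trans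
        ((congrArg (f.f n ≫ ·) (F'.inl_fst n)).trans
        ((Category.comp_id _).trans (F.inl_fst_assoc n (f.f n)).symm))
    · intro m n h
      exact (F.inr_desc_assoc F' f g w m n h (F'.fst n)).trans
        ((congrArg (g.f m ≫ ·) (F'.inr_fst m n h)).trans
        (comp_zero.trans (F.inr_fst_assoc m n h (f.f n)).symm))

/-- The homotopy fibre of an identity is contractible. -/
def contraction (F : FibData (𝟙 K) X) : Homotopy (𝟙 X) 0 where
  hom n m := if h : m + 1 = n then F.snd m n h ≫ F.inl m else 0
  zero n m h := dif_neg h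
  comm n := by
    have h1 : n + 1 = n + 1 := rfl
    have h2 : n - 1 + 1 = n := by lia
    rw [dNext_eq (i := n) (i' := n + 1) _ rfl, prevD_eq (j := n) (j' := n - 1) _ h2, dif_pos h1,
      dif_pos h2]
    apply F.hom_ext_from (n - 1) n h2
    · rw [HomologicalComplex.zero_f, add_zero, Preadditive.comp_add,
        ← Category.assoc (F.inl n) (X.d _ _), F.inl_d n (n + 1) h1]
      simp
    · rw [HomologicalComplex.zero_f, add_zero, Preadditive.comp_add,
        ← Category.assoc (F.inr _ n h2) (X.d _ _), F.inr_d (n - 1) n (n + 1) h2 h1]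
      simp [F.inl_d (n - 1) n h2]

variable {Z : CochainComplex C ℤ} (η : Z ⟶ K) (hη : η ≫ φ = 0)

/-- The morphism to the homotopy fibre from a morphism to the source with trivial composition. -/
def lift : Z ⟶ X where
  f n := η.f n ≫ F.inl n
  comm' m n h := by
    have h' := HomologicalComplex.congr_hom hη m
    rw [HomologicalComplex.comp_f, HomologicalComplex.zero_f] at h'
    rw [Category.assoc, F.inl_d m n h, Preadditive.comp_add, reassoc_of% h', zero_comp, add_zero,
      η.comm_assoc]

lemma comp_lift {Z' : CochainComplex C ℤ} (a : Z' ⟶ Z) (h : (a ≫ η) ≫ φ = 0) :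
    a ≫ F.lift η hη = F.lift (a ≫ η) h := by
  ext n
  exact (Category.assoc _ _ _).symm

lemma lift_desc (h : (η ≫ f) ≫ φ' = 0) : F.lift η hη ≫ F.desc F' f g w = F'.lift (η ≫ f) h := by
  ext n
  exact (Category.assoc _ _ _).trans ((congrArg (η.f n ≫ ·) (F.inl_desc F' f g w n)).trans
    (Category.assoc _ _ _).symm)

lemma map_lift {D : Type*} [Category* D] [Preadditive D] (Ψ : C ⥤ D) [Ψ.Additive] (h) :
    (Ψ.mapHomologicalComplex (ComplexShape.up ℤ)).map (F.lift η hη) =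
      (F.map Ψ).lift ((Ψ.mapHomologicalComplex (ComplexShape.up ℤ)).map η) h := by
  ext n
  exact Ψ.map_comp _ _

end

variable {K L : CochainComplex A ℤ} {φ : K ⟶ L} {X : CochainComplex A ℤ} (F : FibData φ X)
  {K' L' : CochainComplex A ℤ} {φ' : K' ⟶ L'} {X' : CochainComplex A ℤ} (F' : FibData φ' X')

lemma shortExact : F.shortComplex.ShortExact :=
  HomologicalComplex.shortExact_of_degreewise_shortExact _ fun n => (F.splitting n).shortExact

/-- The fibre is an extension of K by L[−1], so the five lemma applies. No boundedness enters. -/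
lemma quasiIso_desc (f : K ⟶ K') (g : L ⟶ L') (w : f ≫ φ' = φ ≫ g) [QuasiIso f] [QuasiIso g] :
    QuasiIso (F.desc F' f g w) :=
  quasiIso_τ₂ (F.shortComplexMap F' f g w) F.shortExact F'.shortExact
    (inferInstanceAs (QuasiIso (g⟦(-1 : ℤ)⟧'))) (inferInstanceAs (QuasiIso f))

lemma acyclic_of_id (F : FibData (𝟙 K) X) : X.Acyclic := by
  intro n
  rw [HomologicalComplex.exactAt_iff_isZero_homology, IsZero.iff_id_eq_zero,
    ← HomologicalComplex.homologyMap_id, F.contraction.homologyMap_eq,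
    HomologicalComplex.homologyMap_zero]

variable {Z : CochainComplex A ℤ} (η : Z ⟶ K) (hη : η ≫ φ = 0)

include F in
-- Z maps to the fibre of φ with cokernel the fibre of the identity of L, and this sequence splits
-- in each degree because Z → K → L does. The fibre of an identity is contractible, so Z → fib φ is
-- a quasi-isomorphism. The splittings need not commute with the differentials.
lemma quasiIso_lift (h : ∀ n, SplitSeq (η.f n) (φ.f n)) : QuasiIso (F.lift η hη) := by
  let G := fibData (𝟙 L)
  have w : φ ≫ 𝟙 L = φ ≫ 𝟙 L := rfl
  have hz : F.lift η hη ≫ F.desc G φ (𝟙 L) w = 0 := by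
    ext n
    have h' := HomologicalComplex.congr_hom hη n
    rw [HomologicalComplex.comp_f, HomologicalComplex.zero_f] at h'
    rw [HomologicalComplex.comp_f, lift, Category.assoc, F.inl_desc, reassoc_of% h', zero_comp]
    rfl
  refine quasiIso_f_of_acyclic (S₁ := .mk _ _ hz)
    (HomologicalComplex.shortExact_of_degreewise_shortExact _ fun n => ?_) G.acyclic_of_id
  obtain ⟨r, s, s1, s2, s3⟩ := h n
  have hn : n - 1 + 1 = n := by lia
  have h1 : (η.f n ≫ F.inl n) ≫ F.fst n ≫ r = 𝟙 _ := by
    rw [Category.assoc, F.inl_fst_assoc, s1]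
  have h2 : (G.fst n ≫ s ≫ F.inl n + G.snd (n - 1) n hn ≫ F.inr (n - 1) n hn) ≫
      (F.desc G φ (𝟙 L) w).f n = 𝟙 _ := by
    apply G.hom_ext_from (n - 1) n hn
    · simp [reassoc_of% s2]
    · simp
  have h3 : (F.fst n ≫ r) ≫ (η.f n ≫ F.inl n) + (F.desc G φ (𝟙 L) w).f n ≫
      (G.fst n ≫ s ≫ F.inl n + G.snd (n - 1) n hn ≫ F.inr (n - 1) n hn) = 𝟙 _ := by
    apply F.hom_ext_from (n - 1) n hn
    · have := congrArg (· ≫ F.inl n) s3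
      simpa using this
    · simp
  exact ShortComplex.Splitting.shortExact ⟨_, _, h1, h2, h3⟩

end FibData

end fibreHomology
end WeilEtale
end

noncomputable section
namespace WeilEtale

/-! ### Derived functors from a two-column functorial resolution. -/

section derived

lemma SplitSeq.map {C D : Type*} [Category* C] [Preadditive C] [Category* D] [Preadditive D]
    {a b c : C} {f : a ⟶ b} {g : b ⟶ c} (h : SplitSeq f g) (Ψ : C ⥤ D) [Ψ.Additive] :
    SplitSeq (Ψ.map f) (Ψ.map g) := by
  obtain ⟨r, s, h1, h2, h3⟩ := h
  refine ⟨Ψ.map r, Ψ.map s, ?_, ?_, ?_⟩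
  · rw [← Ψ.map_comp, h1, Ψ.map_id]
  · rw [← Ψ.map_comp, h2, Ψ.map_id]
  · rw [← Ψ.map_comp, ← Ψ.map_comp, ← Ψ.map_add, h3, Ψ.map_id]

/-- The terms of the resolution are biproducts of two values of `J`, so splitness has to pass to
biproducts. -/
lemma SplitSeq.biprod {C : Type*} [Category* C] [Preadditive C] {J : C ⥤ C} [J.Additive]
    {η : 𝟭 C ⟶ J} {δ : J ⟶ J} {F F' : C} [HasBinaryBiproduct F F']
    (h : SplitSeq (η.app F) (δ.app F)) (h' : SplitSeq (η.app F') (δ.app F')) :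
    SplitSeq (η.app (F ⊞ F')) (δ.app (F ⊞ F')) := by
  obtain ⟨(r : J.obj F ⟶ F), s, (h1 : η.app F ≫ r = 𝟙 F), h2, h3⟩ := h
  obtain ⟨(r' : J.obj F' ⟶ F'), s', (h1' : η.app F' ≫ r' = 𝟙 F'), h2', h3'⟩ := h'
  have hJ : J.map (biprod.fst : F ⊞ F' ⟶ F) ≫ J.map biprod.inl +
      J.map (biprod.snd : F ⊞ F' ⟶ F') ≫ J.map biprod.inr = 𝟙 _ := by
    rw [← J.map_comp, ← J.map_comp, ← J.map_add, biprod.total, J.map_id]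
  have e1 : (biprod.fst : F ⊞ F' ⟶ F) ≫ η.app F = η.app _ ≫ J.map biprod.fst := η.naturality _
  have e2 : (biprod.snd : F ⊞ F' ⟶ F') ≫ η.app F' = η.app _ ≫ J.map biprod.snd := η.naturality _
  have e3 : (biprod.inl : F ⟶ F ⊞ F') ≫ η.app (F ⊞ F') = η.app _ ≫ J.map biprod.inl := η.naturality _
  have e4 : (biprod.inr : F' ⟶ F ⊞ F') ≫ η.app (F ⊞ F') = η.app _ ≫ J.map biprod.inr := η.naturality _
  have h3a := congrArg (fun t => J.map (biprod.fst : F ⊞ F' ⟶ F) ≫ t ≫ J.map (biprod.inl : F ⟶ F ⊞ F')) h3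
  have h3b := congrArg (fun t => J.map (biprod.snd : F ⊞ F' ⟶ F') ≫ t ≫ J.map (biprod.inr : F' ⟶ F ⊞ F')) h3'
  simp only [Preadditive.add_comp, Preadditive.comp_add, Category.id_comp, Category.assoc]
    at h3a h3b
  refine ⟨J.map biprod.fst ≫ r ≫ (biprod.inl : F ⟶ F ⊞ F') +
    J.map biprod.snd ≫ r' ≫ (biprod.inr : F' ⟶ F ⊞ F'),
    J.map biprod.fst ≫ s ≫ J.map biprod.inl + J.map biprod.snd ≫ s' ≫ J.map biprod.inr, ?_, ?_, ?_⟩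
  · rw [Preadditive.comp_add, ← reassoc_of% e1, ← reassoc_of% e2, reassoc_of% h1, reassoc_of% h1']
    exact biprod.total
  · simp only [Preadditive.add_comp, Category.assoc, NatTrans.naturality, reassoc_of% h2,
      reassoc_of% h2', hJ]
  · simp only [Preadditive.add_comp, Preadditive.comp_add, Category.assoc, e3, e4]
    rw [← NatTrans.naturality_assoc, ← NatTrans.naturality_assoc]
    rw [add_add_add_comm, h3a, h3b, hJ]

variable {𝒲 𝒯 S : Type*} [Category* 𝒲] [Preadditive 𝒲] [HasBinaryBiproducts 𝒲]
  [Category* 𝒯] [Preadditive 𝒯] [Category* S] [Abelian S]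

/-- The morphisms of complexes that an additive functor sends to quasi-isomorphisms. -/
abbrev qisOf {𝒜 : Type*} [Category* 𝒜] [Preadditive 𝒜] (Φ : 𝒜 ⥤ S) [Φ.Additive] :
    MorphismProperty (CochainComplex 𝒜 ℤ) :=
  (HomologicalComplex.quasiIso S (ComplexShape.up ℤ)).inverseImage
    (Φ.mapHomologicalComplex (ComplexShape.up ℤ))

variable {J : 𝒲 ⥤ 𝒲} [J.Additive] (η : 𝟭 𝒲 ⟶ J) (δ : J ⟶ J) (hηδ : η ≫ δ = 0)

/-- The endomorphism of a complex induced by a natural transformation. -/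
abbrev cplxMap (δ : J ⟶ J) (K : CochainComplex 𝒲 ℤ) :
    (J.mapHomologicalComplex (ComplexShape.up ℤ)).obj K ⟶
      (J.mapHomologicalComplex (ComplexShape.up ℤ)).obj K :=
  (NatTrans.mapHomologicalComplex δ (ComplexShape.up ℤ)).app K

lemma cplxMap_naturality {K L : CochainComplex 𝒲 ℤ} (f : K ⟶ L) :
    (J.mapHomologicalComplex (ComplexShape.up ℤ)).map f ≫ cplxMap δ L =
      cplxMap δ K ≫ (J.mapHomologicalComplex (ComplexShape.up ℤ)).map f :=
  (NatTrans.mapHomologicalComplex δ (ComplexShape.up ℤ)).naturality f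

/-- The functorial resolution by the homotopy fibre of `δ`. -/
def resolution : CochainComplex 𝒲 ℤ ⥤ CochainComplex 𝒲 ℤ where
  obj K := fib (cplxMap δ K)
  map f := (fibData _).desc (fibData _) _ _ (cplxMap_naturality δ f)
  map_id K := by
    apply (fibData (cplxMap δ K)).complex_hom_ext <;> intros <;> simp
  map_comp f g := by
    refine Eq.trans ?_ (FibData.desc_comp _ _ _ _ _ (cplxMap_naturality δ f) _ _
      (cplxMap_naturality δ g) (by
        rw [Category.assoc, cplxMap_naturality, reassoc_of% (cplxMap_naturality δ f)])).symm
    apply (fibData (cplxMap δ _)).complex_hom_ext <;> intros <;> simp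

/-- The morphism of complexes given by the unit. -/
def unitMap (K : CochainComplex 𝒲 ℤ) : K ⟶ (J.mapHomologicalComplex (ComplexShape.up ℤ)).obj K where
  f n := η.app (K.X n)
  comm' m n _ := (η.naturality (K.d m n)).symm

include hηδ in
lemma unitMap_comp (K : CochainComplex 𝒲 ℤ) : unitMap η K ≫ cplxMap δ K = 0 := by
  ext n
  exact congrArg (fun t => t.app (K.X n)) hηδ

/-- The functorial resolution of a complex. -/
def toResolution : 𝟭 (CochainComplex 𝒲 ℤ) ⟶ resolution δ where
  app K := (fibData (cplxMap δ K)).lift (unitMap η K) (unitMap_comp η δ hηδ K)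
  naturality K L f := by
    have h1 : f ≫ unitMap η L = unitMap η K ≫ (J.mapHomologicalComplex (ComplexShape.up ℤ)).map f := by
      ext n
      exact η.naturality (f.f n)
    have h2 : (f ≫ unitMap η L) ≫ cplxMap δ L = 0 := by
      rw [Category.assoc, unitMap_comp η δ hηδ, comp_zero]
    refine ((fibData (cplxMap δ L)).comp_lift _ _ f h2).trans (Eq.trans ?_
      ((fibData (cplxMap δ K)).lift_desc (fibData (cplxMap δ L)) _ _ (cplxMap_naturality δ f)
        (unitMap η K) (unitMap_comp η δ hηδ K) (h1 ▸ h2)).symm)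
    congr 1

variable (uW : 𝒲 ⥤ S) [uW.Additive] (γ : 𝒲 ⥤ 𝒯) [γ.Additive] (uT : 𝒯 ⥤ S) [uT.Additive]

/-- `Ψ` is left free for two uses. The forgetful functor gives that the resolution is a
quasi-isomorphism; γ followed by the forgetful functor gives that already resolved complexes are
acyclic for γ. -/
lemma qisOf_toResolution {Ψ : 𝒲 ⥤ S} [Ψ.Additive] (K : CochainComplex 𝒲 ℤ)
    (h : ∀ n, SplitSeq (Ψ.map (η.app (K.X n))) (Ψ.map (δ.app (K.X n)))) :
    qisOf Ψ ((toResolution η δ hηδ).app K) := by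
  change QuasiIso _
  have hz : (Ψ.mapHomologicalComplex (ComplexShape.up ℤ)).map (unitMap η K) ≫
      (Ψ.mapHomologicalComplex (ComplexShape.up ℤ)).map (cplxMap δ K) = 0 := by
    rw [← Functor.map_comp, unitMap_comp η δ hηδ, Functor.map_zero]
  have := ((fibData (cplxMap δ K)).map Ψ).quasiIso_lift _ hz h
  exact ((fibData (cplxMap δ K)).map_lift (unitMap η K) (unitMap_comp η δ hηδ K) Ψ hz) ▸ this

/-- Both columns of the resolution are values of `J`, so it is enough that γ ∘ `J` preserves
quasi-isomorphisms. -/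
lemma qisOf_resolution_map {K L : CochainComplex 𝒲 ℤ} (f : K ⟶ L)
    (h : qisOf (J ⋙ γ ⋙ uT) f) : qisOf (γ ⋙ uT) ((resolution δ).map f) := by
  have h' : QuasiIso (((γ ⋙ uT).mapHomologicalComplex (ComplexShape.up ℤ)).map
      ((J.mapHomologicalComplex (ComplexShape.up ℤ)).map f)) := h
  change QuasiIso (((γ ⋙ uT).mapHomologicalComplex (ComplexShape.up ℤ)).map
    (FibData.desc _ _ _ _ (cplxMap_naturality δ f)))
  have w : ((γ ⋙ uT).mapHomologicalComplex (ComplexShape.up ℤ)).map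
        ((J.mapHomologicalComplex (ComplexShape.up ℤ)).map f) ≫
      ((γ ⋙ uT).mapHomologicalComplex (ComplexShape.up ℤ)).map (cplxMap δ L) =
      ((γ ⋙ uT).mapHomologicalComplex (ComplexShape.up ℤ)).map (cplxMap δ K) ≫
        ((γ ⋙ uT).mapHomologicalComplex (ComplexShape.up ℤ)).map
        ((J.mapHomologicalComplex (ComplexShape.up ℤ)).map f) := by
    rw [← Functor.map_comp, ← Functor.map_comp, cplxMap_naturality]
  exact (FibData.map_desc (fibData (cplxMap δ K)) (fibData (cplxMap δ L)) _ _
    (cplxMap_naturality δ f) (γ ⋙ uT) w) ▸ FibData.quasiIso_desc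
      ((fibData (cplxMap δ K)).map (γ ⋙ uT)) ((fibData (cplxMap δ L)).map (γ ⋙ uT)) _ _ w

variable (hA : ∀ F, SplitSeq (uW.map (η.app F)) (uW.map (δ.app F)))
  (hB : ∀ ⦃K L : CochainComplex 𝒲 ℤ⦄ (f : K ⟶ L), qisOf uW f → qisOf (J ⋙ γ ⋙ uT) f)
  (hC : ∀ F, SplitSeq (η.app (J.obj F)) (δ.app (J.obj F)))

/-- `γ` applied degreewise, with values in the localization. -/
abbrev cplxQ : CochainComplex 𝒲 ℤ ⥤ (qisOf uT).Localization :=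
  γ.mapHomologicalComplex (ComplexShape.up ℤ) ⋙ (qisOf uT).Q

/-- The complexes on which the resolution does not change the value of `γ`. -/
def gammaAcyclic : ObjectProperty (CochainComplex 𝒲 ℤ) := fun K =>
  IsIso ((cplxQ γ uT).map ((toResolution η δ hηδ).app K))

include hC in
-- On values of `J` the unit sequence splits in the source category itself, and such a splitting
-- survives γ, about whose exactness nothing is assumed.
lemma gammaAcyclic_resolution (K : CochainComplex 𝒲 ℤ) :
    gammaAcyclic η δ hηδ γ uT ((resolution δ).obj K) := by
  refine Localization.inverts (qisOf uT).Q (qisOf uT) _ ?_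
  exact qisOf_toResolution η δ hηδ (Ψ := γ ⋙ uT) _ fun n =>
    (SplitSeq.biprod (hC _) (hC _)).map (γ ⋙ uT)

/-- The inclusion of the acyclic complexes. -/
def acyclicLocalizer : LocalizerMorphism
    ((qisOf uW).inverseImage (gammaAcyclic η δ hηδ γ uT).ι) (qisOf uW) where
  functor := (gammaAcyclic η δ hηδ γ uT).ι
  map := le_rfl

instance : (acyclicLocalizer η δ hηδ uW γ uT).functor.Full :=
  inferInstanceAs (gammaAcyclic η δ hηδ γ uT).ι.Full

instance : (acyclicLocalizer η δ hηδ uW γ uT).functor.Faithful :=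
  inferInstanceAs (gammaAcyclic η δ hηδ γ uT).ι.Faithful

include hA hC in
lemma isRightDerivabilityStructure_acyclicLocalizer :
    (acyclicLocalizer η δ hηδ uW γ uT).IsRightDerivabilityStructure :=
  LocalizerMorphism.isRightDerivabilityStructure_of_functorial_resolutions _
    (ρ := (gammaAcyclic η δ hηδ γ uT).lift (resolution δ)
      (gammaAcyclic_resolution η δ hηδ γ uT hC))
    (toResolution η δ hηδ)
    (fun K => qisOf_toResolution η δ hηδ (Ψ := uW) K fun n => hA (K.X n)) rfl

include hB in
-- In the naturality square of the resolution the two vertical maps become isomorphisms by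
-- acyclicity, and the resolved map does by `qisOf_resolution_map`. Hence so does the original one.
lemma derives_acyclicLocalizer : (acyclicLocalizer η δ hηδ uW γ uT).Derives (cplxQ γ uT) := by
  intro K L f hf
  have hK : IsIso ((cplxQ γ uT).map ((toResolution η δ hηδ).app K.obj)) := K.property
  have hL : IsIso ((cplxQ γ uT).map ((toResolution η δ hηδ).app L.obj)) := L.property
  have h1 : IsIso ((cplxQ γ uT).map ((resolution δ).map f.hom)) :=
    Localization.inverts (qisOf uT).Q (qisOf uT) _ (qisOf_resolution_map δ γ uT f.hom (hB _ hf))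
  have h2 : (cplxQ γ uT).map f.hom ≫ (cplxQ γ uT).map ((toResolution η δ hηδ).app L.obj) =
      (cplxQ γ uT).map ((toResolution η δ hηδ).app K.obj) ≫
        (cplxQ γ uT).map ((resolution δ).map f.hom) := by
    rw [← Functor.map_comp, ← Functor.map_comp]
    exact congrArg _ ((toResolution η δ hηδ).naturality f.hom)
  have h3 : IsIso ((cplxQ γ uT).map f.hom ≫
      (cplxQ γ uT).map ((toResolution η δ hηδ).app L.obj)) := by
    rw [h2]
    infer_instance
  exact @IsIso.of_isIso_comp_right _ _ _ _ _ _ ((cplxQ γ uT).map ((toResolution η δ hηδ).app L.obj)) hL h3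

include hηδ hA hB hC in
lemma hasRightDerivedFunctor_cplxQ : (cplxQ γ uT).HasRightDerivedFunctor (qisOf uW) := by
  have := isRightDerivabilityStructure_acyclicLocalizer η δ hηδ uW γ uT hA hC
  have := (derives_acyclicLocalizer η δ hηδ uW γ uT hB).hasPointwiseRightDerivedFunctor
  infer_instance

include hηδ hA hB hC in
-- The derived functor agrees with γ on the acyclic resolution of K, and K is isomorphic to that
-- resolution in the derived category.
lemma nonempty_totalRightDerived_iso [(cplxQ γ uT).HasRightDerivedFunctor (qisOf uW)]
    (K : CochainComplex 𝒲 ℤ) :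
    Nonempty ((qisOf uT).Q.obj ((γ.mapHomologicalComplex (ComplexShape.up ℤ)).obj
      ((resolution δ).obj K)) ≅
      ((cplxQ γ uT).totalRightDerived (qisOf uW).Q (qisOf uW)).obj ((qisOf uW).Q.obj K)) := by
  have := isRightDerivabilityStructure_acyclicLocalizer η δ hηδ uW γ uT hA hC
  have h1 := (derives_acyclicLocalizer η δ hηδ uW γ uT hB).isIso_of_isRightDerivedFunctor
    ((cplxQ γ uT).totalRightDerivedUnit (qisOf uW).Q (qisOf uW))
    ⟨(resolution δ).obj K, gammaAcyclic_resolution η δ hηδ γ uT hC K⟩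
  have h2 := Localization.isoOfHom (qisOf uW).Q (qisOf uW) ((toResolution η δ hηδ).app K)
    (qisOf_toResolution η δ hηδ (Ψ := uW) K fun n => hA (K.X n))
  exact ⟨(@asIso _ _ _ _ _ h1).trans
    (((cplxQ γ uT).totalRightDerived (qisOf uW).Q (qisOf uW)).mapIso h2.symm)⟩

end derived
end WeilEtale
end

noncomputable section
namespace WeilEtale

/-! ### The unit sequence of an infinite cyclic group: solving difference equations. -/

section unitSequence

/-- Sum forwards from 0 for n ≥ 0, and subtract the sum over n, …, −1 for n < 0. The normalisation
a(0) = 0 makes the solution unique and so, later, natural. -/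
lemma exists_int_antidifference {M : Type*} [AddCommGroup M] (b : ℤ → M) :
    ∃ a : ℤ → M, a 0 = 0 ∧ ∀ n, a (n + 1) = a n + b n := by
  refine ⟨fun n => ∑ i ∈ Finset.range n.toNat, b i - ∑ i ∈ Finset.range (-n).toNat, b (-(i + 1)),
    by simp, fun n => ?_⟩
  rcases n with n | n
  · have h1 : (Int.ofNat n + 1).toNat = n + 1 := by simp
    have h2 : (-(Int.ofNat n + 1)).toNat = 0 := by simp
    have h3 : (Int.ofNat n).toNat = n := by simp
    have h4 : (-(Int.ofNat n)).toNat = 0 := by simp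
    simp only [h1, h2, h3, h4, Finset.sum_range_succ]
    simp
  · have h1 : (Int.negSucc n + 1).toNat = 0 := by lia
    have h2 : (-(Int.negSucc n + 1)).toNat = n := by lia
    have h3 : (Int.negSucc n).toNat = 0 := by lia
    have h4 : (-(Int.negSucc n)).toNat = n + 1 := by lia
    simp only [h1, h2, h3, h4, Finset.sum_range_succ]
    have h5 : Int.negSucc n = -((n : ℤ) + 1) := by lia
    rw [h5]
    abel

lemma exists_log {G : Type*} [Group G] {c : G} (hc : Subgroup.zpowers c = ⊤)
    (hc' : ¬ IsOfFinOrder c) : ∃ l : G → ℤ, l 1 = 0 ∧ (∀ g, l (c * g) = l g + 1) ∧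
      ∀ g, c ^ l g = g := by
  have h : ∀ g : G, ∃ n : ℤ, c ^ n = g := fun g => by
    have := Subgroup.mem_top g
    rwa [← hc, Subgroup.mem_zpowers_iff] at this
  choose l hl using h
  have hi := injective_zpow_iff_not_isOfFinOrder.2 hc'
  refine ⟨l, hi ?_, fun g => hi ?_, hl⟩
  · simp only [hl, zpow_zero]
  · simp only [hl]
    rw [add_comm, zpow_add, zpow_one, hl]

/-- Endomorphisms of b are detected jointly by r and d, so the decomposition of the identity is
checked after each of them. -/
lemma splitSeq_of_joint {C : Type*} [Category* C] [Preadditive C] {a b c : C} (i : a ⟶ b)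
    (d : b ⟶ c) (r : b ⟶ a) (s : c ⟶ b) (hid : i ≫ d = 0) (hir : i ≫ r = 𝟙 a) (hsr : s ≫ r = 0)
    (hsd : s ≫ d = 𝟙 c) (h : ∀ f f' : b ⟶ b, f ≫ r = f' ≫ r → f ≫ d = f' ≫ d → f = f') :
    SplitSeq i d := by
  refine ⟨r, s, hir, hsd, h _ _ ?_ ?_⟩
  · rw [Preadditive.add_comp, Category.assoc, Category.assoc, hsr, hir, comp_zero, add_zero,
      Category.comp_id, Category.id_comp]
  · rw [Preadditive.add_comp, Category.assoc, Category.assoc, hsd, hid, comp_zero, zero_add,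
      Category.comp_id, Category.id_comp]

variable {k : Type u} [Field k] {X : Scheme.{u}} {p : X ⟶ Spec (.of k)} {E : ObjectProperty (Over X)}
  {Γ : Subgroup (GHat k)}

section coord

variable (F : EqSheaf p E Γ) {U : Ebar p E}

lemma EqSheaf.tr_tr_inv (g : Γ) (x : F.sec ((twist p E g).obj U)) :
    F.tr g (twId p E g U) (twId_hom p E g U)
      (F.tr g⁻¹ (twInv p E g U) (twInv_hom p E (inv_mul_cancel (g : GHat k)) U) x) = x := by
  refine (F.tr_tr g g⁻¹ (twInv p E g U) (twInv_hom p E (inv_mul_cancel (g : GHat k)) U)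
    (twId p E g U) (twId_hom p E g U) x).trans ?_
  simp only [mul_inv_cancel]
  exact F.tr_eq_self (U := (twist p E g).obj U) (twId p E g U ≫ twInv p E g U)
    (Category.comp_id (𝟙 U.obj.left)) _ x

/-- Coordinates of a section of a coinduced sheaf. -/
def coord (g : Γ) : coindSec Γ F.sheaf U →+ F.sec U :=
  AddMonoidHom.mk' (fun f => F.tr g⁻¹ (twInv p E g U)
    (twInv_hom p E (inv_mul_cancel (g : GHat k)) U) (f g)) fun f f' => map_add _ (f g) (f' g)

lemma tr_coord (f : coindSec Γ F.sheaf U) (g : Γ) :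
    F.tr g (twId p E g U) (twId_hom p E g U) (coord F g f) = f g :=
  F.tr_tr_inv g (f g)

/-- The section of a coinduced sheaf with given coordinates. -/
def ofCoord (y : Γ → F.sec U) : coindSec Γ F.sheaf U := fun g =>
  F.tr g (twId p E g U) (twId_hom p E g U) (y g)

lemma coord_ofCoord (y : Γ → F.sec U) (g : Γ) : coord F g (ofCoord F y) = y g :=
  F.tr_inv_tr g (y g)

variable {F} in
lemma coord_ext {f f' : coindSec Γ F.sheaf U} (h : ∀ g, coord F g f = coord F g f') : f = f' :=
  funext fun g => by rw [← tr_coord F f, ← tr_coord F f', h]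

/-- Since g⁻¹c⁻¹ = (cg)⁻¹, in coordinates the shift only replaces g by cg. Shift − 1 becomes a
difference operator. -/
lemma coord_shift (c : Γ) (f : coindSec Γ F.sheaf U) (g : Γ) :
    coord F g (ap (shift le_rfl c F).hom.hom U f) = coord F (c * g) f := by
  have key : ∀ (d : Γ) (_ : d = c * g) (H : ((c⁻¹ : Γ) : GHat k) * (d : GHat k) = g),
      F.tr g⁻¹ (twInv p E g U) (twInv_hom p E (inv_mul_cancel (g : GHat k)) U)
        (F.tr c⁻¹ (twCh p E g d U) (twCh_hom p E H U) (f d)) = coord F (c * g) f := by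
    rintro _ rfl H
    refine (F.tr_tr g⁻¹ c⁻¹ (twCh p E g (c * g : Γ) U) (twCh_hom p E H U) (twInv p E g U)
      (twInv_hom p E (inv_mul_cancel (g : GHat k)) U) (f (c * g))).trans ?_
    exact F.tr_congr (U := (twist p E (c * g : Γ)).obj U) (V := U) (mul_inv_rev c g).symm
      (show twInv p E g U ≫ twCh p E g (c * g : Γ) U = twInv p E (c * g : Γ) U from
        Category.comp_id (𝟙 U.obj.left)) _ (f (c * g))
  exact key _ rfl (shift_eq le_rfl c g)

lemma coord_one (f : coindSec Γ F.sheaf U) :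
    coord F 1 f = ap (coindEval Γ F.sheaf).hom U f := by
  refine (F.tr_congr inv_one rfl _ (f 1)).trans ?_
  exact F.tr_one (oneHom Γ U) (f 1)

end coord

variable {c : Γ}

lemma coord_shiftSubOne (F : EqSheaf p E Γ) (U : Ebar p E) (f : coindSec Γ F.sheaf U) (g : Γ) :
    coord F g (ap (shiftSubOne le_rfl c F).hom.hom U f) = coord F (c * g) f - coord F g f :=
  (map_sub (coord F g) (ap (shift le_rfl c F).hom.hom U f) f).trans
    (congrArg (· - coord F g f) (coord_shift F c f g))

variable (hc : Subgroup.zpowers c = ⊤)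

include hc in
-- The coordinates are invariant under translation by the generator c, hence constant, and the one
-- at 1 vanishes.
lemma eq_zero_of_shiftSubOne (F : EqSheaf p E Γ) (U : Ebar p E) (f : coindSec Γ F.sheaf U)
    (h1 : ap (coindEval Γ F.sheaf).hom U f = 0)
    (h : ap (shiftSubOne le_rfl c F).hom.hom U f = 0) : f = 0 := by
  rw [← coord_one] at h1
  have h2 : ∀ g, coord F (c * g) f = coord F g f := fun g => by
    have := coord_shiftSubOne (c := c) F U f g
    rw [h] at this
    exact (sub_eq_zero.1 (this.symm.trans (map_zero (coord F g))))
  have h3 : ∀ n : ℤ, coord F (c ^ n) f = 0 := fun n => by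
    induction n using Int.induction_on with
    | zero => rw [zpow_zero]; exact h1
    | succ n ih => rw [add_comm, zpow_add, zpow_one, h2, ih]
    | pred n ih => rw [← h2, ← ih, ← zpow_one_add]; congr 2; lia
  apply coord_ext
  intro g
  obtain ⟨n, rfl⟩ : ∃ n : ℤ, c ^ n = g := by
    have := Subgroup.mem_top g
    rwa [← hc, Subgroup.mem_zpowers_iff] at this
  exact (h3 n).trans (map_zero (coord F (c ^ n))).symm

include hc in
lemma exists_shiftSubOne (hc' : ¬ IsOfFinOrder c) (F : EqSheaf p E Γ) (U : Ebar p E)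
    (y : coindSec Γ F.sheaf U) : ∃ f : coindSec Γ F.sheaf U,
      ap (coindEval Γ F.sheaf).hom U f = 0 ∧ ap (shiftSubOne le_rfl c F).hom.hom U f = y := by
  obtain ⟨l, h1, h2, h3⟩ := exists_log hc hc'
  obtain ⟨a, ha, hab⟩ := exists_int_antidifference fun n : ℤ => coord F (c ^ n) y
  refine ⟨ofCoord F fun g => a (l g), ?_, ?_⟩
  · rw [← coord_one, coord_ofCoord, h1, ha]
  · apply coord_ext
    intro g
    rw [coord_shiftSubOne, coord_ofCoord, coord_ofCoord, h2, hab, h3, add_sub_cancel_left]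

include hc in
lemma shiftSubOne_inj (F : EqSheaf p E Γ) (U : Ebar p E) {f f' : coindSec Γ F.sheaf U}
    (h : ap (coindEval Γ F.sheaf).hom U f = ap (coindEval Γ F.sheaf).hom U f')
    (h' : ap (shiftSubOne le_rfl c F).hom.hom U f = ap (shiftSubOne le_rfl c F).hom.hom U f') :
    f = f' :=
  sub_eq_zero.1 (eq_zero_of_shiftSubOne hc F U (f - f')
    ((map_sub (ap (coindEval Γ F.sheaf).hom U) f f').trans (sub_eq_zero.2 h))
    ((map_sub (ap (shiftSubOne le_rfl c F).hom.hom U) f f').trans (sub_eq_zero.2 h')))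

include hc in
-- Solutions of the difference equation vanishing at 1 are unique, so they are automatically
-- additive and compatible with restriction and form a morphism of sheaves.
lemma exists_section (hc' : ¬ IsOfFinOrder c) (F : EqSheaf p E Γ) :
    ∃ s : coindSheaf Γ F.sheaf ⟶ coindSheaf Γ F.sheaf, s ≫ coindEval Γ F.sheaf = 0 ∧
      s ≫ (shiftSubOne le_rfl c F).hom = 𝟙 (coindSheaf Γ F.sheaf) := by
  choose s h1 h2 using fun U y => exists_shiftSubOne hc hc' F U y
  have hadd : ∀ U (y y' : coindSec Γ F.sheaf U), s U (y + y') = s U y + s U y' := fun U y y' =>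
    shiftSubOne_inj hc F U
      ((h1 U (y + y')).trans (((map_add (ap (coindEval Γ F.sheaf).hom U) (s U y) (s U y')).trans
        ((congrArg₂ (· + ·) (h1 U y) (h1 U y')).trans (add_zero 0))).symm))
      ((h2 U (y + y')).trans ((map_add (ap (shiftSubOne le_rfl c F).hom.hom U)
        (s U y) (s U y')).trans (congrArg₂ (· + ·) (h2 U y) (h2 U y'))).symm)
  have hres : ∀ U V (a : V ⟶ U) (y : coindSec Γ F.sheaf U),
      s V (res (coindSheaf Γ F.sheaf).obj a y) = res (coindSheaf Γ F.sheaf).obj a (s U y) :=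
    fun U V a y => shiftSubOne_inj hc F V
      ((h1 V _).trans ((ap_res (coindEval Γ F.sheaf).hom a (s U y)).trans
        ((congrArg (res F.sheaf.obj a) (h1 U y)).trans (map_zero (res F.sheaf.obj a)))).symm)
      ((h2 V _).trans ((ap_res (shiftSubOne le_rfl c F).hom.hom a (s U y)).trans
        (congrArg (res (coindSheaf Γ F.sheaf).obj a) (h2 U y))).symm)
  let t : coindSheaf Γ F.sheaf ⟶ coindSheaf Γ F.sheaf :=
    ⟨pshHom (P := (coindSheaf Γ F.sheaf).obj) (Q := (coindSheaf Γ F.sheaf).obj)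
      (fun U => AddMonoidHom.mk' (fun y : coindSec Γ F.sheaf U => s U y) (hadd U))
      fun {U V} a y => hres U V a y⟩
  exact ⟨t, Sheaf.hom_ext (psh_hom_ext fun U y => h1 U y),
    Sheaf.hom_ext (psh_hom_ext fun U y => h2 U y)⟩

include hc in
lemma shiftSubOne_hom_eq (F : EqSheaf p E Γ) {A : AbSheaf p E} {f f' : A ⟶ coindSheaf Γ F.sheaf}
    (h1 : f ≫ coindEval Γ F.sheaf = f' ≫ coindEval Γ F.sheaf)
    (h2 : f ≫ (shiftSubOne le_rfl c F).hom = f' ≫ (shiftSubOne le_rfl c F).hom) : f = f' :=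
  Sheaf.hom_ext (psh_hom_ext fun U x => shiftSubOne_inj hc F U
    (congrArg (fun t => ap t.hom U x) h1) (congrArg (fun t => ap t.hom U x) h2))

variable [Fintype k]

lemma coindLift_shiftSubOne (F : EqSheaf p E Γ) :
    coindLift Γ (𝟙 F.sheaf) ≫ shiftSubOne le_rfl c F = 0 :=
  (comp_shiftSubOne le_rfl c F (𝟙 F.sheaf)).2 (EqSheaf.conj_hom c (𝟙 F))

include hc in
/-- The unit sequence is split on underlying sheaves. -/
lemma splitSeq_unit (hc' : ¬ IsOfFinOrder c) (F : EqSheaf p E Γ) :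
    SplitSeq (coindLift Γ (𝟙 F.sheaf)).hom (shiftSubOne le_rfl c F).hom := by
  obtain ⟨s, h1, h2⟩ := exists_section hc hc' F
  have h3 : (coindLift Γ (𝟙 F.sheaf)).hom ≫ (shiftSubOne le_rfl c F).hom = 0 :=
    congrArg EqSheaf.Hom.hom (coindLift_shiftSubOne (c := c) F)
  have h4 : (coindLift Γ (𝟙 F.sheaf)).hom ≫ coindEval Γ F.sheaf = 𝟙 _ := coindLift_eval Γ _
  exact splitSeq_of_joint (coindLift Γ (𝟙 F.sheaf)).hom (shiftSubOne le_rfl c F).hom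
    (coindEval Γ F.sheaf) s h3 h4 h1 h2 fun f f' => shiftSubOne_hom_eq hc F

include hc in
/-- The unit sequence of a coinduced sheaf is split. -/
lemma splitSeq_unit_of_retraction (hc' : ¬ IsOfFinOrder c) (F : EqSheaf p E Γ)
    (r : coindObj Γ F.sheaf ⟶ F) (hr : coindLift Γ (𝟙 F.sheaf) ≫ r = 𝟙 F) :
    SplitSeq (coindLift Γ (𝟙 F.sheaf)) (shiftSubOne le_rfl c F) := by
  obtain ⟨r₀, s, h1, h2, h3⟩ := splitSeq_unit hc hc' F
  set i := coindLift Γ (𝟙 F.sheaf)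
  set d := shiftSubOne le_rfl c F
  have hr' : i.hom ≫ r.hom = 𝟙 _ := congrArg EqSheaf.Hom.hom hr
  have hid : i.hom ≫ d.hom = 0 := congrArg EqSheaf.Hom.hom (coindLift_shiftSubOne (c := c) F)
  have h4 : d.hom ≫ s = 𝟙 _ - r₀ ≫ i.hom := by rw [← h3]; abel
  -- The section is corrected to the one complementary to the equivariant retraction `r`, so that
  -- `d` followed by `t` is 1 − ri, a morphism compatible with the action.
  let t := s - s ≫ r.hom ≫ i.hom
  have ht : d.hom ≫ t = (𝟙 _ - r ≫ i : coindObj Γ F.sheaf ⟶ coindObj Γ F.sheaf).hom := by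
    change d.hom ≫ (s - s ≫ r.hom ≫ i.hom) = 𝟙 _ - r.hom ≫ i.hom
    rw [Preadditive.comp_sub, ← Category.assoc d.hom, h4, Preadditive.sub_comp, Category.assoc,
      reassoc_of% hr', Category.id_comp, sub_sub, add_sub_cancel]
  have ht' : t ≫ d.hom = 𝟙 _ := by
    change (s - s ≫ r.hom ≫ i.hom) ≫ d.hom = 𝟙 _
    rw [Preadditive.sub_comp, h2, Category.assoc, Category.assoc, hid, comp_zero, comp_zero,
      sub_zero]
  -- `d` is a split epimorphism on underlying sheaves. As both `d` and `d` followed by `t` commute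
  -- with the action, so does `t`.
  have hcomm : ∀ g : Γ, (coindObj Γ F.sheaf).σ g ≫ (pull p E g).map t =
      t ≫ (coindObj Γ F.sheaf).σ g := fun g => by
    have h5 : s ≫ d.hom ≫ (coindObj Γ F.sheaf).σ g ≫ (pull p E g).map t =
        s ≫ d.hom ≫ t ≫ (coindObj Γ F.sheaf).σ g := by
      rw [← Category.assoc d.hom, ← d.comm, Category.assoc, ← Functor.map_comp, ht,
        EqSheaf.Hom.comm, ← ht, Category.assoc]
    have h6 : ∀ {B : AbSheaf p E} (w : (coindObj Γ F.sheaf).sheaf ⟶ B), s ≫ d.hom ≫ w = w :=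
      fun w => by rw [← Category.assoc, h2]; exact Category.id_comp w
    rwa [h6, h6] at h5
  refine ⟨r, ⟨t, hcomm⟩, hr, EqSheaf.hom_ext ht', ?_⟩
  have h7 : d ≫ (⟨t, hcomm⟩ : coindObj Γ F.sheaf ⟶ coindObj Γ F.sheaf) = 𝟙 _ - r ≫ i :=
    EqSheaf.hom_ext ht
  rw [h7, add_sub_cancel]

lemma coindLift_map_eval (A : AbSheaf p E) : coindLift Γ (𝟙 (coindObj Γ A).sheaf) ≫
    (coind p E Γ).map (coindEval Γ A) = 𝟙 (coindObj Γ A) :=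
  (coindAdj p E Γ).right_triangle_components A

end unitSequence

/-! ### The Weil group is infinite. -/

section weil

variable (k : Type u) [Field k] [Fintype k]

/-- If the n-th power of Frobenius were trivial, with n > 0 and q the order of k, every element of
k̄ would be a root of x^(q^n) − x, but k̄ is infinite. -/
lemma not_isOfFinOrder_weilGen : ¬ IsOfFinOrder (weilGen k) := by
  rw [isOfFinOrder_iff_pow_eq_one]
  rintro ⟨n, hn, h⟩
  have h1 : frobenius k ^ n = 1 := congrArg Subtype.val h
  have h2 : ∀ x : AlgebraicClosure k, x ^ Fintype.card k ^ n = x := fun x => by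
    have h3 := congrArg (fun g : GHat k => g x) h1
    have h4 := congrFun (FiniteField.coe_frobeniusAlgEquivOfAlgebraic_iterate k
      (AlgebraicClosure k) n) x
    rw [← h4]
    refine Eq.trans ?_ h3
    rw [AlgEquiv.coe_pow]
    rfl
  have hq : 1 < Fintype.card k ^ n := Nat.one_lt_pow hn.ne' Fintype.one_lt_card
  have := FiniteField.X_pow_card_sub_X_ne_zero (AlgebraicClosure k) hq
  classical
  have hfin : (Set.univ : Set (AlgebraicClosure k)).Finite := by
    refine (((Polynomial.X ^ (Fintype.card k ^ n) - Polynomial.X :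
      Polynomial (AlgebraicClosure k)).roots.toFinset.finite_toSet).subset fun x _ => ?_)
    simp [this, h2 x]
  exact Set.infinite_univ hfin

end weil
end WeilEtale
end

noncomputable section
namespace WeilEtale

/-! ### The derived functor of `gammaLower` exists and is computed by the resolution. -/

section rgamma

variable {k : Type u} [Field k] {X : Scheme.{u}} {p : X ⟶ Spec (.of k)} {E : ObjectProperty (Over X)}

instance (Γ : Subgroup (GHat k)) : (coind p E Γ).Additive := (coindAdj p E Γ).right_adjoint_additive

instance (Γ : Subgroup (GHat k)) : HasBinaryBiproducts (EqSheaf p E Γ) :=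
  HasBinaryBiproducts.of_hasBinaryCoproducts

variable [Fintype k]

variable (p E)

/-- The monad of the adjunction between forgetting the action of the Weil group and coinduction. -/
abbrev coindMonad : TG p E ⥤ TG p E := underlying p E ⋙ coind p E (weilGroup k)

/-- The unit of the adjunction. -/
def coindUnit : 𝟭 (TG p E) ⟶ coindMonad p E := (coindAdj p E (weilGroup k)).unit

/-- The shift by Frobenius minus the identity, as a natural transformation. -/
def shiftDiff : coindMonad p E ⟶ coindMonad p E where
  app F := shiftSubOne le_rfl (weilGen k) F
  naturality F F' α := by
    have h := shift_naturality (Δ := weilGroup k) le_rfl (weilGen k) α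
    have key : ∀ a : coindObj (weilGroup k) F.sheaf ⟶ coindObj (weilGroup k) F'.sheaf,
        a ≫ shift le_rfl (weilGen k) F' = shift le_rfl (weilGen k) F ≫ a →
        a ≫ (shift le_rfl (weilGen k) F' - 𝟙 _) = (shift le_rfl (weilGen k) F - 𝟙 _) ≫ a := by
      intro a ha
      rw [Preadditive.comp_sub, Preadditive.sub_comp, ha, Category.comp_id, Category.id_comp]
    exact key _ h

lemma coindUnit_shiftDiff : coindUnit p E ≫ shiftDiff p E = 0 := by
  ext F : 2
  exact coindLift_shiftSubOne F

lemma splitSeq_underlying (F : TG p E) : SplitSeq ((underlying p E).map ((coindUnit p E).app F))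
    ((underlying p E).map ((shiftDiff p E).app F)) :=
  splitSeq_unit zpowers_weilGen (not_isOfFinOrder_weilGen k) F

lemma splitSeq_coindMonad (F : TG p E) : SplitSeq ((coindUnit p E).app ((coindMonad p E).obj F))
    ((shiftDiff p E).app ((coindMonad p E).obj F)) :=
  splitSeq_unit_of_retraction zpowers_weilGen (not_isOfFinOrder_weilGen k) _
    ((coind p E (weilGroup k)).map (coindEval (weilGroup k) F.sheaf))
    (coindLift_map_eval F.sheaf)

variable {p E}

variable (hE : IsAdmissible p E) [(gammaUpper p E).IsLeftAdjoint]

include hE in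
-- γ_* of a coinduced sheaf is the smooth coinduced sheaf of the underlying sheaf, and smooth
-- coinduction is exact.
lemma qisOf_coindMonad {K L : CochainComplex (TG p E) ℤ} (f : K ⟶ L)
    (hf : qisOf (underlying p E) f) :
    qisOf (coindMonad p E ⋙ gammaLower p E ⋙ underlyingHat p E) f := by
  let e : coindMonad p E ⋙ gammaLower p E ⋙ underlyingHat p E ≅
      underlying p E ⋙ coindHat hE ⋙ underlyingHat p E :=
    Functor.isoWhiskerLeft (underlying p E)
      (Functor.isoWhiskerRight (coindHatIso hE).symm (underlyingHat p E))
  have hf' : QuasiIso (((underlying p E).mapHomologicalComplex (ComplexShape.up ℤ)).map f) := hf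
  have := preservesHomology_coindHat hE
  have h1 : QuasiIso (((coindHat hE ⋙ underlyingHat p E).mapHomologicalComplex
    (ComplexShape.up ℤ)).map
      (((underlying p E).mapHomologicalComplex (ComplexShape.up ℤ)).map f)) := inferInstance
  refine ((HomologicalComplex.quasiIso (AbSheaf p E) (ComplexShape.up ℤ)).arrow_mk_iso_iff
    (Arrow.isoMk ((NatIso.mapHomologicalComplex e (ComplexShape.up ℤ)).app K)
      ((NatIso.mapHomologicalComplex e (ComplexShape.up ℤ)).app L) ?_)).2 h1
  exact ((NatIso.mapHomologicalComplex e (ComplexShape.up ℤ)).hom.naturality f).symm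

include hE in
lemma hasRightDerivedFunctor_gammaLower :
    (gammaLowerComplex p E).HasRightDerivedFunctor (qisG p E) :=
  hasRightDerivedFunctor_cplxQ (coindUnit p E) (shiftDiff p E) (coindUnit_shiftDiff p E)
    (underlying p E) (gammaLower p E) (underlyingHat p E) (splitSeq_underlying p E)
    (fun _ _ f hf => qisOf_coindMonad hE f hf) (splitSeq_coindMonad p E)

include hE in
lemma nonempty_RGamma_iso [(gammaLowerComplex p E).HasRightDerivedFunctor (qisG p E)]
    (K : CochainComplex (TG p E) ℤ) :
    Nonempty ((QHat p E).obj (((gammaLower p E).mapHomologicalComplex (ComplexShape.up ℤ)).obj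
      ((resolution (shiftDiff p E)).obj K)) ≅ (RGamma p E).obj ((QG p E).obj K)) :=
  have : (cplxQ (gammaLower p E) (underlyingHat p E)).HasRightDerivedFunctor
    (qisOf (underlying p E)) := hasRightDerivedFunctor_gammaLower hE
  nonempty_totalRightDerived_iso (coindUnit p E) (shiftDiff p E) (coindUnit_shiftDiff p E)
    (underlying p E) (gammaLower p E) (underlyingHat p E) (splitSeq_underlying p E)
    (fun _ _ f hf => qisOf_coindMonad hE f hf) (splitSeq_coindMonad p E) K

end rgamma
end WeilEtale
end

noncomputable section
namespace WeilEtale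
-- Sections of the constant sheaf of integers.
section constant

variable {k : Type u} [Field k] {X : Scheme.{u}} {p : X ⟶ Spec (.of k)} {E : ObjectProperty (Over X)}

lemma nonempty_ebar (U : Ebar p E) : Nonempty U.obj.left := by
  obtain ⟨Y, -, i, -, y, hy⟩ := U.property
  obtain ⟨x, -⟩ : y ∈ Set.range i.left := hy ▸ mem_connectedComponent
  exact ⟨x⟩

lemma preconnectedSpace_ebar (U : Ebar p E) : PreconnectedSpace U.obj.left := by
  obtain ⟨Y, -, i, hi, y, hy⟩ := U.property
  have h1 : Topology.IsInducing i.left := i.left.isOpenEmbedding.isInducing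
  refine ⟨h1.isPreconnected_image.1 ?_⟩
  rw [Set.image_univ, hy]
  exact isPreconnected_connectedComponent

variable (p E) in
/-- The constant presheaf `ℤ`. -/
abbrev constPsh : (Ebar p E)ᵒᵖ ⥤ AddCommGrpCat.{u + 1} :=
  (Functor.const _).obj (AddCommGrpCat.of (ULift.{u + 1} ℤ))

variable [PerfectField k] (hE : IsAdmissible p E)
include hE

/-- A compatible family of integers on a cover defines a locally constant function on U. Objects of
`Ē` are connected and non-empty, so it is constant and no sheafification is needed. -/
lemma isSheaf_constPsh : Presheaf.IsSheaf (etaleTopology p E) (constPsh p E) := by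
  rw [isSheaf_iff_existsUnique]
  intro U S hS x hx
  have hx' : ∀ (V W : Ebar p E) (f : V ⟶ U) (hf : S f) (g : W ⟶ V),
      (x V f hf : ULift.{u + 1} ℤ) = x W (g ≫ f) (S.downward_closed hf g) := hx
  -- Two members of the cover whose images share a point have a common refinement by a non-empty
  -- object, on which the two integers are both the value of the family.
  have key : ∀ (V W : Ebar p E) (f : V ⟶ U) (hf : S f) (j : W ⟶ U) (hj : S j), Etale j.hom.left →
      ∀ v w, f.hom.left v = j.hom.left w → (x V f hf : ULift.{u + 1} ℤ) = x W j hj := by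
    intro V W f hf j hj hj' v w h
    obtain ⟨T, a, b, -, -, hab⟩ := exists_refinement hE f j hj' v ⟨w, h.symm⟩
    refine (hx' V T f hf a).trans (Eq.trans ?_ (hx' W T j hj b).symm)
    simp only [hab]
  have cov : ∀ u : U.obj.left, ∃ (W : Ebar p E) (j : W ⟶ U), Etale j.hom.left ∧
      u ∈ Set.range j.hom.left ∧ S j := by
    intro u
    obtain ⟨W, j, h1, h2, h3⟩ := hS (𝟙 U) u
    exact ⟨W, j, h1, h2, by simpa using h3⟩
  choose W j hj hu hS' using cov
  let c : U.obj.left → ULift.{u + 1} ℤ := fun u => x (W u) (j u) (hS' u)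
  have hc : IsLocallyConstant c := by
    rw [IsLocallyConstant.iff_exists_open]
    intro u
    have := hj u
    refine ⟨Set.range (j u).hom.left, (j u).hom.left.isOpenMap.isOpen_range, hu u, ?_⟩
    rintro v ⟨w, hw⟩
    obtain ⟨w', hw'⟩ := hu v
    exact key _ _ _ _ _ _ (hj u) w' w (hw'.trans hw.symm)
  have := preconnectedSpace_ebar U
  obtain ⟨u₀⟩ := nonempty_ebar U
  have hx0 : ∀ (V : Ebar p E) (f : V ⟶ U) (hf : S f), c u₀ = x V f hf := by
    intro V f hf
    obtain ⟨v⟩ := nonempty_ebar V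
    obtain ⟨w, hw⟩ := hu (f.hom.left v)
    refine (hc.apply_eq_of_preconnectedSpace u₀ (f.hom.left v)).trans ?_
    exact (key V _ f hf _ (hS' _) (hj _) v w hw.symm).symm
  refine ⟨c u₀, fun V f hf => hx0 V f hf, fun t ht => ?_⟩
  exact (ht _ (j u₀) (hS' u₀)).trans (hx0 _ _ _).symm

/-- The sections of the constant sheaf `ℤ`. -/
def constEquiv (Γ : Subgroup (GHat k)) (U : Ebar p E) :
    ULift.{u + 1} ℤ ≃+ (EqSheaf.constInt p E Γ).sec U :=
  have : IsIso (toSheafify (etaleTopology p E) (constPsh p E)) :=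
    isIso_toSheafify _ (isSheaf_constPsh hE)
  ((asIso (toSheafify (etaleTopology p E) (constPsh p E))).app (op U)).addCommGroupIsoToAddEquiv

lemma tr_constEquiv (Γ : Subgroup (GHat k)) (g : Γ) {U V : Ebar p E}
    (a : V.obj.left ⟶ U.obj.left) (h : a ≫ U.obj.hom ≫ act p g = V.obj.hom) (n : ULift.{u + 1} ℤ) :
    (EqSheaf.constInt p E Γ).tr g a h (constEquiv hE Γ U n) = constEquiv hE Γ V n := by
  have h1 : toSheafify (etaleTopology p E) (constPsh p E) ≫ ((EqSheaf.constInt p E Γ).σ g).hom =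
      𝟙 (constPsh p E) ≫ Functor.whiskerLeft (twist p E g).op
        (toSheafify (etaleTopology p E) (constPsh p E)) := toSheafify_sheafifyLift _ _ _
  have h2 : ap ((EqSheaf.constInt p E Γ).σ g).hom U (constEquiv hE Γ U n) =
      constEquiv hE Γ ((twist p E g).obj U) n := congrArg (fun t => ap t U n) h1
  refine (congrArg _ h2).trans ?_
  exact (ap_res (toSheafify (etaleTopology p E) (constPsh p E))
    (homMk a h : V ⟶ (twist p E g).obj U) n).symm

lemma res_constEquiv (Γ : Subgroup (GHat k)) {U V : Ebar p E} (f : V ⟶ U) (n : ULift.{u + 1} ℤ) :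
    res (EqSheaf.constInt p E Γ).sheaf.obj f (constEquiv hE Γ U n) = constEquiv hE Γ V n :=
  (ap_res (toSheafify (etaleTopology p E) (constPsh p E)) f n).symm

end constant
end WeilEtale
end

noncomputable section
namespace WeilEtale
-- Locally constant functions on a compact space as a tensor product.
section locallyConstantTensor
open scoped TensorProduct Classical

variable {X T A : Type*} [AddCommGroup T] [AddCommGroup A]
  (c : T →+ (X → ℤ))

/-- The map `T ⊗ A → (X → A)` determined by a map from `T` to integral functions on `X`. -/
def funTensor : T ⊗[ℤ] A →+ (X → A) :=
  TensorProduct.liftAddHom (AddMonoidHom.mk' (fun θ => AddMonoidHom.mk' (fun a x => c θ x • a)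
      fun a a' => funext fun x => smul_add _ _ _)
    fun θ θ' => AddMonoidHom.ext fun a => funext fun x => by
      simp [add_smul]) fun n θ a => funext fun x => by
      simp [mul_smul, smul_comm n]

lemma funTensor_tmul (θ : T) (a : A) (x : X) : funTensor c (θ ⊗ₜ[ℤ] a) x = c θ x • a := rfl

variable {c} [TopologicalSpace X]

lemma isLocallyConstant_funTensor (hc : ∀ θ, IsLocallyConstant (c θ)) (t : T ⊗[ℤ] A) :
    IsLocallyConstant (funTensor c t) := by
  induction t using TensorProduct.induction_on with
  | zero => rw [map_zero]; exact IsLocallyConstant.const 0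
  | tmul θ a => exact (hc θ).comp (fun n : ℤ => n • a)
  | add t t' h h' => rw [map_add]; exact h.add h'

variable (hc : ∀ f : X → ℤ, IsLocallyConstant f → ∃ θ, c θ = f)
include hc

lemma exists_indicators {J : Type*} (π : X → J) (hπ : IsLocallyConstant π) :
    ∃ θ : J → T, ∀ j x, c (θ j) x = if π x = j then 1 else 0 := by
  have h : ∀ j, ∃ θ, c θ = fun x => if π x = j then 1 else 0 := fun j =>
    hc _ (hπ.comp fun i => if i = j then (1 : ℤ) else 0)
  choose θ hθ using h
  exact ⟨θ, fun j x => congrFun (hθ j) x⟩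

/-- A locally constant function on a compact space has finitely many values, so it is a finite sum
of indicator functions times values. -/
lemma exists_funTensor_eq [CompactSpace X] (y : X → A) (hy : IsLocallyConstant y) :
    ∃ t, funTensor c t = y := by
  have : Finite (Set.range y) := hy.range_finite
  have := Fintype.ofFinite (Set.range y)
  obtain ⟨θ, hθ⟩ := exists_indicators hc y hy
  refine ⟨∑ j : Set.range y, θ j ⊗ₜ[ℤ] (j : A), funext fun x => ?_⟩
  rw [map_sum, Finset.sum_apply, Finset.sum_eq_single ⟨y x, x, rfl⟩]
  · simp [funTensor_tmul, hθ]
  · rintro ⟨j, hj⟩ - h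
    rw [funTensor_tmul, hθ, if_neg, zero_smul]
    rintro rfl
    exact h rfl
  · simp

/-- Normal form: every tensor is a sum over the blocks of one finite locally constant partition of
X. Adding two tensors requires the common refinement of their partitions, where each old indicator
is a sum of new ones. -/
lemma exists_eq_sum_indicators [CompactSpace X] (hc' : ∀ θ, IsLocallyConstant (c θ))
    (hi : Function.Injective c) (t : T ⊗[ℤ] A) :
    ∃ (J : Type) (_ : Fintype J) (π : X → J) (b : J → A) (θ : J → T), IsLocallyConstant π ∧
      (∀ j x, c (θ j) x = if π x = j then 1 else 0) ∧ t = ∑ j, θ j ⊗ₜ[ℤ] b j := by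
  induction t using TensorProduct.induction_on with
  | zero => exact ⟨Unit, inferInstance, fun _ => (), 0, fun _ => (hc 1
      (IsLocallyConstant.const 1)).choose, IsLocallyConstant.const _, fun j x => by
        simp [(hc 1 (IsLocallyConstant.const 1)).choose_spec], by simp⟩
  | tmul θ a =>
    have : Finite (Set.range (c θ)) := (hc' θ).range_finite
    have := Fintype.ofFinite (Set.range (c θ))
    have hπ : IsLocallyConstant (Set.rangeFactorization (c θ)) := by
      rw [IsLocallyConstant.iff_exists_open]
      intro x
      obtain ⟨V, h1, h2, h3⟩ := (IsLocallyConstant.iff_exists_open _).1 (hc' θ) x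
      exact ⟨V, h1, h2, fun y hy => Subtype.ext (h3 y hy)⟩
    obtain ⟨η, hη⟩ := exists_indicators hc _ hπ
    refine ⟨Set.range (c θ), inferInstance, Set.rangeFactorization (c θ), fun j => (j : ℤ) • a, η,
      hπ, hη, ?_⟩
    have h1 : θ = ∑ j : Set.range (c θ), (j : ℤ) • η j := hi <| funext fun x => by
      rw [map_sum, Finset.sum_apply, Finset.sum_eq_single (Set.rangeFactorization (c θ) x)]
      · simp [hη]
      · intro j _ h
        simp [hη, h.symm]
      · simp
    conv_lhs => rw [h1, TensorProduct.sum_tmul]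
    exact Finset.sum_congr rfl fun j _ => TensorProduct.smul_tmul _ _ _
  | add t t' h h' =>
    obtain ⟨J, _, π, b, θ, hπ, hθ, rfl⟩ := h
    obtain ⟨J', _, π', b', θ', hπ', hθ', rfl⟩ := h'
    have hππ : IsLocallyConstant fun x => (π x, π' x) := hπ.prodMk hπ'
    obtain ⟨η, hη⟩ := exists_indicators hc _ hππ
    refine ⟨J × J', inferInstance, fun x => (π x, π' x), fun j => b j.1 + b' j.2, η, hππ, hη, ?_⟩
    have h1 : ∀ j, θ j = ∑ j', η (j, j') := fun j => hi <| funext fun x => by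
      rw [map_sum, Finset.sum_apply, hθ]
      by_cases h : π x = j <;> simp [hη, h]
    have h2 : ∀ j', θ' j' = ∑ j, η (j, j') := fun j' => hi <| funext fun x => by
      rw [map_sum, Finset.sum_apply, hθ']
      by_cases h : π' x = j' <;> simp [hη, h]
    simp only [TensorProduct.tmul_add, Finset.sum_add_distrib]
    congr 1
    · rw [Fintype.sum_prod_type]
      exact Finset.sum_congr rfl fun j _ => by rw [h1, TensorProduct.sum_tmul]
    · rw [Fintype.sum_prod_type_right]
      exact Finset.sum_congr rfl fun j _ => by rw [h2, TensorProduct.sum_tmul]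

/-- In normal form, evaluation at a point of a block isolates the coefficient of that block. Empty
blocks have zero indicator. -/
lemma funTensor_injective [CompactSpace X] (hc' : ∀ θ, IsLocallyConstant (c θ))
    (hi : Function.Injective c) : Function.Injective (funTensor (A := A) c) := by
  rw [injective_iff_map_eq_zero]
  intro t ht
  obtain ⟨J, _, π, b, θ, hπ, hθ, rfl⟩ := exists_eq_sum_indicators hc hc' hi t
  refine Finset.sum_eq_zero fun j _ => ?_
  by_cases hj : ∃ x, π x = j
  · obtain ⟨x, rfl⟩ := hj
    have h1 := congrFun ht x
    rw [map_sum, Finset.sum_apply, Finset.sum_eq_single (π x)] at h1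
    · rw [funTensor_tmul, hθ, if_pos rfl, one_smul] at h1
      rw [h1]
      exact TensorProduct.tmul_zero _ _
    · intro j _ h
      rw [funTensor_tmul, hθ, if_neg h.symm, zero_smul]
    · simp
  · have h1 : θ j = 0 := hi <| funext fun x => by
      rw [hθ, if_neg fun h => hj ⟨x, h⟩, map_zero]
      rfl
    rw [h1, TensorProduct.zero_tmul]

end locallyConstantTensor
end WeilEtale
end

noncomputable section
namespace WeilEtale
open scoped Topology
-- Smooth coinduced sections are locally constant functions on the Galois group.
section smoothCoord

/-- On a compact group a locally constant function is uniformly so: one neighbourhood of 1 serves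
all g. -/
lemma eventually_forall_mul_of_isLocallyConstant {G α : Type*} [Group G] [TopologicalSpace G]
    [IsTopologicalGroup G] [CompactSpace G] {y : G → α} (hy : IsLocallyConstant y) :
    ∀ᶠ h in 𝓝 (1 : G), ∀ g, y (g * h) = y g := by
  have h1 : ∀ g ∈ (Set.univ : Set G), ∀ᶠ z : G × G in 𝓝 (1, g), y (z.2 * z.1) = y z.2 := by
    intro g _
    have h2 : Filter.Tendsto (fun z : G × G => z.2 * z.1) (𝓝 (1, g)) (𝓝 g) := by
      have h3 : Continuous fun z : G × G => z.2 * z.1 := by fun_prop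
      simpa using h3.tendsto (1, g)
    have h4 : Filter.Tendsto (fun z : G × G => z.2) (𝓝 (1, g)) (𝓝 g) :=
      continuous_snd.tendsto (1, g)
    filter_upwards [h2.eventually (hy.eventually_eq g), h4.eventually (hy.eventually_eq g)]
      with z h h'
    rw [h, h']
  filter_upwards [isCompact_univ.eventually_forall_of_forall_eventually
    (P := fun h g => y (g * h) = y g) h1] with h hh g
  exact hh g (Set.mem_univ g)

variable {k : Type u} [Field k] {X : Scheme.{u}} {p : X ⟶ Spec (.of k)} {E : ObjectProperty (Over X)}

lemma coord_tr {Γ : Subgroup (GHat k)} (F : EqSheaf p E Γ) (h : Γ) {U V : Ebar p E}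
    (a : V.obj.left ⟶ U.obj.left) (ha : a ≫ U.obj.hom ≫ act p h = V.obj.hom)
    (f : coindSec Γ F.sheaf U) (g : Γ) :
    coord F g ((coindObj Γ F.sheaf).tr h a ha f) = F.tr h a ha (coord F (g * h) f) := by
  refine (congrArg (F.tr g⁻¹ (twInv p E g V) (twInv_hom p E (inv_mul_cancel (g : GHat k)) V))
    (coind_tr Γ F.sheaf h a ha f g)).trans ?_
  refine (F.tr_res g⁻¹ (twInv p E g V) (twInv_hom p E (inv_mul_cancel (g : GHat k)) V)
    (twistHom p E g h a ha) (f (g * h))).trans ?_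
  refine Eq.trans ?_ (F.tr_tr h (g * h)⁻¹ (twInv p E (g * h : Γ) U)
    (twInv_hom p E (inv_mul_cancel ((g * h : Γ) : GHat k)) U) a ha (f (g * h))).symm
  exact F.tr_congr (U := (twist p E (g * h : Γ)).obj U) (V := V)
    (show g⁻¹ = h * (g * h)⁻¹ by rw [mul_inv_rev, mul_inv_cancel_left])
    (show twInv p E g V ≫ (twistHom p E g h a ha).hom.left = a ≫ twInv p E (g * h : Γ) U from
      (Category.id_comp a).trans (Category.comp_id a).symm) _ (f (g * h))

lemma coord_res {Γ : Subgroup (GHat k)} (F : EqSheaf p E Γ) {U V : Ebar p E} (a : V ⟶ U)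
    (f : coindSec Γ F.sheaf U) (g : Γ) :
    coord F g (res (coindSheaf Γ F.sheaf).obj a f : coindSec Γ F.sheaf V) =
      res F.sheaf.obj a (coord F g f) :=
  F.tr_res_eq g⁻¹ (twInv p E g V) (twInv_hom p E (inv_mul_cancel (g : GHat k)) V)
    (twInv p E g U) (twInv_hom p E (inv_mul_cancel (g : GHat k)) U) ((twist p E g).map a) a
    (twInv_naturality p E g a) (f g)

variable [PerfectField k] (hE : IsAdmissible p E) (F : EqSheaf p E ⊤)
  (hF : ∀ (U : Ebar p E) (x : F.sec U), IsSmooth F x) {U : Ebar p E}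
include hE hF

/-- In coordinates (hf)(g) = h · f(gh). As sections of F are smooth, h near 1 acts trivially on any
given value, so invariance of f under such h is invariance of its coordinates under right
translation. The neighbourhood of 1 may depend on the value, which matters only in the converse. -/
lemma isSmooth_coind_iff_isLocallyConstant (f : coindSec ⊤ F.sheaf U) :
    IsSmooth (coindObj ⊤ F.sheaf) f ↔
      IsLocallyConstant fun g : GHat k => coord F (topElt g) f := by
  obtain ⟨M, -⟩ := exists_good_model hE U
  have key : ∀ (h : GHat k) (hh : h ∈ M.K.fixingSubgroup) (g : GHat k),
      coord F (topElt g) (coindConj F.sheaf M h hh f) = M.conjTr F h hh (coord F (topElt (g * h)) f) :=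
    fun h hh g => coord_tr F (topElt h) (U := U) (V := U) (M.conjMap ⟨h, hh⟩) (M.conjMap_act h hh) f
      (topElt g)
  have hs := fun g : GHat k => hF U (coord F (topElt g) f) M
  refine (isSmooth_iff_of_model (F := coindObj ⊤ F.sheaf) hE (x := f) M).trans ?_
  constructor
  · intro h
    rw [IsLocallyConstant.iff_eventually_eq]
    intro g
    have ht : Filter.Tendsto (fun g' : GHat k => g⁻¹ * g') (𝓝 g) (𝓝 1) := by
      simpa using (continuous_const_mul (g⁻¹ : GHat k)).tendsto g
    filter_upwards [ht.eventually h, ht.eventually M.eventually_mem,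
      ht.eventually (hs g)] with g' h1 h2 h3
    have h4 := key _ h2 g
    have h5 : coindConj F.sheaf M (g⁻¹ * g') h2 f = f := h1 h2
    rw [h5, ← h3 h2] at h4
    have h6 : Function.Injective (M.conjTr F (g⁻¹ * g') h2) := by
      refine Function.LeftInverse.injective (g := M.conjTr F (g⁻¹ * g')⁻¹ (inv_mem h2)) fun x => ?_
      rw [← M.conjTr_mul F, M.conjTr_congr F (inv_mul_cancel _), M.conjTr_one]
    have h7 := h6 h4
    rw [mul_inv_cancel_left] at h7
    exact h7.symm
  · intro h
    -- A locally constant function on the compact Galois group has finite range, so finitely many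
    -- open stabilizers are intersected.
    have hsu : ∀ᶠ h in 𝓝 (1 : GHat k), ∀ x ∈ Set.range (fun g : GHat k => coord F (topElt g) f),
        ∀ hh, M.conjTr F h hh x = x := by
      rw [Filter.eventually_all_finite h.range_finite]
      rintro _ ⟨g, rfl⟩
      exact hs g
    filter_upwards [eventually_forall_mul_of_isLocallyConstant h, hsu] with h h1 h2 hh
    refine coord_ext (f := coindConj F.sheaf M h hh f) fun g => ?_
    refine (key h hh g).trans ((congrArg _ (h1 g)).trans ?_)
    exact h2 _ ⟨g, rfl⟩ hh

end smoothCoord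
end WeilEtale
end

noncomputable section
namespace WeilEtale
open scoped Topology
-- Coordinates of smooth coinduced sections: functoriality, action, shift.
section smoothCoord

lemma funTensor_map {X X' T T' A A' : Type*} [AddCommGroup T] [AddCommGroup T'] [AddCommGroup A]
    [AddCommGroup A'] {c : T →+ (X → ℤ)} {c' : T' →+ (X' → ℤ)} (r : X' → X) (f : T →ₗ[ℤ] T')
    (f' : A →ₗ[ℤ] A') (h : ∀ θ x, c' (f θ) x = c θ (r x)) (t : TensorProduct ℤ T A) (x : X') :
    funTensor c' (TensorProduct.map f f' t) x = f' (funTensor c t (r x)) := by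
  induction t using TensorProduct.induction_on with
  | zero => simp
  | tmul θ a =>
    rw [TensorProduct.map_tmul, funTensor_tmul, funTensor_tmul, h, map_zsmul]
  | add t t' ht ht' =>
    rw [map_add, map_add, map_add, Pi.add_apply, Pi.add_apply, ht, ht', map_add]

variable {k : Type u} [Field k] {X : Scheme.{u}} {p : X ⟶ Spec (.of k)} {E : ObjectProperty (Over X)}
  [Fintype k] (hE : IsAdmissible p E) (F : EqSheaf p E ⊤) (U : Ebar p E)

/-- The coordinates of a smooth coinduced section. -/
def smoothCoord : ((coindHat hE).obj F.sheaf).obj.sec U →+ (GHat k → F.sec U) :=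
  AddMonoidHom.mk' (fun f g => coord F (topElt g) (ap (coindHatι hE F.sheaf).hom.hom U f))
    fun f f' => funext fun g => (congrArg (coord F (topElt g)) (map_add
      (ap (coindHatι hE F.sheaf).hom.hom U) f f')).trans (map_add (coord F (topElt g)) _ _)

lemma smoothCoord_injective : Function.Injective (smoothCoord hE F U) := fun _ _ h =>
  (smoothSub (coindObj ⊤ F.sheaf) hE).incl_injective U (coord_ext fun g => congrFun h g)

variable {U}

lemma smoothCoord_tr (h : (⊤ : Subgroup (GHat k))) {V : Ebar p E}
    (a : V.obj.left ⟶ U.obj.left) (ha : a ≫ U.obj.hom ≫ act p h = V.obj.hom)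
    (f : ((coindHat hE).obj F.sheaf).obj.sec U) (g : GHat k) :
    smoothCoord hE F V (((coindHat hE).obj F.sheaf).obj.tr h a ha f) g =
      F.tr h a ha (smoothCoord hE F U f (g * h)) :=
  (congrArg (coord F (topElt g)) (EqSheaf.tr_map (coindHatι hE F.sheaf) h a ha f)).trans
    (coord_tr F h a ha (ap (coindHatι hE F.sheaf).hom.hom U f) (topElt g))

lemma smoothCoord_res {V : Ebar p E} (a : V ⟶ U) (f : ((coindHat hE).obj F.sheaf).obj.sec U)
    (g : GHat k) : smoothCoord hE F V (res ((coindHat hE).obj F.sheaf).obj.sheaf.obj a f) g =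
      res F.sheaf.obj a (smoothCoord hE F U f g) :=
  (congrArg (coord F (topElt g)) (ap_res (coindHatι hE F.sheaf).hom.hom a f)).trans
    (coord_res F a (ap (coindHatι hE F.sheaf).hom.hom U f) (topElt g))

lemma smoothCoord_map {F F' : EqSheaf p E ⊤} (α : F ⟶ F')
    (f : ((coindHat hE).obj F.sheaf).obj.sec U) (g : GHat k) :
    smoothCoord hE F' U (ap ((coindHat hE).map α.hom).hom.hom.hom U f) g =
      ap α.hom.hom U (smoothCoord hE F U f g) :=
  (EqSheaf.tr_map α (topElt g)⁻¹ (twInv p E (topElt g) U)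
    (twInv_hom p E (inv_mul_cancel ((topElt g : (⊤ : Subgroup (GHat k))) : GHat k)) U)
    ((ap (coindHatι hE F.sheaf).hom.hom U f : coindSec ⊤ F.sheaf U) (topElt g))).symm

lemma smoothCoord_shift (f : ((coindHat hE).obj F.sheaf).obj.sec U) (g : GHat k) :
    smoothCoord hE F U (ap (shiftHat hE ((EqSheaf.restrict le_top).obj F)).hom.hom.hom U f) g =
      smoothCoord hE F U f (frobenius k * g) :=
  coord_shift F (topElt (frobenius k)) (ap (coindHatι hE F.sheaf).hom.hom U f) (topElt g)

variable (hF : ∀ (U : Ebar p E) (x : F.sec U), IsSmooth F x)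
include hF

lemma isLocallyConstant_smoothCoord (f : ((coindHat hE).obj F.sheaf).obj.sec U) :
    IsLocallyConstant (smoothCoord hE F U f) :=
  (isSmooth_coind_iff_isLocallyConstant hE F hF _).1
    (f : (smoothSub (coindObj ⊤ F.sheaf) hE).carrier U).2

lemma exists_smoothCoord_eq (y : GHat k → F.sec U) (hy : IsLocallyConstant y) :
    ∃ f, smoothCoord hE F U f = y := by
  have h1 : (fun g : GHat k => coord F (topElt g) (ofCoord F fun g => y g)) = y :=
    funext fun g => coord_ofCoord F (fun g => y g) (topElt g)
  exact ⟨(⟨ofCoord F fun g => y g, (isSmooth_coind_iff_isLocallyConstant hE F hF _).2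
    (h1.symm ▸ hy)⟩ : (smoothSub (coindObj ⊤ F.sheaf) hE).carrier U), h1⟩

end smoothCoord

/-! ### The sheaf coinduced from the integers. -/

section constant

variable {k : Type u} [Field k] {X : Scheme.{u}} {p : X ⟶ Spec (.of k)} {E : ObjectProperty (Over X)}
  [Fintype k] (hE : IsAdmissible p E) {U : Ebar p E}

include hE in
lemma isSmooth_constInt (x : (EqSheaf.constInt p E ⊤).sec U) :
    IsSmooth (EqSheaf.constInt p E ⊤) x := fun M => .of_forall fun h hh => by
  obtain ⟨n, rfl⟩ := (constEquiv hE ⊤ U).surjective x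
  exact tr_constEquiv hE ⊤ (topElt h) (M.conjMap ⟨h, hh⟩) (M.conjMap_act h hh) n

/-- The smooth coinduced sheaf of the constant sheaf `ℤ`. -/
abbrev coindInt : TGHat p E := (coindHat hE).obj (EqSheaf.constInt p E ⊤).sheaf

variable (U) in
/-- The coordinates of a section of the sheaf coinduced from `ℤ`, as integers. -/
def intCoord : (coindInt hE).obj.sec U →+ (GHat k → ℤ) :=
  AddMonoidHom.mk' (fun f g => ((constEquiv hE ⊤ U).symm
      (smoothCoord hE (EqSheaf.constInt p E ⊤) U f g)).down)
    fun f f' => funext fun g => by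
      rw [map_add]
      exact congrArg ULift.down (map_add (constEquiv hE ⊤ U).symm _ _)

variable (U) in
lemma intCoord_injective : Function.Injective (intCoord hE U) := fun _ _ h =>
  smoothCoord_injective hE _ U (funext fun g => (constEquiv hE ⊤ U).symm.injective
    (ULift.down_injective (congrFun h g)))

lemma isLocallyConstant_intCoord (θ : (coindInt hE).obj.sec U) :
    IsLocallyConstant (intCoord hE U θ) :=
  (isLocallyConstant_smoothCoord hE _ (fun _ x => isSmooth_constInt hE x) θ).comp
    fun x => ((constEquiv hE ⊤ U).symm x).down

lemma exists_intCoord_eq (f : GHat k → ℤ) (hf : IsLocallyConstant f) :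
    ∃ θ, intCoord hE U θ = f := by
  obtain ⟨θ, hθ⟩ := exists_smoothCoord_eq hE (EqSheaf.constInt p E ⊤)
    (fun _ x => isSmooth_constInt hE x) (fun g => constEquiv hE ⊤ U ⟨f g⟩)
    (hf.comp fun n => constEquiv hE ⊤ U ⟨n⟩)
  exact ⟨θ, funext fun g => by
    refine (congrArg (fun y => ((constEquiv hE ⊤ U).symm (y g)).down) hθ).trans ?_
    exact congrArg ULift.down ((constEquiv hE ⊤ U).symm_apply_apply ⟨f g⟩)⟩

lemma intCoord_tr (h : (⊤ : Subgroup (GHat k))) {V : Ebar p E}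
    (a : V.obj.left ⟶ U.obj.left) (ha : a ≫ U.obj.hom ≫ act p h = V.obj.hom)
    (θ : (coindInt hE).obj.sec U) (g : GHat k) :
    intCoord hE V ((coindInt hE).obj.tr h a ha θ) g = intCoord hE U θ (g * h) := by
  refine congrArg ULift.down ((constEquiv hE ⊤ V).symm_apply_eq.2 ?_)
  refine (smoothCoord_tr hE _ h a ha θ g).trans ?_
  obtain ⟨n, hn⟩ := (constEquiv hE ⊤ U).surjective
    (smoothCoord hE (EqSheaf.constInt p E ⊤) U θ (g * h))
  refine (congrArg _ hn.symm).trans ((tr_constEquiv hE ⊤ h a ha n).trans (congrArg _ ?_))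
  exact (constEquiv hE ⊤ U).eq_symm_apply.2 hn

lemma intCoord_res {V : Ebar p E} (a : V ⟶ U) (θ : (coindInt hE).obj.sec U) (g : GHat k) :
    intCoord hE V (res (coindInt hE).obj.sheaf.obj a θ) g = intCoord hE U θ g := by
  refine congrArg ULift.down ((constEquiv hE ⊤ V).symm_apply_eq.2 ?_)
  refine (smoothCoord_res hE _ a θ g).trans ?_
  obtain ⟨n, hn⟩ := (constEquiv hE ⊤ U).surjective
    (smoothCoord hE (EqSheaf.constInt p E ⊤) U θ g)
  refine (congrArg _ hn.symm).trans ((res_constEquiv hE ⊤ a n).trans (congrArg _ ?_))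
  exact (constEquiv hE ⊤ U).eq_symm_apply.2 hn

lemma intCoord_shift (θ : (coindInt hE).obj.sec U) (g : GHat k) :
    intCoord hE U (ap (shiftHat hE (EqSheaf.constInt p E (weilGroup k))).hom.hom.hom U θ) g =
      intCoord hE U θ (frobenius k * g) :=
  congrArg (fun x => ((constEquiv hE ⊤ U).symm x).down)
    (smoothCoord_shift hE (EqSheaf.constInt p E ⊤) θ g)

end constant
end WeilEtale
end

noncomputable section
namespace WeilEtale
-- Tensoring with the sheaf coinduced from the integers is smooth coinduction.
section tensorCoind

variable {k : Type u} [Field k] {X : Scheme.{u}} {p : X ⟶ Spec (.of k)} {E : ObjectProperty (Over X)}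

lemma EqSheaf.isIso_of_hom {Γ : Subgroup (GHat k)} {F F' : EqSheaf p E Γ} (f : F ⟶ F')
    [IsIso f.hom] : IsIso f := by
  refine ⟨⟨inv f.hom, fun g => ?_⟩, EqSheaf.hom_ext (IsIso.hom_inv_id f.hom),
    EqSheaf.hom_ext (IsIso.inv_hom_id f.hom)⟩
  rw [← cancel_epi f.hom, IsIso.hom_inv_id_assoc, ← Category.assoc, ← f.comm, Category.assoc,
    ← Functor.map_comp, IsIso.hom_inv_id, CategoryTheory.Functor.map_id,
    Category.comp_id]

lemma isIso_of_ap_bijective {C : Type (u + 1)} [Category.{u} C]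
    {P Q : Cᵒᵖ ⥤ AddCommGrpCat.{u + 1}} (α : P ⟶ Q) (h : ∀ U, Function.Bijective (ap α U)) :
    IsIso α := by
  have : ∀ U, IsIso (α.app U) := fun U => by
    rw [ConcreteCategory.isIso_iff_bijective]
    exact h U.unop
  exact NatIso.isIso_of_isIso_app α

variable [Fintype k] (hE : IsAdmissible p E) (F : TGHat p E)

lemma exists_tensorCoind {U : Ebar p E} (t : TensorProduct ℤ ((coindInt hE).obj.sec U) (F.obj.sec U)) :
    ∃ f, smoothCoord hE F.obj U f = funTensor (intCoord hE U) t :=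
  exists_smoothCoord_eq hE F.obj ((isContinuous_iff F.obj).1 F.property) _
    (isLocallyConstant_funTensor (isLocallyConstant_intCoord hE) t)

/-- The map from the tensor product with the sheaf coinduced from `ℤ` to the coinduced sheaf, on
sections. -/
def tensorCoindSec (U : Ebar p E) :
    TensorProduct ℤ ((coindInt hE).obj.sec U) (F.obj.sec U) →+
      ((coindHat hE).obj F.obj.sheaf).obj.sec U :=
  AddMonoidHom.mk' (fun t => (exists_tensorCoind hE F t).choose) fun t t' => by
    apply smoothCoord_injective hE F.obj U
    refine (exists_tensorCoind hE F (t + t')).choose_spec.trans ?_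
    rw [map_add, map_add, (exists_tensorCoind hE F t).choose_spec,
      (exists_tensorCoind hE F t').choose_spec]

lemma smoothCoord_tensorCoindSec {U : Ebar p E}
    (t : TensorProduct ℤ ((coindInt hE).obj.sec U) (F.obj.sec U)) :
    smoothCoord hE F.obj U (tensorCoindSec hE F U t) = funTensor (intCoord hE U) t :=
  (exists_tensorCoind hE F t).choose_spec

/-- In coordinates both sides are the locally constant functions from the compact Galois group to
F(U). -/
lemma tensorCoindSec_bijective (U : Ebar p E) : Function.Bijective (tensorCoindSec hE F U) := by
  constructor
  · intro t t' h
    apply funTensor_injective (exists_intCoord_eq hE) (isLocallyConstant_intCoord hE)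
      (intCoord_injective hE U)
    rw [← smoothCoord_tensorCoindSec, ← smoothCoord_tensorCoindSec, h]
  · intro f
    obtain ⟨t, ht⟩ := exists_funTensor_eq (exists_intCoord_eq hE) _
      (isLocallyConstant_smoothCoord hE F.obj ((isContinuous_iff F.obj).1 F.property) f)
    refine ⟨t, smoothCoord_injective hE F.obj U ?_⟩
    rw [smoothCoord_tensorCoindSec, ht]

variable {F} in
-- One statement covers all compatibilities. The reindexing `r` is the identity for restriction and
-- functoriality, right translation for the action, and left translation by Frobenius for the shift.
lemma tensorCoindSec_map {F' : TGHat p E} {U V : Ebar p E}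
    (f₁ : (coindInt hE).obj.sec U →ₗ[ℤ] (coindInt hE).obj.sec V)
    (f₂ : F.obj.sec U →ₗ[ℤ] F'.obj.sec V)
    (f : ((coindHat hE).obj F.obj.sheaf).obj.sec U → ((coindHat hE).obj F'.obj.sheaf).obj.sec V)
    (r : GHat k → GHat k)
    (h₁ : ∀ θ g, intCoord hE V (f₁ θ) g = intCoord hE U θ (r g))
    (h : ∀ y g, smoothCoord hE F'.obj V (f y) g = f₂ (smoothCoord hE F.obj U y (r g)))
    (t : TensorProduct ℤ ((coindInt hE).obj.sec U) (F.obj.sec U)) :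
    tensorCoindSec hE F' V (TensorProduct.map f₁ f₂ t) = f (tensorCoindSec hE F U t) := by
  apply smoothCoord_injective hE F'.obj V
  funext g
  rw [h, smoothCoord_tensorCoindSec, smoothCoord_tensorCoindSec, funTensor_map r f₁ f₂ h₁]

/-- The map from the objectwise tensor product with the sheaf coinduced from `ℤ` to the coinduced
sheaf. -/
def tensorCoindPsh : ((coindInt hE).obj.pshTensor F.obj).psh ⟶
    ((coindHat hE).obj F.obj.sheaf).obj.sheaf.obj :=
  pshHom (P := ((coindInt hE).obj.pshTensor F.obj).psh) (tensorCoindSec hE F) fun {U V} a t =>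
    tensorCoindSec_map hE
      (AddMonoidHom.toIntLinearMap (res (coindInt hE).obj.sheaf.obj a))
      (AddMonoidHom.toIntLinearMap (res F.obj.sheaf.obj a)) _ id
      (fun θ g => intCoord_res hE a θ g) (fun y g => smoothCoord_res hE F.obj a y g) t

/-- The map from the tensor product with the sheaf coinduced from `ℤ` to the coinduced sheaf. -/
def tensorCoindSheaf : (((EqSheaf.tensor p E ⊤).obj (coindInt hE).obj).obj F.obj).sheaf ⟶
    ((coindHat hE).obj F.obj.sheaf).obj.sheaf :=
  ⟨sheafifyLift (etaleTopology p E) (tensorCoindPsh hE F)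
    ((coindHat hE).obj F.obj.sheaf).obj.sheaf.property⟩

lemma toSheafify_tensorCoindSheaf :
    toSheafify (etaleTopology p E) ((coindInt hE).obj.pshTensor F.obj).psh ≫
      (tensorCoindSheaf hE F).hom = tensorCoindPsh hE F := toSheafify_sheafifyLift _ _ _

lemma tensorCoindPsh_comm (g : (⊤ : Subgroup (GHat k))) :
    ((coindInt hE).obj.pshTensor F.obj).τ g ≫
      Functor.whiskerLeft (twist p E g).op (tensorCoindPsh hE F) =
    tensorCoindPsh hE F ≫ (((coindHat hE).obj F.obj.sheaf).obj.σ g).hom := by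
  apply psh_hom_ext
  intro U t
  refine (tensorCoindSec_map hE (F' := F) (U := U) (V := (twist p E g).obj U)
    (AddMonoidHom.toIntLinearMap (ap ((coindInt hE).obj.σ g).hom U))
    (AddMonoidHom.toIntLinearMap (ap (F.obj.σ g).hom U))
    (ap (((coindHat hE).obj F.obj.sheaf).obj.σ g).hom U) (fun h => h * g) (fun θ h => ?_)
    (fun y h => ?_) t)
  · refine Eq.trans ?_ (intCoord_tr hE g (twId p E g U) (twId_hom p E g U) θ h)
    exact congrArg (fun x => intCoord hE ((twist p E g).obj U) x h)
      ((coindInt hE).obj.tr_id g θ).symm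
  · refine Eq.trans ?_ ((smoothCoord_tr hE F.obj g (twId p E g U) (twId_hom p E g U) y h).trans ?_)
    · exact congrArg (fun x => smoothCoord hE F.obj ((twist p E g).obj U) x h)
        (((coindHat hE).obj F.obj.sheaf).obj.tr_id g y).symm
    · exact F.obj.tr_id g (smoothCoord hE F.obj U y (h * g))

/-- The map from the tensor product with the sheaf coinduced from `ℤ` to the coinduced sheaf. -/
def tensorCoind : ((EqSheaf.tensor p E ⊤).obj (coindInt hE).obj).obj F.obj ⟶
    ((coindHat hE).obj F.obj.sheaf).obj where
  hom := tensorCoindSheaf hE F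
  comm g := by
    apply EqPresheaf.sheaf_hom_ext
    have h1 := toSheafify_tensorCoindSheaf hE F
    have h2 : toSheafify (etaleTopology p E) ((coindInt hE).obj.pshTensor F.obj).psh ≫
      ((((EqSheaf.tensor p E ⊤).obj (coindInt hE).obj).obj F.obj).σ g).hom = _ :=
        toSheafify_sheafifyLift _ _ _
    refine (Category.assoc _ _ _).symm.trans ((congrArg (· ≫ _) h2).trans ?_)
    refine Eq.trans ?_ (Category.assoc _ _ _)
    refine Eq.trans ?_ (congrArg (· ≫ (((coindHat hE).obj F.obj.sheaf).obj.σ g).hom) h1).symm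
    refine Eq.trans ?_ (tensorCoindPsh_comm hE F g)
    refine (Category.assoc _ _ _).trans (congrArg (_ ≫ ·) ?_)
    exact congrArg (Functor.whiskerLeft (twist p E g).op) h1

/-- The presheaf tensor product is already a sheaf here, being isomorphic to one sectionwise, so
sheafification changes nothing. -/
instance : IsIso (tensorCoind hE F) := by
  have h1 : IsIso (tensorCoindPsh hE F) :=
    isIso_of_ap_bijective _ (tensorCoindSec_bijective hE F)
  have h2 : Presheaf.IsSheaf (etaleTopology p E) ((coindInt hE).obj.pshTensor F.obj).psh :=
    (Presheaf.isSheaf_of_iso_iff (asIso (tensorCoindPsh hE F))).2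
      ((coindHat hE).obj F.obj.sheaf).obj.sheaf.property
  have h3 := isIso_toSheafify _ h2
  have h4 : IsIso (tensorCoindSheaf hE F).hom := by
    have h5 := toSheafify_tensorCoindSheaf hE F
    rw [← h5] at h1
    exact IsIso.of_isIso_comp_left
      (toSheafify (etaleTopology p E) ((coindInt hE).obj.pshTensor F.obj).psh) _
  have h6 : IsIso (tensorCoind hE F).hom := by
    have h7 : IsIso ((sheafToPresheaf _ _).map (tensorCoindSheaf hE F)) := h4
    exact isIso_of_reflects_iso (tensorCoindSheaf hE F) (sheafToPresheaf _ _)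
  exact EqSheaf.isIso_of_hom _

variable {F} in
lemma tensorMap_tensorCoind {F' : TGHat p E} (φ : (coindInt hE).obj ⟶ (coindInt hE).obj)
    (α : F.obj ⟶ F'.obj)
    (β : ((coindHat hE).obj F.obj.sheaf).obj ⟶ ((coindHat hE).obj F'.obj.sheaf).obj)
    (r : GHat k → GHat k)
    (h₁ : ∀ (U : Ebar p E) θ g, intCoord hE U (ap φ.hom.hom U θ) g = intCoord hE U θ (r g))
    (h : ∀ (U : Ebar p E) y g, smoothCoord hE F'.obj U (ap β.hom.hom U y) g =
      ap α.hom.hom U (smoothCoord hE F.obj U y (r g))) :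
    EqSheaf.tensorMap φ α ≫ tensorCoind hE F' = tensorCoind hE F ≫ β := by
  apply EqSheaf.hom_ext
  apply EqPresheaf.sheaf_hom_ext
  have h1 := toSheafify_naturality (etaleTopology p E) (pshTensorMap φ.hom.hom α.hom.hom)
  refine (Category.assoc _ _ _).symm.trans ((congrArg (· ≫ _) h1.symm).trans ?_)
  refine (Category.assoc _ _ _).trans ((congrArg (_ ≫ ·) (toSheafify_tensorCoindSheaf hE F')).trans ?_)
  refine Eq.trans ?_ (Category.assoc _ _ _)
  refine Eq.trans ?_ (congrArg (· ≫ β.hom.hom) (toSheafify_tensorCoindSheaf hE F)).symm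
  apply psh_hom_ext
  intro U t
  exact tensorCoindSec_map hE (AddMonoidHom.toIntLinearMap (ap φ.hom.hom U))
    (AddMonoidHom.toIntLinearMap (ap α.hom.hom U)) (ap β.hom.hom U) r (h₁ U) (h U) t

lemma tensorCoind_naturality {F F' : TGHat p E} (α : F ⟶ F') :
    ((EqSheaf.tensor p E ⊤).obj (coindInt hE).obj).map α.hom ≫ tensorCoind hE F' =
      tensorCoind hE F ≫ ((coindHat hE).map α.hom.hom).hom :=
  tensorMap_tensorCoind hE (𝟙 _) α.hom _ id (fun _ _ _ => rfl)
    fun U y g => smoothCoord_map hE α.hom y g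

lemma tensorCoind_shift : ((EqSheaf.tensor p E ⊤).map
      (shiftHat hE (EqSheaf.constInt p E (weilGroup k))).hom).app F.obj ≫ tensorCoind hE F =
    tensorCoind hE F ≫ (shiftHat hE ((gammaUpper p E).obj F)).hom :=
  tensorMap_tensorCoind hE _ (𝟙 F.obj) _ (fun g => frobenius k * g)
    (fun _ θ g => intCoord_shift hE θ g) fun U y g => smoothCoord_shift hE F.obj y g

end tensorCoind
end WeilEtale
end

noncomputable section
namespace WeilEtale
-- The total tensor product with a two-term complex is a homotopy fibre.
section twoTermTensor

open HomologicalComplex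

variable {C₁ C₂ D : Type*} [Category* C₁] [Category* C₂] [Category* D] [HasZeroMorphisms C₁]
  [HasZeroMorphisms C₂] [Preadditive D] (F : C₁ ⥤ C₂ ⥤ D) [F.PreservesZeroMorphisms]
  [∀ A, (F.obj A).PreservesZeroMorphisms] (P : CochainComplex C₁ ℤ) (Q : CochainComplex C₂ ℤ)
  [HasMapBifunctor P Q F (ComplexShape.up ℤ)]

variable {F P Q} in
lemma isZero_bifunctor_obj {A : C₁} (hA : IsZero A) (B : C₂) : IsZero ((F.obj A).obj B) := by
  rw [IsZero.iff_id_eq_zero]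
  have h1 : (F.map (𝟙 A)).app B = 𝟙 _ := by rw [F.map_id, NatTrans.id_app]
  rw [← h1, (IsZero.iff_id_eq_zero A).1 hA, F.map_zero, zero_app]

/-- Projection to a summand of the total complex. -/
def mapBifunctorProj (a b n : ℤ) (hab : a + b = n) :
    (mapBifunctor P Q F (ComplexShape.up ℤ)).X n ⟶ (F.obj (P.X a)).obj (Q.X b) :=
  mapBifunctorDesc fun i j h => if hi : i = a then
    (F.map (P.XIsoOfEq hi).hom).app (Q.X j) ≫ (F.obj (P.X a)).map (Q.XIsoOfEq (by
      have : i + j = n := h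
      lia)).hom else 0

lemma ι_mapBifunctorProj_self (a b n : ℤ) (hab : a + b = n) :
    ιMapBifunctor P Q F (ComplexShape.up ℤ) a b n hab ≫ mapBifunctorProj F P Q a b n hab = 𝟙 _ := by
  rw [mapBifunctorProj, ι_mapBifunctorDesc]
  simp

lemma ι_mapBifunctorProj_of_ne (a b n : ℤ) (hab : a + b = n) (i j : ℤ) (hij : i + j = n)
    (h : i ≠ a) :
    ιMapBifunctor P Q F (ComplexShape.up ℤ) i j n hij ≫ mapBifunctorProj F P Q a b n hab = 0 := by
  rw [mapBifunctorProj, ι_mapBifunctorDesc, dif_neg h]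

section

variable {F P Q} (hP : ∀ i, i ≠ 0 → i ≠ 1 → IsZero (P.X i))
include hP

lemma mapBifunctorProj_total (m n : ℤ) (h : m + 1 = n) (h' : 1 + m = n) :
    mapBifunctorProj F P Q 0 n n (zero_add n) ≫
        ιMapBifunctor P Q F (ComplexShape.up ℤ) 0 n n (zero_add n) +
      mapBifunctorProj F P Q 1 m n h' ≫ ιMapBifunctor P Q F (ComplexShape.up ℤ) 1 m n h' = 𝟙 _ := by
  apply mapBifunctor.hom_ext
  intro i j hij
  have hij' : i + j = n := hij
  rw [Preadditive.comp_add, Category.comp_id]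
  by_cases h0 : i = 0
  · subst h0
    obtain rfl : j = n := by lia
    rw [← Category.assoc, ← Category.assoc, ι_mapBifunctorProj_self,
      ι_mapBifunctorProj_of_ne F P Q 1 m j _ 0 j _ zero_ne_one, zero_comp, add_zero,
      Category.id_comp]
  by_cases h1 : i = 1
  · subst h1
    obtain rfl : j = m := by lia
    rw [← Category.assoc, ← Category.assoc, ι_mapBifunctorProj_self,
      ι_mapBifunctorProj_of_ne F P Q 0 n n _ 1 j _ one_ne_zero, zero_comp, zero_add,
      Category.id_comp]
  exact (isZero_bifunctor_obj (hP i h0 h1) (Q.X j)).eq_of_src _ _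

omit hP in
lemma ι_zero_d (m n : ℤ) (h : m + 1 = n) (h' : 1 + m = n) :
    ιMapBifunctor P Q F (ComplexShape.up ℤ) 0 m m (zero_add m) ≫
        (mapBifunctor P Q F (ComplexShape.up ℤ)).d m n =
      (F.obj (P.X 0)).map (Q.d m n) ≫ ιMapBifunctor P Q F (ComplexShape.up ℤ) 0 n n (zero_add n) +
        (F.map (P.d 0 1)).app (Q.X m) ≫ ιMapBifunctor P Q F (ComplexShape.up ℤ) 1 m n h' := by
  rw [mapBifunctor.d_eq, Preadditive.comp_add, mapBifunctor.ι_D₁, mapBifunctor.ι_D₂,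
    mapBifunctor.d₁_eq P Q F (ComplexShape.up ℤ) (show (ComplexShape.up ℤ).Rel 0 1 from rfl) m n h',
    mapBifunctor.d₂_eq P Q F (ComplexShape.up ℤ) 0 (show (ComplexShape.up ℤ).Rel m n from h) n
      (zero_add n), add_comm]
  have h1 : (ComplexShape.up ℤ).ε₁ (ComplexShape.up ℤ) (ComplexShape.up ℤ) ((0, m) : ℤ × ℤ) = 1 := rfl
  have h2 : (ComplexShape.up ℤ).ε₂ (ComplexShape.up ℤ) (ComplexShape.up ℤ) ((0, m) : ℤ × ℤ) = 1 := rfl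
  rw [h1, h2, one_smul, one_smul]

/-- The Koszul sign in column 1 is −1, which is exactly the sign required by `FibData.inr_d`.
Nothing goes to column 2, which is zero. -/
lemma ι_one_d (m n l : ℤ) (h : m + 1 = n) (hn : 1 + m = n) (hl : 1 + n = l) :
    ιMapBifunctor P Q F (ComplexShape.up ℤ) 1 m n hn ≫
        (mapBifunctor P Q F (ComplexShape.up ℤ)).d n l =
      - ((F.obj (P.X 1)).map (Q.d m n) ≫ ιMapBifunctor P Q F (ComplexShape.up ℤ) 1 n l hl) := by
  have h2 : P.d 1 2 = 0 := (hP 2 (by decide) (by decide)).eq_of_tgt _ _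
  rw [mapBifunctor.d_eq, Preadditive.comp_add, mapBifunctor.ι_D₁, mapBifunctor.ι_D₂,
    mapBifunctor.d₁_eq P Q F (ComplexShape.up ℤ) (show (ComplexShape.up ℤ).Rel 1 2 from rfl) m l
      (by change (2 : ℤ) + m = l; lia),
    mapBifunctor.d₂_eq P Q F (ComplexShape.up ℤ) 1 (show (ComplexShape.up ℤ).Rel m n from h) l
      hl, h2, F.map_zero, zero_app, zero_comp, smul_zero, zero_add]
  have h3 : (ComplexShape.up ℤ).ε₂ (ComplexShape.up ℤ) (ComplexShape.up ℤ) ((1, m) : ℤ × ℤ) = -1 :=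
    Int.negOnePow_one
  rw [h3, Units.neg_smul, one_smul]

end

/-- The total tensor product with a complex concentrated in degrees `0` and `1` is a homotopy fibre. -/
def twoTermFibData (hP : ∀ i, i ≠ 0 → i ≠ 1 → IsZero (P.X i)) :
    FibData ((NatTrans.mapHomologicalComplex (F.map (P.d 0 1)) (ComplexShape.up ℤ)).app Q)
      (mapBifunctor P Q F (ComplexShape.up ℤ)) where
  inl n := ιMapBifunctor P Q F (ComplexShape.up ℤ) 0 n n (zero_add n)
  inr m n h := ιMapBifunctor P Q F (ComplexShape.up ℤ) 1 m n ((add_comm 1 m).trans h)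
  fst n := mapBifunctorProj F P Q 0 n n (zero_add n)
  snd m n h := mapBifunctorProj F P Q 1 m n ((add_comm 1 m).trans h)
  inl_fst n := ι_mapBifunctorProj_self F P Q 0 n n _
  inl_snd m n h := ι_mapBifunctorProj_of_ne F P Q 1 m n _ 0 n _ zero_ne_one
  inr_fst m n h := ι_mapBifunctorProj_of_ne F P Q 0 n n _ 1 m _ one_ne_zero
  inr_snd m n h := ι_mapBifunctorProj_self F P Q 1 m n _
  total m n h := mapBifunctorProj_total hP m n h _
  inl_d m n h := ι_zero_d m n h _
  inr_d m n l h h' := ι_one_d hP m n l h _ _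

end twoTermTensor
end WeilEtale
end

noncomputable section
namespace WeilEtale

namespace FibData

/-! ### Homotopy fibres between complexes concentrated in one degree. -/

section concentrated

variable {C : Type*} [Category* C] [Preadditive C] {K L : CochainComplex C ℤ} {φ : K ⟶ L}
  {X : CochainComplex C ℤ} (F : FibData φ X)
include F

lemma isZero (m n : ℤ) (h : m + 1 = n) (hK : IsZero (K.X n)) (hL : IsZero (L.X m)) :
    IsZero (X.X n) := by
  rw [IsZero.iff_id_eq_zero, ← F.total m n h, hK.eq_of_tgt (F.fst n) 0, hL.eq_of_tgt (F.snd m n h) 0,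
    zero_comp, zero_comp, add_zero]

omit F in
/-- The homotopy fibre agrees with the source in a degree where the target does not contribute. -/
def inlIso (F : FibData φ X) (m n : ℤ) (h : m + 1 = n) (hL : IsZero (L.X m)) : K.X n ≅ X.X n where
  hom := F.inl n
  inv := F.fst n
  hom_inv_id := F.inl_fst n
  inv_hom_id := by
    rw [← F.total m n h, hL.eq_of_tgt (F.snd m n h) 0, zero_comp, add_zero]

omit F in
/-- The homotopy fibre agrees with the target in a degree where the source does not contribute. -/
def inrIso (F : FibData φ X) (m n : ℤ) (h : m + 1 = n) (hK : IsZero (K.X n)) : L.X m ≅ X.X n where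
  hom := F.inr m n h
  inv := F.snd m n h
  hom_inv_id := F.inr_snd m n h
  inv_hom_id := by
    rw [← F.total m n h, hK.eq_of_tgt (F.fst n) 0, zero_comp, zero_add]

lemma inlIso_d (l m n : ℤ) (hl : l + 1 = m) (h : m + 1 = n) (hL : IsZero (L.X l))
    (hK : IsZero (K.X n)) :
    (F.inlIso l m hl hL).hom ≫ X.d m n = φ.f m ≫ (F.inrIso m n h hK).hom := by
  refine (F.inl_d m n h).trans ?_
  rw [hK.eq_of_tgt (K.d m n) 0, zero_comp, zero_add]
  rfl

end concentrated

end FibData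

/-- With its converse below, this expresses acyclicity as a property of the zero endomorphism.
Additive constructions that preserve quasi-isomorphisms then preserve acyclic complexes. -/
lemma acyclic_of_quasiIso_zero {S : Type*} [Category* S] [Abelian S] {K : CochainComplex S ℤ}
    (h : QuasiIso (0 : K ⟶ K)) : K.Acyclic := by
  intro n
  rw [HomologicalComplex.exactAt_iff_isZero_homology, IsZero.iff_id_eq_zero]
  have h1 : IsIso (HomologicalComplex.homologyMap (0 : K ⟶ K) n) := inferInstance
  rw [HomologicalComplex.homologyMap_zero] at h1
  rw [← IsIso.hom_inv_id (0 : K.homology n ⟶ K.homology n), zero_comp]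

lemma quasiIso_zero_of_acyclic {S : Type*} [Category* S] [Abelian S] {K : CochainComplex S ℤ}
    (h : K.Acyclic) : QuasiIso (0 : K ⟶ K) := by
  rw [quasiIso_iff]
  exact fun n => (quasiIsoAt_iff_exactAt' (0 : K ⟶ K) n (h n)).2 (h n)

/-! ### Compatibility of the tensor isomorphism with shift − 1 and the direct image. -/

section tensorResolution

variable {k : Type u} [Field k] [Fintype k] {X : Scheme.{u}} {p : X ⟶ Spec (.of k)}
  {E : ObjectProperty (Over X)}

lemma EqSheaf.tensorMap_sub_id {Γ : Subgroup (GHat k)} {F F' F'' : EqSheaf p E Γ} (f g : F ⟶ F') :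
    tensorMap (f - g) (𝟙 F'') = tensorMap f (𝟙 F'') - tensorMap g (𝟙 F'') := by
  have h1 : pshTensorMap (f - g).hom.hom (𝟙 F''.sheaf.obj) =
      pshTensorMap f.hom.hom (𝟙 F''.sheaf.obj) - pshTensorMap g.hom.hom (𝟙 F''.sheaf.obj) := by
    ext U : 2
    refine ab_tensor_hom_ext fun a b => ?_
    exact TensorProduct.sub_tmul _ _ _
  apply EqSheaf.hom_ext
  refine (congrArg (presheafToSheaf (etaleTopology p E) _).map h1).trans ?_
  exact (presheafToSheaf (etaleTopology p E) AddCommGrpCat.{u + 1}).map_sub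

variable (hE : IsAdmissible p E)

/-- The shift by Frobenius on the sheaf coinduced from `ℤ`. -/
def intFrob : (coindInt hE).obj ⟶ (coindInt hE).obj :=
  (shiftHat hE (EqSheaf.constInt p E (weilGroup k))).hom

/-- The shift by Frobenius on the smooth coinduced sheaf. -/
def coindHatFrob (F : TGHat p E) :
    ((coindHat hE).obj F.obj.sheaf).obj ⟶ ((coindHat hE).obj F.obj.sheaf).obj :=
  (shiftHat hE ((gammaUpper p E).obj F)).hom

/-- Frobenius minus the identity on the sheaf coinduced from `ℤ`. -/
abbrev intShift : (coindInt hE).obj ⟶ (coindInt hE).obj := intFrob hE - 𝟙 (coindInt hE).obj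

/-- Frobenius minus the identity on the smooth coinduced sheaf. -/
abbrev coindHatShift (F : TGHat p E) :
    ((coindHat hE).obj F.obj.sheaf).obj ⟶ ((coindHat hE).obj F.obj.sheaf).obj :=
  coindHatFrob hE F - 𝟙 ((coindHat hE).obj F.obj.sheaf).obj

lemma tensorCoind_intShift (F : TGHat p E) :
    ((EqSheaf.tensor p E ⊤).map (intShift hE)).app F.obj ≫ tensorCoind hE F =
      tensorCoind hE F ≫ coindHatShift hE F := by
  have h1 : ((EqSheaf.tensor p E ⊤).map (intShift hE)).app F.obj =
      ((EqSheaf.tensor p E ⊤).map (intFrob hE)).app F.obj - 𝟙 _ :=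
    (EqSheaf.tensorMap_sub_id _ _).trans
      (congrArg (_ - ·) (EqSheaf.tensorMap_id (coindInt hE).obj F.obj))
  have h2 : ((EqSheaf.tensor p E ⊤).map (intFrob hE)).app F.obj ≫ tensorCoind hE F =
    tensorCoind hE F ≫ coindHatFrob hE F := tensorCoind_shift hE F
  rw [h1, Preadditive.sub_comp, Preadditive.comp_sub, h2, Category.id_comp, Category.comp_id]

variable [(gammaUpper p E).IsLeftAdjoint]

/-- The smooth coinduced sheaf as the direct image of the coinduced sheaf. -/
def coindHatObjIso (F : TGHat p E) : ((coindHat hE).obj F.obj.sheaf).obj ≅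
    ((gammaLower p E).obj ((coindMonad p E).obj ((gammaUpper p E).obj F))).obj :=
  (isContinuous p E).ι.mapIso ((coindHatIso hE).app F.obj.sheaf)

lemma coindHatObjIso_naturality {F F' : TGHat p E} (α : F ⟶ F') :
    ((coindHat hE).map α.hom.hom).hom ≫ (coindHatObjIso hE F').hom = (coindHatObjIso hE F).hom ≫
      ((gammaLower p E).map ((coindMonad p E).map ((gammaUpper p E).map α))).hom :=
  congrArg (fun t => t.hom) ((coindHatIso hE).hom.naturality α.hom.hom)

lemma coindHatObjIso_shift (F : TGHat p E) :
    coindHatShift hE F ≫ (coindHatObjIso hE F).hom = (coindHatObjIso hE F).hom ≫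
      ((gammaLower p E).map ((shiftDiff p E).app ((gammaUpper p E).obj F))).hom := by
  have h1 : ∀ {W : TG p E} (s : W ⟶ W), ((gammaLower p E).map (s - 𝟙 W)).hom =
      ((gammaLower p E).map s).hom - 𝟙 ((gammaLower p E).obj W).obj := fun {W} s => by
    rw [Functor.map_sub, CategoryTheory.Functor.map_id]
    rfl
  have h2 : coindHatFrob hE F ≫ (coindHatObjIso hE F).hom = (coindHatObjIso hE F).hom ≫
      ((gammaLower p E).map (shift le_rfl (weilGen k) ((gammaUpper p E).obj F) :
        (coindMonad p E).obj ((gammaUpper p E).obj F) ⟶ _)).hom :=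
    congrArg (fun t => t.hom) (coindHatIso_shift hE ((gammaUpper p E).obj F)).symm
  refine Eq.trans ?_ (congrArg ((coindHatObjIso hE F).hom ≫ ·) (h1 _).symm)
  rw [Preadditive.sub_comp, Preadditive.comp_sub, Category.id_comp, Category.comp_id, h2]
  rfl

variable {A B : EqSheaf p E ⊤}

/-- The tensor product with a sheaf isomorphic to that coinduced from `ℤ`. -/
def tensorIso (a : (coindInt hE).obj ≅ A) (F : TGHat p E) :
    ((EqSheaf.tensor p E ⊤).obj A).obj F.obj ≅
      ((gammaLower p E).obj ((coindMonad p E).obj ((gammaUpper p E).obj F))).obj :=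
  ((EqSheaf.tensor p E ⊤).mapIso a.symm).app F.obj ≪≫ asIso (tensorCoind hE F) ≪≫
    coindHatObjIso hE F

lemma tensorIso_hom (a : (coindInt hE).obj ≅ A) (F : TGHat p E) : (tensorIso hE a F).hom =
    ((EqSheaf.tensor p E ⊤).map a.inv).app F.obj ≫ tensorCoind hE F ≫ (coindHatObjIso hE F).hom := rfl

lemma tensorIso_naturality (a : (coindInt hE).obj ≅ A) {F F' : TGHat p E} (α : F ⟶ F') :
    ((EqSheaf.tensor p E ⊤).obj A).map α.hom ≫ (tensorIso hE a F').hom = (tensorIso hE a F).hom ≫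
      ((gammaLower p E).map ((coindMonad p E).map ((gammaUpper p E).map α))).hom := by
  have h1 := ((EqSheaf.tensor p E ⊤).map a.inv).naturality α.hom
  rw [tensorIso_hom, tensorIso_hom, reassoc_of% h1, reassoc_of% (tensorCoind_naturality hE α),
    coindHatObjIso_naturality, Category.assoc, Category.assoc]

/-- `A` and `B` will be the degree 0 and degree 1 terms representing Rγ_*ℤ. They are only isomorphic
to the sheaf coinduced from ℤ, so the isomorphisms are carried along. -/
lemma tensorIso_shift (a : (coindInt hE).obj ≅ A) (b : (coindInt hE).obj ≅ B) (d : A ⟶ B)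
    (h : a.hom ≫ d = intShift hE ≫ b.hom) (F : TGHat p E) :
    ((EqSheaf.tensor p E ⊤).map d).app F.obj ≫ (tensorIso hE b F).hom = (tensorIso hE a F).hom ≫
      ((gammaLower p E).map ((shiftDiff p E).app ((gammaUpper p E).obj F))).hom := by
  have h' : d ≫ b.inv = a.inv ≫ intShift hE := by
    rw [Iso.comp_inv_eq, Category.assoc, ← h, Iso.inv_hom_id_assoc]
  have h1 : ((EqSheaf.tensor p E ⊤).map d).app F.obj ≫ ((EqSheaf.tensor p E ⊤).map b.inv).app F.obj =
      ((EqSheaf.tensor p E ⊤).map a.inv).app F.obj ≫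
        ((EqSheaf.tensor p E ⊤).map (intShift hE)).app F.obj := by
    rw [← NatTrans.comp_app, ← NatTrans.comp_app, ← Functor.map_comp, ← Functor.map_comp, h']
  rw [tensorIso_hom, tensorIso_hom, reassoc_of% h1, reassoc_of% (tensorCoind_intShift hE F),
    coindHatObjIso_shift, Category.assoc, Category.assoc]

end tensorResolution
end WeilEtale
end

noncomputable section
namespace WeilEtale
-- The two sides of the projection formula as the same homotopy fibre.
section derivedTensor

variable {k : Type u} [Field k] [Fintype k] {X : Scheme.{u}} {p : X ⟶ Spec (.of k)}
  {E : ObjectProperty (Over X)} (hE : IsAdmissible p E) [(gammaUpper p E).IsLeftAdjoint]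

/-- The sheaf smoothly coinduced from `ℤ` as the direct image of the coinduced sheaf. -/
def coindIntIso : (coindInt hE).obj ≅
    ((gammaLower p E).obj ((coindMonad p E).obj (EqSheaf.constInt p E (weilGroup k)))).obj :=
  (isContinuous p E).ι.mapIso ((coindHatIso hE).app (EqSheaf.constInt p E (weilGroup k)).sheaf)

lemma coindIntIso_shift : intShift hE ≫ (coindIntIso hE).hom = (coindIntIso hE).hom ≫
    ((gammaLower p E).map ((shiftDiff p E).app (EqSheaf.constInt p E (weilGroup k)))).hom := by
  have h1 : ∀ {W : TG p E} (s : W ⟶ W), ((gammaLower p E).map (s - 𝟙 W)).hom =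
      ((gammaLower p E).map s).hom - 𝟙 ((gammaLower p E).obj W).obj := fun {W} s => by
    rw [Functor.map_sub, CategoryTheory.Functor.map_id]
    rfl
  have h2 : intFrob hE ≫ (coindIntIso hE).hom = (coindIntIso hE).hom ≫
      ((gammaLower p E).map (shift le_rfl (weilGen k) (EqSheaf.constInt p E (weilGroup k)) :
        (coindMonad p E).obj (EqSheaf.constInt p E (weilGroup k)) ⟶ _)).hom :=
    congrArg (fun t => t.hom) (coindHatIso_shift hE (EqSheaf.constInt p E (weilGroup k))).symm
  refine Eq.trans ?_ (congrArg ((coindIntIso hE).hom ≫ ·) (h1 _).symm)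
  rw [Preadditive.sub_comp, Preadditive.comp_sub, Category.id_comp, Category.comp_id, h2]
  rfl

variable (p E)

/-- The functor `γ_*` composed with the functorial resolution, on complexes of Weil-étale sheaves. -/
abbrev gammaResolution : CochainComplex (TG p E) ℤ ⥤ CochainComplex (TGHat p E) ℤ :=
  resolution (shiftDiff p E) ⋙ (gammaLower p E).mapHomologicalComplex (ComplexShape.up ℤ)

/-- The underlying complex of sheaves with action of a complex of étale sheaves. -/
abbrev complexι : CochainComplex (TGHat p E) ℤ ⥤
    CochainComplex (EqSheaf p E (⊤ : Subgroup (GHat k))) ℤ :=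
  (isContinuous p E).ι.mapHomologicalComplex (ComplexShape.up ℤ)

variable {p E}

/-- The complex computing `Rγ_*` is a homotopy fibre. -/
def gammaFibData (K : CochainComplex (TG p E) ℤ) :
    FibData ((complexι p E).map (((gammaLower p E).mapHomologicalComplex (ComplexShape.up ℤ)).map
      (cplxMap (shiftDiff p E) K))) ((complexι p E).obj ((gammaResolution p E).obj K)) :=
  ((fibData (cplxMap (shiftDiff p E) K)).map (gammaLower p E)).map (isContinuous p E).ι

variable (p E)

/-- The constant sheaf `ℤ` as a complex of Weil-étale sheaves. -/
abbrev intComplex : CochainComplex (TG p E) ℤ :=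
  (HomologicalComplex.single (TG p E) (ComplexShape.up ℤ) 0).obj
    (EqSheaf.constInt p E (weilGroup k))

/-- The complex representing `Rγ_* ℤ`. -/
abbrev gammaInt : CochainComplex (TGHat p E) ℤ := (gammaResolution p E).obj (intComplex p E)

variable {p E}

lemma isZero_gammaInt_aux (n : ℤ) (hn : n ≠ 0) :
    IsZero (((gammaLower p E).obj ((coindMonad p E).obj ((intComplex p E).X n))).obj) := by
  have h1 : IsZero ((intComplex p E).X n) :=
    HomologicalComplex.isZero_single_obj_X (ComplexShape.up ℤ) 0 _ n hn
  exact (isContinuous p E).ι.map_isZero ((gammaLower p E).map_isZero ((coindMonad p E).map_isZero h1))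

lemma isZero_gammaInt (i : ℤ) (h0 : i ≠ 0) (h1 : i ≠ 1) :
    IsZero (((complexι p E).obj (gammaInt p E)).X i) :=
  (gammaFibData (intComplex p E)).isZero (i - 1) i (by lia) (isZero_gammaInt_aux i h0)
    (isZero_gammaInt_aux (i - 1) (by lia))

/-- The degree `0` part of the complex representing `Rγ_* ℤ`. -/
def gammaIntZero : (coindInt hE).obj ≅ ((complexι p E).obj (gammaInt p E)).X 0 :=
  coindIntIso hE ≪≫ ((coindMonad p E) ⋙ gammaLower p E ⋙ (isContinuous p E).ι).mapIso
    (HomologicalComplex.singleObjXSelf (ComplexShape.up ℤ) 0 _).symm ≪≫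
    (gammaFibData (intComplex p E)).inlIso (-1) 0 (by lia) (isZero_gammaInt_aux (-1) (by lia))

/-- The degree `1` part of the complex representing `Rγ_* ℤ`. -/
def gammaIntOne : (coindInt hE).obj ≅ ((complexι p E).obj (gammaInt p E)).X 1 :=
  coindIntIso hE ≪≫ ((coindMonad p E) ⋙ gammaLower p E ⋙ (isContinuous p E).ι).mapIso
    (HomologicalComplex.singleObjXSelf (ComplexShape.up ℤ) 0 _).symm ≪≫
    (gammaFibData (intComplex p E)).inrIso 0 1 (by lia) (isZero_gammaInt_aux 1 (by lia))

/-- Up to isomorphism, the complex representing Rγ_*ℤ is shift − 1 on the sheaf smoothly coinduced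
from ℤ, in degrees 0 and 1. -/
lemma gammaIntZero_d : (gammaIntZero hE).hom ≫ ((complexι p E).obj (gammaInt p E)).d 0 1 =
    intShift hE ≫ (gammaIntOne hE).hom := by
  have h1 := (gammaFibData (intComplex p E)).inlIso_d (-1) 0 1 (by lia) (by lia)
    (isZero_gammaInt_aux (-1) (by lia)) (isZero_gammaInt_aux 1 (by lia))
  have h2 : ((coindMonad p E) ⋙ gammaLower p E ⋙ (isContinuous p E).ι).map
        (HomologicalComplex.singleObjXSelf (ComplexShape.up ℤ) 0
          (EqSheaf.constInt p E (weilGroup k))).inv ≫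
      ((gammaLower p E).map ((shiftDiff p E).app ((intComplex p E).X 0))).hom =
      ((gammaLower p E).map ((shiftDiff p E).app (EqSheaf.constInt p E (weilGroup k)))).hom ≫
      ((coindMonad p E) ⋙ gammaLower p E ⋙ (isContinuous p E).ι).map
        (HomologicalComplex.singleObjXSelf (ComplexShape.up ℤ) 0
          (EqSheaf.constInt p E (weilGroup k))).inv :=
    (Functor.whiskerRight (shiftDiff p E) (gammaLower p E ⋙ (isContinuous p E).ι)).naturality _
  have key : ∀ {A B C D D' : EqSheaf p E ⊤} (s : A ⟶ A) (a : A ⟶ B) (d : B ⟶ B) (b : B ⟶ C)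
      (f : C ⟶ C) (i : C ⟶ D) (j : C ⟶ D') (d' : D ⟶ D'), i ≫ d' = f ≫ j → b ≫ f = d ≫ b →
      s ≫ a = a ≫ d → (a ≫ b ≫ i) ≫ d' = s ≫ a ≫ b ≫ j := by
    intro A B C D D' s a d b f i j d' e1 e2 e3
    rw [Category.assoc, Category.assoc, e1, reassoc_of% e2, reassoc_of% e3]
  exact key _ _ _ _ _ _ _ _ h1 h2 (coindIntIso_shift hE)

variable (𝒢 : CochainComplex (TGHat p E) ℤ)

/-- The restriction `γ^*` on complexes. -/
abbrev gammaUpperComplex : CochainComplex (TG p E) ℤ :=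
  ((gammaUpper p E).mapHomologicalComplex (ComplexShape.up ℤ)).obj 𝒢

/-- The tensor product of a complex with a sheaf isomorphic to that coinduced from `ℤ`. -/
def tensorComplexIso {A : EqSheaf p E ⊤} (a : (coindInt hE).obj ≅ A) :
    ((((EqSheaf.tensor p E ⊤).obj A).mapHomologicalComplex (ComplexShape.up ℤ)).obj
      ((complexι p E).obj 𝒢)) ≅ (complexι p E).obj
      (((gammaLower p E).mapHomologicalComplex (ComplexShape.up ℤ)).obj
        (((coindMonad p E).mapHomologicalComplex (ComplexShape.up ℤ)).obj (gammaUpperComplex 𝒢))) :=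
  HomologicalComplex.Hom.isoOfComponents (fun n => tensorIso hE a (𝒢.X n)) fun m n _ =>
    (tensorIso_naturality hE a (𝒢.d m n)).symm

/-- The total tensor product with the complex representing `Rγ_* ℤ`. -/
def totalTensorIso : (complexι p E).obj ((gammaResolution p E).obj (gammaUpperComplex 𝒢)) ≅
    EqSheaf.totalTensor ((complexι p E).obj (gammaInt p E)) ((complexι p E).obj 𝒢) :=
  -- Both complexes are homotopy fibres, one of d ⊗ 1 and the other of γ_*(shift − 1). The
  -- identifications in degrees 0 and 1 intertwine these two maps.
  ((twoTermFibData (EqSheaf.tensor p E ⊤) ((complexι p E).obj (gammaInt p E))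
    ((complexι p E).obj 𝒢) isZero_gammaInt).isoOfIso (gammaFibData (gammaUpperComplex 𝒢))
    (tensorComplexIso hE 𝒢 (gammaIntZero hE)) (tensorComplexIso hE 𝒢 (gammaIntOne hE)) (by
      ext n : 1
      exact (tensorIso_shift hE (gammaIntZero hE) (gammaIntOne hE) _ (gammaIntZero_d hE)
        (𝒢.X n)).symm)).symm

include hE in
-- An acyclic complex has a zero endomorphism that is a quasi-isomorphism. γ_* composed with the
-- resolution preserves quasi-isomorphisms and zero, so the result is acyclic too.
lemma acyclic_gammaResolution (h : Acyclic ((complexι p E).obj 𝒢)) :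
    Acyclic ((complexι p E).obj ((gammaResolution p E).obj (gammaUpperComplex 𝒢))) := by
  have h1 : qisOf (underlying p E) (0 : gammaUpperComplex 𝒢 ⟶ gammaUpperComplex 𝒢) := by
    change QuasiIso _
    rw [Functor.map_zero]
    exact quasiIso_zero_of_acyclic h
  have h2 : qisOf (gammaLower p E ⋙ underlyingHat p E)
      ((resolution (shiftDiff p E)).map (0 : gammaUpperComplex 𝒢 ⟶ gammaUpperComplex 𝒢)) :=
    qisOf_resolution_map (shiftDiff p E) (gammaLower p E) (underlyingHat p E) _
      (qisOf_coindMonad hE _ h1)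
  have h3 : (resolution (shiftDiff p E)).map (0 : gammaUpperComplex 𝒢 ⟶ gammaUpperComplex 𝒢) = 0 := by
    apply (fibData (cplxMap (shiftDiff p E) (gammaUpperComplex 𝒢))).complex_hom_ext
    · intro n
      refine (FibData.inl_desc _ _ _ _ (cplxMap_naturality _ _) n).trans ?_
      rw [Functor.map_zero]
      exact zero_comp.trans comp_zero.symm
    · intro m n hmn
      refine (FibData.inr_desc _ _ _ _ (cplxMap_naturality _ _) m n hmn).trans ?_
      rw [Functor.map_zero]
      exact zero_comp.trans comp_zero.symm
  rw [h3] at h2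
  have h4 : QuasiIso (((gammaLower p E ⋙ underlyingHat p E).mapHomologicalComplex
    (ComplexShape.up ℤ)).map (0 : (resolution (shiftDiff p E)).obj (gammaUpperComplex 𝒢) ⟶ _)) := h2
  rw [Functor.map_zero] at h4
  exact acyclic_of_quasiIso_zero h4

include hE in
-- The tensor product with 𝒞 is the complex computing Rγ_*γ^*𝒞, which depends on 𝒞 exactly. Flatness
-- of the individual terms is not needed.
lemma kFlat_gammaInt : KFlat (gammaInt p E) := by
  intro 𝒞 h
  have h1 := acyclic_gammaResolution hE 𝒞 h
  exact fun n => (h1 n).of_iso (((EqSheaf.forget p E ⊤).mapHomologicalComplex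
    (ComplexShape.up ℤ)).mapIso (totalTensorIso hE 𝒞))

include hE in
-- The K-flat representative is the resolved complex for ℤ. 𝒢 represents itself, and the total
-- tensor product is the resolved complex for γ^*𝒢.
lemma isDerivedTensor_gammaInt [(gammaLowerComplex p E).HasRightDerivedFunctor (qisG p E)] :
    IsDerivedTensor ((RGamma p E).obj ((QG p E).obj (intComplex p E))) ((QHat p E).obj 𝒢)
      ((RGamma p E).obj ((QG p E).obj (gammaUpperComplex 𝒢))) :=
  ⟨gammaInt p E, 𝒢, (gammaResolution p E).obj (gammaUpperComplex 𝒢), kFlat_gammaInt hE,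
    nonempty_RGamma_iso hE _, ⟨Iso.refl _⟩, ⟨totalTensorIso hE 𝒢⟩, nonempty_RGamma_iso hE _⟩

end derivedTensor
end WeilEtale
end

theorem mainTheorem1 (k : Type u) [Field k] [Fintype k] {X : Scheme.{u}}
    (p : X ⟶ Spec (.of k)) (E : ObjectProperty (Over X)) (hE : IsAdmissible p E) :
    ∃ (_ : (gammaUpper p E).IsLeftAdjoint)
      (_ : (gammaLowerComplex p E).HasRightDerivedFunctor (qisG p E)),
      ∀ 𝒢 : CochainComplex (TGHat p E) ℤ,
        IsDerivedTensor
          ((RGamma p E).obj ((QG p E).obj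
            ((HomologicalComplex.single (TG p E) (ComplexShape.up ℤ) 0).obj
              (EqSheaf.constInt p E (weilGroup k)))))
          ((QHat p E).obj 𝒢)
          ((RGamma p E).obj ((QG p E).obj
            (((gammaUpper p E).mapHomologicalComplex (ComplexShape.up ℤ)).obj 𝒢))) := by
  have h1 := gammaUpper_isLeftAdjoint hE
  have h2 := hasRightDerivedFunctor_gammaLower hE
  exact ⟨h1, h2, fun 𝒢 => isDerivedTensor_gammaInt hE 𝒢⟩
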